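/- **Theorem 2.5.** Let $n,m\ge 1$, and for $t>0$ let $\theta_t:\mathbb{R}^{(m+1)n}\to\mathbb{C}$ be kernels such that $(t,x,y_1,\dots,y_m)\mapsto\theta_t(x,y_1,\dots,y_m)$ is measurable and, for some $N>n$, $0<\gamma\le 1$ and $A<\infty$, $$|\theta_t(x,y_1,\dots,y_m)|\le A\prod_{i=1}^m\frac{t^{-n}}{(1+t^{-1}|x-y_i|)^N},$$ $$|\theta_t(x,y_1,\dots,y_m)-\theta_t(x,y_1,\dots,y_i',\dots,y_m)|\le A\,t^{-mn}\,(t^{-1}|y_i-y_i'|)^\gamma$$ for all $t>0$, $x,y_1,\dots,y_m,y_i'\in\mathbb{R}^n$ and $i=1,\dots,m$. Put $$\Theta_t(f_1,\dots,f_m)(x)=\int_{\mathbb{R}^{mn}}\theta_t(x,y_1,\dots,y_m)\prod_{i=1}^m f_i(y_i)\,dy_1\cdots dy_m,\qquad S(f_1,\dots,f_m)(x)=\Big(\int_0^\infty|\Theta_t(f_1,\dots,f_m)(x)|^2\,\frac{dt}{t}\Big)^{1/2}.$$ Suppose that $\Theta_t(1,\dots,1)=0$ almost everywhere for every $t>0$.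 Let $1<p,p_1,\dots,p_m<\infty$ satisfy $\frac1p=\sum_{i=1}^m\frac1{p_i}$. Then there is a finite constant $C$, independent of $w_1,\dots,w_m$ and $f_1,\dots,f_m$, such that for all non-negative functions $w_1,\dots,w_m$ on $\mathbb{R}^n$ with $w_i^{p_i}\in A_{p_i}$, with $w=\prod_{i=1}^m w_i$, and for all $f_i\in L^{p_i}(w_i^{p_i})\cap L^{p_i}(\mathbb{R}^n)$, $$\|S(f_1,\dots,f_m)\|_{L^p(w^p)}\le C\prod_{i=1}^m\Big(1+[w_i^{p_i}]_{A_{p_i}}^{\max(1,p_i'/p_i)+\max(\frac12,p_i'/p_i)}\Big)\prod_{i=1}^m\|f_i\|_{L^{p_i}(w_i^{p_i})}.$$ Here $r'=r/(r-1)$, $\|f\|_{L^r(v)}=(\int|f|^r v\,dx)^{1/r}$, and for $r>1$ a non-negative locally integrable $v$ belongs to $A_r$ if $$[v]_{A_r}=\sup_Q\Big(\frac1{|Q|}\int_Q v\,dx\Big)\Big(\frac1{|Q|}\int_Q v^{1-r'}\,dx\Big)^{r-1}<\infty,$$ the supremum being over all cubes $Q\subset\mathbb{R}^n$ with sides parallel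 to the coordinate axes. -/

import Mathlib

open MeasureTheory
open scoped ENNReal NNReal

namespace SquareFunction

/-- The Euclidean space `ℝⁿ`. -/
abbrev Rn (n : ℕ) : Type := EuclideanSpace ℝ (Fin n)

/-- A family of kernels `θ_t(x, y₁, …, y_m)`; only the values at `t > 0` are ever used. -/
abbrev KernelFamily (n m : ℕ) : Type := ℝ → Rn n → (Fin m → Rn n) → ℂ

/-- Lebesgue measurability of `(t, x, y₁, …, y_m) ↦ θ_t(x, y₁, …, y_m)` on `t > 0`. -/
def KernelMeasurable {n m : ℕ} (θ : KernelFamily n m) : Prop :=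
  AEStronglyMeasurable (fun z : ℝ × Rn n × (Fin m → Rn n) => θ z.1 z.2.1 z.2.2)
    (((volume : Measure ℝ).restrict (Set.Ioi 0)).prod
      (volume : Measure (Rn n × (Fin m → Rn n))))

/-- Size condition:
`|θ_t(x, y₁, …, y_m)| ≲ ∏ᵢ t⁻ⁿ / (1 + t⁻¹ |x - yᵢ|) ^ N`, uniformly in `t > 0`. -/
def SizeCondition {n m : ℕ} (θ : KernelFamily n m) (N : ℝ) : Prop :=
  ∃ A : ℝ, ∀ t : ℝ, 0 < t → ∀ (x : Rn n) (y : Fin m → Rn n),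
    ‖θ t x y‖ ≤ A * ∏ i, t ^ (-(n : ℤ)) / (1 + t⁻¹ * ‖x - y i‖) ^ N

/-- Regularity condition in each of the variables `y₁, …, y_m`:
`|θ_t(x, y₁, …, y_m) - θ_t(x, y₁, …, yᵢ', …, y_m)| ≲ t^{-mn} (t⁻¹ |yᵢ - yᵢ'|) ^ γ`. -/
def RegularityCondition {n m : ℕ} (θ : KernelFamily n m) (γ : ℝ) : Prop :=
  ∃ A : ℝ, ∀ t : ℝ, 0 < t → ∀ (x : Rn n) (y : Fin m → Rn n) (i : Fin m) (y' : Rn n),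
    ‖θ t x y - θ t x (Function.update y i y')‖
      ≤ A * (t ^ (-((m * n : ℕ) : ℤ)) * (t⁻¹ * ‖y i - y'‖) ^ γ)

/-- `Θ_t(f₁, …, f_m)(x) = ∫_{ℝ^{mn}} θ_t(x, y₁, …, y_m) ∏ᵢ fᵢ(yᵢ) dy₁ ⋯ dy_m`. -/
noncomputable def Theta {n m : ℕ} (θ : KernelFamily n m) (t : ℝ) (f : Fin m → Rn n → ℂ)
    (x : Rn n) : ℂ :=
  ∫ y : Fin m → Rn n, θ t x y * ∏ i, f i (y i)

/-- The square function
`S(f₁, …, f_m)(x) = (∫₀^∞ |Θ_t(f₁, …, f_m)(x)|² dt/t)^{1/2}`, with values in `[0, ∞]`. -/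
noncomputable def S {n m : ℕ} (θ : KernelFamily n m) (f : Fin m → Rn n → ℂ) (x : Rn n) : ℝ≥0∞ :=
  (∫⁻ t in Set.Ioi (0 : ℝ), ‖Theta θ t f x‖ₑ ^ 2 / ENNReal.ofReal t) ^ (1 / 2 : ℝ)

/-- The (closed) cube with sides of length `ℓ` parallel to the axes and lowest corner `a`. -/
def cube {n : ℕ} (a : Rn n) (ℓ : ℝ) : Set (Rn n) :=
  {x | ∀ i, x i ∈ Set.Icc (a i) (a i + ℓ)}

/-- The Muckenhoupt constant
`[v]_{A_p} = sup_Q (1/|Q| ∫_Q v) (1/|Q| ∫_Q v^{1-p'})^{p-1}` in `[0, ∞]`, where `p' = p / (p - 1)`.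
The power `v^{1-p'}` is taken in `[0, ∞]`, so that it is `∞` where `v` vanishes. -/
noncomputable def ApConst {n : ℕ} (p : ℝ) (v : Rn n → ℝ≥0) : ℝ≥0∞ :=
  ⨆ (a : Rn n) (ℓ : ℝ) (_ : 0 < ℓ),
    ((volume (cube a ℓ))⁻¹ * ∫⁻ x in cube a ℓ, (v x : ℝ≥0∞)) *
      ((volume (cube a ℓ))⁻¹ *
        ∫⁻ x in cube a ℓ, (v x : ℝ≥0∞) ^ (1 - Real.conjExponent p)) ^ (p - 1)

/-- `v` is an `A_p` weight. -/
def IsApWeight {n : ℕ} (p : ℝ) (v : Rn n → ℝ≥0) : Prop :=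
  LocallyIntegrable (fun x => (v x : ℝ)) volume ∧ ApConst p v < ∞

/-- The measure `v(x) dx`. -/
noncomputable def weightMeasure {n : ℕ} (v : Rn n → ℝ≥0) : Measure (Rn n) :=
  volume.withDensity fun x => (v x : ℝ≥0∞)

end SquareFunction

/-! The multilinear square function is bounded pointwise by products of linear objects, and these
satisfy weighted bounds with an explicit power of the Muckenhoupt constant.

Pointwise bound. A geometric mean of the size and regularity conditions gives Hölder regularity with
decay of order n + 2β in each variable (`exists_isMultiKernel`). At scale t near x, let a_i be a
bump average of f_i. Replacing f_i by a_i one index at a time leaves the term with all factors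
constant, which the cancellation condition kills, and terms in which some slot j carries f_j - a_j.
Integrating out the other slots costs maximal functions and leaves a one-variable kernel acting on
f_j - a_j. That kernel is cut into dyadic annuli, and each piece is corrected by a bump to have mean
zero, so it becomes a multiple of an atom: a Hölder function of mean zero on a cube of one of 2^n
shifted dyadic grids. Hence the term is at most a geometrically weighted sum, over scales above t,
of the numbers c_Q(f_j) (`coef`), the largest pairings of f_j with atoms on Q. Square integration in
dt/t gives S(f) ≤ C ∏ (M f_i + 𝒮 f_i), where 𝒮 is the square function built from the c_Q
(`exists_S_le`).

Linear weighted bound. On bounded functions 𝒮 obeys a local L² estimate, by almost orthogonality of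
atoms of different scales. A Calderón–Zygmund decomposition turns this into a local weak type (1,1)
estimate (`weak_type_square`). So on every cube F the sum over the scales up to F can be stopped at
height of order the mean of |f|, outside at least half of F. For a weight v in A_q, half of a cube
in volume carries a fraction of at least 1/(2^q [v]) of its v-mass. Charging each stopping cube to
its unstopped half and iterating gives ∫ 𝒮f · h dv ≤ C [v] ∫ Mf · M_v h dv
(`lintegral_squareTrunc_mul_le`). Duality and Doob's inequality for M_v, whose constant does not see
v, give ‖𝒮f‖ ≤ C [v] ‖Mf‖ in L^q(v), and Buckley's theorem gives ‖Mf‖ ≤ C [v]^{1/(q-1)} ‖f‖. The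
total power 1 + 1/(q-1) is at most max(1, q'/q) + max(1/2, q'/q), because q'/q = 1/(q-1).

Conclusion. Since w^p = ∏ (w_i^{p_i})^{p/p_i}, Hölder's inequality combines the linear bounds. An
A_p weight, with the dual power equal to ∞ on the zero set, vanishes almost everywhere or almost
nowhere; in the first case the left side is zero. -/

namespace SquareFunction

/-! ### Dyadic grids and partitions into stopping cubes -/

/-- A system of half-open dyadic cubes in `ℝⁿ`, shifted by `shift k` at scale `2 ^ k`. -/
structure Grid (n : ℕ) where
  shift : ℤ → Fin n → ℝ
  -- This congruence makes the grid nested: a translation by multiples of `2 ^ k` keeps every large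
  -- cube a union of small ones.
  shift_succ : ∀ k i, ∃ m : ℤ, shift (k + 1) i = shift k i + m * 2 ^ k

namespace Grid

variable {n : ℕ} (D : Grid n)

/-- The label of the cube of scale `2 ^ k` that contains `x`. -/
noncomputable def idx (k : ℤ) (x : Rn n) : Fin n → ℤ :=
  fun i => ⌊(x i - D.shift k i) / 2 ^ k⌋

/-- The cube of scale `2 ^ k` that contains `x`. -/
def cell (k : ℤ) (x : Rn n) : Set (Rn n) := {y | D.idx k y = D.idx k x}

lemma mem_cell_self (k : ℤ) (x : Rn n) : x ∈ D.cell k x := rfl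

lemma cell_eq_of_mem {k : ℤ} {x y : Rn n} (h : y ∈ D.cell k x) : D.cell k y = D.cell k x := by
  have h' : D.idx k y = D.idx k x := h
  simp only [cell, h']

lemma mem_cell_comm {k : ℤ} {x y : Rn n} : y ∈ D.cell k x ↔ x ∈ D.cell k y :=
  ⟨fun h => Eq.symm h, fun h => Eq.symm h⟩

/-- Since the shifts agree modulo `2 ^ k`, the label at scale `k + 1` is half the translated label
at scale `k`, rounded down, and so is determined by it. -/
lemma idx_succ {k : ℤ} {x y : Rn n} (h : D.idx k x = D.idx k y) :
    D.idx (k + 1) x = D.idx (k + 1) y := by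
  funext i
  obtain ⟨m, hm⟩ := D.shift_succ k i
  have key : ∀ z : Rn n, D.idx (k + 1) z i = (D.idx k z i - m) / 2 := by
    intro z
    have h2 : (0 : ℝ) < 2 ^ k := by positivity
    have : (z i - D.shift (k + 1) i) / 2 ^ (k + 1)
        = ((z i - D.shift k i) / 2 ^ k - m) / (2 : ℕ) := by
      rw [hm, zpow_add₀ (by norm_num)]
      field_simp
      push_cast
      ring
    simp only [idx]
    rw [this, Int.floor_div_natCast, Int.floor_sub_intCast]
    rfl
  rw [key, key, h]

lemma idx_mono {j k : ℤ} (hjk : j ≤ k) {x y : Rn n} (h : D.idx j x = D.idx j y) :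
    D.idx k x = D.idx k y := by
  induction k, hjk using Int.leInduction with
  | base => exact h
  | succ k _ ih => exact D.idx_succ ih

lemma cell_mono {j k : ℤ} (hjk : j ≤ k) (x : Rn n) : D.cell j x ⊆ D.cell k x :=
  fun _ hy => D.idx_mono hjk hy

lemma cell_subset_of_mem {j k : ℤ} (hjk : j ≤ k) {x y : Rn n} (h : y ∈ D.cell k x) :
    D.cell j y ⊆ D.cell k x :=
  (D.cell_mono hjk y).trans (D.cell_eq_of_mem h).subset

lemma measurable_idx (k : ℤ) : Measurable (D.idx k) := by
  refine measurable_pi_lambda _ fun i => Int.measurable_floor.comp ?_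
  have : Measurable fun x : Rn n => x i := by fun_prop
  exact (this.sub_const _).div_const _

lemma measurableSet_cell (k : ℤ) (x : Rn n) : MeasurableSet (D.cell k x) :=
  D.measurable_idx k (measurableSet_singleton (D.idx k x))

/-- A function of the cube containing `x` is measurable. -/
lemma measurable_fun_cell {β : Type*} [MeasurableSpace β] (k : ℤ) (φ : Set (Rn n) → β) :
    Measurable fun x => φ (D.cell k x) :=
  (measurable_of_countable fun i : Fin n → ℤ => φ {y | D.idx k y = i}).comp (D.measurable_idx k)

lemma measurable_uncurry_cell {β : Type*} [MeasurableSpace β] (k : ℤ)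
    (φ : Set (Rn n) → Rn n → β) (hφ : ∀ S, Measurable (φ S)) :
    Measurable fun x => φ (D.cell k x) x := by
  have : Measurable fun p : (Fin n → ℤ) × Rn n => φ {y | D.idx k y = p.1} p.2 :=
    measurable_from_prod_countable_right fun i => hφ {y | D.idx k y = i}
  exact this.comp ((D.measurable_idx k).prodMk measurable_id)

/-- The lowest corner of the cube of scale `2 ^ k` containing `x`. -/
noncomputable def corner (k : ℤ) (x : Rn n) : Rn n :=
  WithLp.toLp 2 fun i => D.shift k i + D.idx k x i * 2 ^ k

lemma mem_cell_iff {k : ℤ} {x y : Rn n} :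
    y ∈ D.cell k x ↔ ∀ i, y i ∈ Set.Ico (D.corner k x i) (D.corner k x i + 2 ^ k) := by
  have h2 : (0 : ℝ) < 2 ^ k := by positivity
  have : y ∈ D.cell k x ↔ ∀ i, D.idx k y i = D.idx k x i := funext_iff
  rw [this]
  refine forall_congr' fun i => ?_
  rw [idx, Int.floor_eq_iff, le_div_iff₀ h2, div_lt_iff₀ h2]
  simp only [corner, Set.mem_Ico]
  constructor <;> rintro ⟨h1, h3⟩ <;> constructor <;> nlinarith

lemma volume_box (ℓ : ℝ) (hℓ : 0 ≤ ℓ) (I : Fin n → Set ℝ)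
    (hI : ∀ i, MeasurableSet (I i)) (hv : ∀ i, volume (I i) = ENNReal.ofReal ℓ) :
    volume {y : Rn n | ∀ i, y i ∈ I i} = ENNReal.ofReal (ℓ ^ n) := by
  have hp := PiLp.volume_preserving_ofLp (Fin n)
  have : {y : Rn n | ∀ i, y i ∈ I i} = (fun y : Rn n => y.ofLp) ⁻¹' Set.univ.pi I := by
    ext y; simp
  rw [this, hp.measure_preimage (MeasurableSet.univ_pi hI).nullMeasurableSet, volume_pi_pi]
  simp [hv, ENNReal.ofReal_pow hℓ]

lemma volume_cell (k : ℤ) (x : Rn n) :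
    volume (D.cell k x) = ENNReal.ofReal (((2 : ℝ) ^ k) ^ n) := by
  have : D.cell k x =
      {y : Rn n | ∀ i, y i ∈ Set.Ico (D.corner k x i) (D.corner k x i + 2 ^ k)} := by
    ext y; exact D.mem_cell_iff
  rw [this]
  exact volume_box (2 ^ k) (by positivity) _ (fun i => measurableSet_Ico) (by simp)

lemma volume_cell_ne_zero (k : ℤ) (x : Rn n) : volume (D.cell k x) ≠ 0 := by
  rw [volume_cell]
  have : (0 : ℝ) < ((2 : ℝ) ^ k) ^ n := by positivity
  simpa using this

lemma volume_cell_ne_top (k : ℤ) (x : Rn n) : volume (D.cell k x) ≠ ∞ := by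
  rw [volume_cell]; exact ENNReal.ofReal_ne_top

lemma cell_subset_cube (k : ℤ) (x : Rn n) : D.cell k x ⊆ cube (D.corner k x) (2 ^ k) :=
  fun _ hy i => Set.Ico_subset_Icc_self (D.mem_cell_iff.1 hy i)

lemma volume_cube_corner (k : ℤ) (x : Rn n) :
    volume (cube (D.corner k x) (2 ^ k)) = volume (D.cell k x) := by
  rw [volume_cell]
  exact volume_box (2 ^ k) (by positivity) _ (fun i => measurableSet_Icc) (by simp)

lemma norm_sub_le {k : ℤ} {x y : Rn n} (h : y ∈ D.cell k x) : ‖x - y‖ ≤ (n + 1) * 2 ^ k := by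
  have h2 : (0 : ℝ) < 2 ^ k := by positivity
  have hx := D.mem_cell_iff.1 (D.mem_cell_self k x)
  have hy := D.mem_cell_iff.1 h
  have hb : ∀ i, ‖(x - y) i‖ ≤ 2 ^ k := by
    intro i
    have h1 := hx i
    have h3 := hy i
    simp only [Set.mem_Ico] at h1 h3
    rw [PiLp.sub_apply, Real.norm_eq_abs, abs_le]
    constructor <;> linarith
  rw [EuclideanSpace.norm_eq]
  have : ∑ i, ‖(x - y) i‖ ^ 2 ≤ n * (2 ^ k) ^ 2 := by
    calc ∑ i, ‖(x - y) i‖ ^ 2 ≤ ∑ _i : Fin n, ((2 : ℝ) ^ k) ^ 2 :=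
          Finset.sum_le_sum fun i _ => pow_le_pow_left₀ (norm_nonneg _) (hb i) 2
      _ = _ := by simp
  refine Real.sqrt_le_iff.2 ⟨by positivity, this.trans ?_⟩
  have hn : (0 : ℝ) ≤ n := by positivity
  nlinarith [sq_nonneg ((2 : ℝ) ^ k)]

/-- `Ω` is the disjoint union of the cubes `cell (τ x) x`, `x ∈ Ω`. -/
def IsCellUnion (Ω : Set (Rn n)) (τ : Rn n → ℤ) : Prop :=
  ∀ x ∈ Ω, ∀ y ∈ D.cell (τ x) x, y ∈ Ω ∧ τ y = τ x

/-- The cube labelled by `i` in the partition of `Ω`, or the empty set. -/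
def part (Ω : Set (Rn n)) (τ : Rn n → ℤ) (i : ℤ × (Fin n → ℤ)) : Set (Rn n) :=
  {x | x ∈ Ω ∧ (τ x, D.idx (τ x) x) = i}

variable {D} {Ω : Set (Rn n)} {τ : Rn n → ℤ}

lemma iUnion_part : ⋃ i, D.part Ω τ i = Ω := by
  ext x; simp [part]

lemma disjoint_part : Pairwise (Function.onFun Disjoint (D.part Ω τ)) := by
  intro i j hij
  refine Set.disjoint_left.2 fun x hx hy => hij ?_
  rw [← hx.2, ← hy.2]

namespace IsCellUnion

lemma part_eq (hΩ : D.IsCellUnion Ω τ) (i : ℤ × (Fin n → ℤ)) :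
    D.part Ω τ i = ∅ ∨ ∃ x ∈ Ω, D.part Ω τ i = D.cell (τ x) x := by
  rcases Set.eq_empty_or_nonempty (D.part Ω τ i) with h | ⟨x, hx, hxi⟩
  · exact Or.inl h
  · refine Or.inr ⟨x, hx, Set.ext fun y => ⟨fun hy => ?_, fun hy => ?_⟩⟩
    · have h1 := hy.2.trans hxi.symm
      have h2 : τ y = τ x := congrArg Prod.fst h1
      have h3 := congrArg Prod.snd h1
      simp only [h2] at h3
      exact h3
    · obtain ⟨h1, h2⟩ := hΩ x hx y hy
      refine ⟨h1, ?_⟩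
      have : D.idx (τ x) y = D.idx (τ x) x := hy
      rw [h2, this, hxi]

lemma measurableSet_part (hΩ : D.IsCellUnion Ω τ) (i : ℤ × (Fin n → ℤ)) :
    MeasurableSet (D.part Ω τ i) := by
  rcases hΩ.part_eq i with h | ⟨x, -, h⟩
  · simp [h]
  · rw [h]; exact D.measurableSet_cell _ _

lemma measurableSet (hΩ : D.IsCellUnion Ω τ) : MeasurableSet Ω := by
  rw [← iUnion_part (D := D) (Ω := Ω) (τ := τ)]
  exact MeasurableSet.iUnion hΩ.measurableSet_part

lemma lintegral_eq_tsum (hΩ : D.IsCellUnion Ω τ) (μ : Measure (Rn n)) (φ : Rn n → ℝ≥0∞) :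
    ∫⁻ x in Ω, φ x ∂μ = ∑' i, ∫⁻ x in D.part Ω τ i, φ x ∂μ := by
  conv_lhs => rw [← iUnion_part (D := D) (Ω := Ω) (τ := τ)]
  exact lintegral_iUnion hΩ.measurableSet_part disjoint_part _

/-- The stopping cubes are countably many disjoint measurable sets, so estimates on single cubes add
up. No measurability of the integrands or of τ is required. -/
lemma lintegral_le (hΩ : D.IsCellUnion Ω τ) {μ ν : Measure (Rn n)} {φ ψ : Rn n → ℝ≥0∞}
    (h : ∀ x ∈ Ω, ∫⁻ y in D.cell (τ x) x, φ y ∂μ ≤ ∫⁻ y in D.cell (τ x) x, ψ y ∂ν) :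
    ∫⁻ y in Ω, φ y ∂μ ≤ ∫⁻ y in Ω, ψ y ∂ν := by
  rw [hΩ.lintegral_eq_tsum, hΩ.lintegral_eq_tsum]
  refine ENNReal.tsum_le_tsum fun i => ?_
  rcases hΩ.part_eq i with hi | ⟨x, hx, hi⟩
  · simp [hi]
  · rw [hi]; exact h x hx

lemma enorm_integral_le (hΩ : D.IsCellUnion Ω τ) {μ ν : Measure (Rn n)} {φ : Rn n → ℂ}
    {ψ : Rn n → ℝ≥0∞}
    (hφ : IntegrableOn φ Ω μ)
    (h : ∀ x ∈ Ω, ‖∫ y in D.cell (τ x) x, φ y ∂μ‖ₑ ≤ ∫⁻ y in D.cell (τ x) x, ψ y ∂ν) :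
    ‖∫ y in Ω, φ y ∂μ‖ₑ ≤ ∫⁻ y in Ω, ψ y ∂ν := by
  have hs := hasSum_integral_iUnion (μ := μ) (f := φ) hΩ.measurableSet_part disjoint_part
    (by rwa [iUnion_part])
  rw [iUnion_part] at hs
  rw [← hs.tsum_eq, hΩ.lintegral_eq_tsum]
  refine enorm_tsum_le_tsum_enorm.trans (ENNReal.tsum_le_tsum fun i => ?_)
  rcases hΩ.part_eq i with hi | ⟨x, hx, hi⟩
  · simp [hi]
  · rw [hi]; exact h x hx

lemma aestronglyMeasurable (hΩ : D.IsCellUnion Ω τ) {μ : Measure (Rn n)} {g : Rn n → ℂ}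
    (h : ∀ x ∈ Ω, AEStronglyMeasurable g (μ.restrict (D.cell (τ x) x))) :
    AEStronglyMeasurable g (μ.restrict Ω) := by
  rw [← iUnion_part (D := D) (Ω := Ω) (τ := τ), aestronglyMeasurable_iUnion_iff]
  intro i
  rcases hΩ.part_eq i with hi | ⟨x, hx, hi⟩
  · simp [hi]
  · rw [hi]; exact h x hx

end IsCellUnion

lemma isCellUnion_const {j k : ℤ} (hjk : j ≤ k) (x : Rn n) :
    D.IsCellUnion (D.cell k x) (fun _ => j) :=
  fun _ hy _ hz => ⟨D.cell_subset_of_mem hjk hy hz, rfl⟩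

lemma isCellUnion_univ (j : ℤ) : D.IsCellUnion Set.univ (fun _ => j) :=
  fun _ _ _ _ => ⟨trivial, rfl⟩

end Grid

/-! ### Interpolation and Doob's maximal inequality -/

lemma lintegral_Ioi_rpow_indicator_le {q : ℝ} (hq : 1 < q) (a : ℝ≥0∞) (ha : a ≠ ∞) :
    ∫⁻ t in Set.Ioi (0 : ℝ),
      {t : ℝ | ENNReal.ofReal t < a}.indicator (fun t => ENNReal.ofReal (t ^ (q - 2))) t
      = ENNReal.ofReal ((q - 1)⁻¹) * a ^ (q - 1) := by
  have hm : MeasurableSet {t : ℝ | ENNReal.ofReal t < a} :=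
    measurableSet_lt ENNReal.measurable_ofReal measurable_const
  have hset : {t : ℝ | ENNReal.ofReal t < a} ∩ Set.Ioi 0 = Set.Ioo 0 a.toReal := by
    ext t
    simp only [Set.mem_inter_iff, Set.mem_ofPred_eq, Set.mem_Ioi, Set.mem_Ioo]
    constructor
    · rintro ⟨h1, h2⟩
      exact ⟨h2, (ENNReal.ofReal_lt_iff_lt_toReal h2.le ha).1 h1⟩
    · rintro ⟨h1, h2⟩
      exact ⟨(ENNReal.ofReal_lt_iff_lt_toReal h1.le ha).2 h2, h1⟩
  rw [lintegral_indicator hm, Measure.restrict_restrict hm, hset,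
    ← Measure.restrict_congr_set Ioo_ae_eq_Ioc.symm]
  have hint : IntervalIntegrable (fun t : ℝ => t ^ (q - 2)) volume 0 a.toReal :=
    intervalIntegral.intervalIntegrable_rpow' (by linarith)
  have h0 : (0 : ℝ) ≤ a.toReal := ENNReal.toReal_nonneg
  rw [← ofReal_integral_eq_lintegral_ofReal, ← intervalIntegral.integral_of_le h0,
    integral_rpow (Or.inl (by linarith))]
  · rw [show q - 2 + 1 = q - 1 by ring, Real.zero_rpow (by linarith), sub_zero, div_eq_inv_mul,
      ENNReal.ofReal_mul (by simp; linarith), ← ENNReal.ofReal_rpow_of_nonneg h0 (by linarith),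
      ENNReal.ofReal_toReal ha]
  · exact (intervalIntegrable_iff_integrableOn_Ioc_of_le h0).1 hint
  · filter_upwards [ae_restrict_mem measurableSet_Ioc] with t ht
    exact Real.rpow_nonneg ht.1.le _

/-- Marcinkiewicz interpolation between a weak type estimate at `L¹` and `L^∞`. -/
lemma lintegral_rpow_le_of_weak {α : Type*} [MeasurableSpace α] {μ : Measure α} [SFinite μ]
    {u h : α → ℝ≥0∞} (hu : Measurable u) (hh : Measurable h) {q : ℝ} (hq : 1 < q)
    (hw : ∀ t : ℝ, 0 < t → ENNReal.ofReal t * μ {x | ENNReal.ofReal t < u x}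
      ≤ 2 * ∫⁻ x in {x | ENNReal.ofReal t < 2 * h x}, h x ∂μ) :
    ∫⁻ x, u x ^ q ∂μ ≤ ENNReal.ofReal (2 * q * (2 ^ (q - 1) * (q - 1)⁻¹)) * ∫⁻ x, h x ^ q ∂μ := by
  have hq0 : 0 < q := by linarith
  -- Truncation makes the function real valued, as the layer cake formula needs; monotone
  -- convergence removes it at the end.
  have trunc : ∀ R : ℕ, ∫⁻ x, (min (u x) R) ^ q ∂μ
      ≤ ENNReal.ofReal (2 * q * (2 ^ (q - 1) * (q - 1)⁻¹)) * ∫⁻ x, h x ^ q ∂μ := by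
    intro R
    have hfin : ∀ x, min (u x) (R : ℝ≥0∞) ≠ ∞ := fun x =>
      ne_top_of_le_ne_top (ENNReal.natCast_ne_top R) (min_le_right _ _)
    have h1 : ∀ x, (min (u x) (R : ℝ≥0∞)) ^ q
        = ENNReal.ofReal ((min (u x) (R : ℝ≥0∞)).toReal ^ q) := by
      intro x
      rw [← ENNReal.ofReal_rpow_of_nonneg ENNReal.toReal_nonneg hq0.le,
        ENNReal.ofReal_toReal (hfin x)]
    simp_rw [h1]
    rw [lintegral_rpow_eq_lintegral_meas_lt_mul μ
      (Filter.Eventually.of_forall fun x => ENNReal.toReal_nonneg)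
      ((hu.min measurable_const).ennreal_toReal.aemeasurable) hq0]
    have h2 : ∫⁻ t in Set.Ioi (0 : ℝ), μ {a | t < (min (u a) (R : ℝ≥0∞)).toReal}
          * ENNReal.ofReal (t ^ (q - 1))
        ≤ ∫⁻ t in Set.Ioi (0 : ℝ), ∫⁻ x, 2 * h x *
          {t : ℝ | ENNReal.ofReal t < 2 * h x}.indicator
            (fun t => ENNReal.ofReal (t ^ (q - 2))) t ∂μ := by
      refine setLIntegral_mono_ae' measurableSet_Ioi (Filter.Eventually.of_forall fun t ht => ?_)
      have ht : 0 < t := ht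
      have hset : MeasurableSet {x | ENNReal.ofReal t < 2 * h x} :=
        measurableSet_lt measurable_const (hh.const_mul 2)
      have hsub : {a | t < (min (u a) (R : ℝ≥0∞)).toReal} ⊆ {x | ENNReal.ofReal t < u x} := by
        intro a ha
        have := (ENNReal.ofReal_lt_iff_lt_toReal ht.le (hfin a)).2 ha
        exact this.trans_le (min_le_left _ _)
      -- One factor t is spent on the weak type estimate; the remaining power is still integrable at
      -- 0 because q > 1.
      have e1 : t ^ (q - 1) = t * t ^ (q - 2) := by
        rw [show q - 1 = 1 + (q - 2) by ring, Real.rpow_add ht, Real.rpow_one]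
      have e2 : (∫⁻ x, 2 * h x * {t : ℝ | ENNReal.ofReal t < 2 * h x}.indicator
            (fun t => ENNReal.ofReal (t ^ (q - 2))) t ∂μ)
          = 2 * (∫⁻ x in {x | ENNReal.ofReal t < 2 * h x}, h x ∂μ)
            * ENNReal.ofReal (t ^ (q - 2)) := by
        rw [← lintegral_const_mul _ hh, ← lintegral_mul_const _ (hh.const_mul 2),
          ← lintegral_indicator hset]
        refine lintegral_congr fun x => ?_
        by_cases hx : ENNReal.ofReal t < 2 * h x <;> simp [Set.indicator, hx]
      rw [e2, e1, ENNReal.ofReal_mul ht.le, ← mul_assoc]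
      refine mul_le_mul_left ?_ _
      rw [mul_comm]
      exact (mul_le_mul_right (measure_mono hsub) _).trans (hw t ht)
    refine (mul_le_mul_right h2 _).trans ?_
    rw [lintegral_lintegral_swap]
    · rw [← lintegral_const_mul' _ _ ENNReal.ofReal_ne_top,
        ← lintegral_const_mul' _ _ ENNReal.ofReal_ne_top]
      refine lintegral_mono fun x => ?_
      have hc : (0 : ℝ) < 2 * q * (2 ^ (q - 1) * (q - 1)⁻¹) := by
        have : 0 < q - 1 := by linarith
        positivity
      rcases eq_or_ne (h x) ∞ with hx | hx
      · simp only [hx]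
        rw [ENNReal.top_rpow_of_pos hq0]
        exact le_top.trans_eq (ENNReal.mul_top (by simpa only [ne_eq, ENNReal.ofReal_eq_zero,
          not_le] using hc)).symm
      · have hx2 : 2 * h x ≠ ∞ := ENNReal.mul_ne_top (by simp) hx
        dsimp only
        rw [lintegral_const_mul' _ _ hx2, lintegral_Ioi_rpow_indicator_le hq _ hx2,
          ENNReal.mul_rpow_of_nonneg _ _ (by linarith)]
        have e : h x ^ q = h x * h x ^ (q - 1) := by
          rw [show q = 1 + (q - 1) by ring, ENNReal.rpow_add_of_nonneg _ _ (by simp) (by linarith)]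
          simp
        rw [e, ENNReal.ofReal_mul (by positivity), ENNReal.ofReal_mul (by positivity),
          ENNReal.ofReal_mul (by positivity), ← ENNReal.ofReal_rpow_of_pos (by norm_num)]
        simp only [ENNReal.ofReal_ofNat]
        apply le_of_eq
        ring
    · refine Measurable.aemeasurable ?_
      have hs : MeasurableSet {p : ℝ × α | ENNReal.ofReal p.1 < 2 * h p.2} :=
        measurableSet_lt (ENNReal.measurable_ofReal.comp measurable_fst)
          ((hh.comp measurable_snd).const_mul 2)
      have : (Function.uncurry fun (t : ℝ) (x : α) => 2 * h x *
          {t : ℝ | ENNReal.ofReal t < 2 * h x}.indicator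
            (fun t => ENNReal.ofReal (t ^ (q - 2))) t)
          = fun p : ℝ × α => 2 * h p.2 * {p : ℝ × α | ENNReal.ofReal p.1 < 2 * h p.2}.indicator
            (fun p => ENNReal.ofReal (p.1 ^ (q - 2))) p := by
        funext p
        simp [Function.uncurry, Set.indicator]
      rw [this]
      refine ((hh.comp measurable_snd).const_mul 2).mul (Measurable.indicator ?_ hs)
      exact (measurable_fst.pow_const _).ennreal_ofReal
  have hlim : ∀ x, u x ^ q = ⨆ R : ℕ, (min (u x) (R : ℝ≥0∞)) ^ q := by
    intro x
    have h1 : u x = ⨆ R : ℕ, min (u x) (R : ℝ≥0∞) := by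
      have := (inf_iSup_eq (u x) (fun R : ℕ => (R : ℝ≥0∞)))
      rw [ENNReal.iSup_natCast, inf_top_eq] at this
      exact this
    conv_lhs => rw [h1]
    exact (ENNReal.orderIsoRpow q hq0).map_iSup _
  simp_rw [hlim]
  rw [lintegral_iSup]
  · exact iSup_le trunc
  · exact fun R => (hu.min measurable_const).pow_const _
  · intro R S hRS x
    dsimp only
    gcongr

namespace Grid

variable {n : ℕ} (D : Grid n)

/-- The average of `h` over the cube of scale `2 ^ k` containing `x`. -/
noncomputable def avg (μ : Measure (Rn n)) (h : Rn n → ℝ≥0∞) (k : ℤ) (x : Rn n) : ℝ≥0∞ :=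
  (μ (D.cell k x))⁻¹ * ∫⁻ y in D.cell k x, h y ∂μ

/-- The dyadic maximal function with respect to the measure `μ`. -/
noncomputable def maximal (μ : Measure (Rn n)) (h : Rn n → ℝ≥0∞) (x : Rn n) : ℝ≥0∞ :=
  ⨆ k, D.avg μ h k x

/-- All cubes of the grid have positive finite measure. -/
def Regular (μ : Measure (Rn n)) : Prop := ∀ k x, μ (D.cell k x) ≠ 0 ∧ μ (D.cell k x) ≠ ∞

lemma regular_volume : D.Regular volume :=
  fun k x => ⟨D.volume_cell_ne_zero k x, D.volume_cell_ne_top k x⟩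

lemma avg_le_maximal (μ : Measure (Rn n)) (h : Rn n → ℝ≥0∞) (k : ℤ) (x : Rn n) :
    D.avg μ h k x ≤ D.maximal μ h x := le_iSup (fun k => D.avg μ h k x) k

lemma avg_eq_of_mem {μ : Measure (Rn n)} {h : Rn n → ℝ≥0∞} {k : ℤ} {x y : Rn n}
    (hy : y ∈ D.cell k x) : D.avg μ h k y = D.avg μ h k x := by
  simp only [avg, D.cell_eq_of_mem hy]

lemma measurable_avg (μ : Measure (Rn n)) (h : Rn n → ℝ≥0∞) (k : ℤ) :
    Measurable (D.avg μ h k) :=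
  D.measurable_fun_cell k fun S => (μ S)⁻¹ * ∫⁻ y in S, h y ∂μ

lemma measurable_maximal (μ : Measure (Rn n)) (h : Rn n → ℝ≥0∞) :
    Measurable (D.maximal μ h) := Measurable.iSup fun k => D.measurable_avg μ h k

lemma maximal_congr {μ : Measure (Rn n)} {h h' : Rn n → ℝ≥0∞} (H : h =ᵐ[μ] h') :
    D.maximal μ h = D.maximal μ h' := by
  funext x
  simp only [maximal, avg]
  congr with k
  rw [lintegral_congr_ae (ae_restrict_of_ae H)]

variable {D}

lemma measure_mul_avg {μ : Measure (Rn n)} (hμ : D.Regular μ) (h : Rn n → ℝ≥0∞) (k : ℤ)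
    (x : Rn n) : μ (D.cell k x) * D.avg μ h k x = ∫⁻ y in D.cell k x, h y ∂μ := by
  rw [avg, ← mul_assoc, ENNReal.mul_inv_cancel (hμ k x).1 (hμ k x).2, one_mul]

/-- The weak type `(1, 1)` estimate for the dyadic maximal function restricted to scales `≤ K`. -/
lemma weak_type_maximal_trunc {μ : Measure (Rn n)} (hμ : D.Regular μ) (h : Rn n → ℝ≥0∞)
    (K : ℤ) (t : ℝ≥0∞) :
    t * μ {x | ∃ k ≤ K, t < D.avg μ h k x} ≤ ∫⁻ x, h x ∂μ := by
  classical
  set Ω := {x | ∃ k ≤ K, t < D.avg μ h k x} with hΩdef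
  -- The cap K on the scales provides a largest admissible cube around each point; these maximal
  -- cubes partition Ω.
  have hex : ∀ x ∈ Ω, ∃ k, (k ≤ K ∧ t < D.avg μ h k x) ∧
      ∀ j, (j ≤ K ∧ t < D.avg μ h j x) → j ≤ k := fun x hx =>
    Int.exists_greatest_of_bdd ⟨K, fun z hz => hz.1⟩ hx
  choose! τ hτ hmax using hex
  have hΩ : D.IsCellUnion Ω τ := by
    intro x hx y hy
    have hty := hτ x hx
    have hyΩ : y ∈ Ω := ⟨τ x, hty.1, by rw [D.avg_eq_of_mem hy]; exact hty.2⟩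
    refine ⟨hyΩ, le_antisymm ?_ (hmax y hyΩ _ ⟨hty.1, by rw [D.avg_eq_of_mem hy]; exact hty.2⟩)⟩
    by_contra! hlt
    have hyy := hτ y hyΩ
    have hm : y ∈ D.cell (τ y) x := D.cell_mono hlt.le x hy
    rw [D.avg_eq_of_mem hm] at hyy
    exact absurd (hmax x hx _ hyy) (by simpa using hlt)
  calc t * μ Ω = ∫⁻ _ in Ω, t ∂μ := by simp
    _ ≤ ∫⁻ x in Ω, h x ∂μ := by
        refine hΩ.lintegral_le fun x hx => ?_
        rw [← measure_mul_avg hμ h, setLIntegral_const, mul_comm]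
        gcongr
        exact (hτ x hx).2.le
    _ ≤ ∫⁻ x, h x ∂μ := setLIntegral_le_lintegral _ _

/-- The level sets of the capped maximal functions increase to the full level set, and the bound
does not depend on the cap. -/
lemma weak_type_maximal {μ : Measure (Rn n)} (hμ : D.Regular μ) (h : Rn n → ℝ≥0∞) (t : ℝ≥0∞) :
    t * μ {x | t < D.maximal μ h x} ≤ ∫⁻ x, h x ∂μ := by
  have : {x | t < D.maximal μ h x} = ⋃ K : ℕ, {x | ∃ k ≤ (K : ℤ), t < D.avg μ h k x} := by
    ext x
    simp only [maximal, lt_iSup_iff, Set.mem_ofPred_eq, Set.mem_iUnion]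
    constructor
    · rintro ⟨k, hk⟩
      exact ⟨k.toNat, k, Int.self_le_toNat k, hk⟩
    · rintro ⟨-, k, -, hk⟩
      exact ⟨k, hk⟩
  rw [this, Monotone.measure_iUnion, ENNReal.mul_iSup]
  · exact iSup_le fun K => weak_type_maximal_trunc hμ h K t
  · rintro K L hKL x ⟨k, hk, hx⟩
    exact ⟨k, hk.trans (by exact_mod_cast hKL), hx⟩

/-- Doob's maximal inequality, with a constant that does not depend on the measure. -/
lemma lintegral_maximal_rpow_le {μ : Measure (Rn n)} [SFinite μ] (hμ : D.Regular μ)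
    {h : Rn n → ℝ≥0∞} (hh : Measurable h) {q : ℝ} (hq : 1 < q) :
    ∫⁻ x, D.maximal μ h x ^ q ∂μ
      ≤ ENNReal.ofReal (2 * q * (2 ^ (q - 1) * (q - 1)⁻¹)) * ∫⁻ x, h x ^ q ∂μ := by
  refine lintegral_rpow_le_of_weak (D.measurable_maximal μ h) hh hq fun t ht => ?_
  -- Only the part of h above t/2 matters: the rest contributes at most t/2 to any average, so the
  -- averages of the large part must exceed t/2.
  set S := {x | ENNReal.ofReal t < 2 * h x} with hS
  have hSm : MeasurableSet S := measurableSet_lt measurable_const (hh.const_mul 2)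
  set h' : Rn n → ℝ≥0∞ := S.indicator h
  set s : ℝ≥0∞ := ENNReal.ofReal t / 2 with hs
  have h2s : ENNReal.ofReal t = s + s := (ENNReal.add_halves _).symm
  have hle : ∀ y, h y ≤ s + h' y := by
    intro y
    by_cases hy : y ∈ S
    · simp [h', hy]
    · have hy' : 2 * h y ≤ ENNReal.ofReal t := not_lt.1 hy
      have : h y ≤ s := by
        rw [hs, ENNReal.le_div_iff_mul_le (by simp) (by simp), mul_comm]; exact hy'
      exact this.trans le_self_add
  have hsub : {x | ENNReal.ofReal t < D.maximal μ h x} ⊆ {x | s < D.maximal μ h' x} := by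
    intro x hx
    obtain ⟨k, hk⟩ := lt_iSup_iff.1 (show ENNReal.ofReal t < ⨆ k, D.avg μ h k x from hx)
    have h1 : D.avg μ h k x ≤ s + D.avg μ h' k x := by
      calc D.avg μ h k x ≤ (μ (D.cell k x))⁻¹ * ∫⁻ y in D.cell k x, (s + h' y) ∂μ := by
            unfold avg; gcongr with y; exact hle y
        _ = s + D.avg μ h' k x := by
            rw [lintegral_add_left measurable_const, setLIntegral_const, mul_add, avg,
              mul_comm s, ← mul_assoc, ENNReal.inv_mul_cancel (hμ k x).1 (hμ k x).2, one_mul]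
    have h3 : s < D.avg μ h' k x := by
      by_contra! hcon
      have : D.avg μ h k x ≤ s + s := h1.trans (by gcongr)
      rw [← h2s] at this
      exact absurd hk (not_lt.2 this)
    exact h3.trans_le (D.avg_le_maximal μ h' k x)
  have hw := weak_type_maximal hμ h' s
  rw [lintegral_indicator hSm] at hw
  calc ENNReal.ofReal t * μ {x | ENNReal.ofReal t < D.maximal μ h x}
      ≤ (2 * s) * μ {x | s < D.maximal μ h' x} := by
        rw [← two_mul] at h2s
        rw [← h2s]
        exact mul_le_mul_right (measure_mono hsub) _
    _ ≤ 2 * ∫⁻ x in S, h x ∂μ := by rw [mul_assoc]; gcongr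

end Grid

/-! ### Dyadic Muckenhoupt weights -/

namespace Grid

variable {n : ℕ} (D : Grid n)

/-- `v` is a positive weight whose dyadic `A_q` constant is at most `W`. -/
structure IsAp (q : ℝ) (v : Rn n → ℝ≥0∞) (W : ℝ≥0∞) : Prop where
  one_lt : 1 < q
  measurable : Measurable v
  -- Positivity and finiteness hold everywhere so that powers of v can be inverted pointwise; a
  -- change on a null set achieves this.
  ne_zero : ∀ x, v x ≠ 0
  ne_top : ∀ x, v x ≠ ∞
  const_ne_top : W ≠ ∞
  lintegral_ne_top : ∀ k x, ∫⁻ y in D.cell k x, v y ≠ ∞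
  le_const : ∀ k x, ((volume (D.cell k x))⁻¹ * ∫⁻ y in D.cell k x, v y) *
    ((volume (D.cell k x))⁻¹ * ∫⁻ y in D.cell k x, v y ^ (-(q - 1)⁻¹)) ^ (q - 1) ≤ W

variable {D}

lemma withDensity_cell_ne_zero {u : Rn n → ℝ≥0∞} (hu : Measurable u) (h0 : ∀ x, u x ≠ 0) (k : ℤ)
    (x : Rn n) : ∫⁻ y in D.cell k x, u y ≠ 0 := by
  intro h
  rw [lintegral_eq_zero_iff hu] at h
  have : ∀ᵐ y ∂(volume.restrict (D.cell k x)), False := by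
    filter_upwards [h] with y hy using h0 y hy
  rw [Filter.eventually_false_iff_eq_bot, ae_eq_bot, Measure.restrict_eq_zero] at this
  exact D.volume_cell_ne_zero k x this

namespace IsAp

variable {q : ℝ} {v : Rn n → ℝ≥0∞} {W : ℝ≥0∞}

lemma dual_ne_zero (hv : D.IsAp q v W) (x : Rn n) : v x ^ (-(q - 1)⁻¹) ≠ 0 := by
  simp [ENNReal.rpow_eq_zero_iff, hv.ne_zero x, hv.ne_top x]

lemma dual_ne_top (hv : D.IsAp q v W) (x : Rn n) : v x ^ (-(q - 1)⁻¹) ≠ ∞ := by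
  simp [ENNReal.rpow_eq_top_iff, hv.ne_zero x, hv.ne_top x]

lemma regular (hv : D.IsAp q v W) : D.Regular (volume.withDensity v) := fun k x => by
  rw [withDensity_apply _ (D.measurableSet_cell k x)]
  exact ⟨withDensity_cell_ne_zero hv.measurable hv.ne_zero k x, hv.lintegral_ne_top k x⟩

/-- As v has positive mass on every cube, infinite dual mass would make the A_q product infinite. -/
lemma dual_lintegral_ne_top (hv : D.IsAp q v W) (k : ℤ) (x : Rn n) :
    ∫⁻ y in D.cell k x, v y ^ (-(q - 1)⁻¹) ≠ ∞ := by
  intro h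
  have := hv.le_const k x
  have hq := hv.one_lt
  rw [h, ENNReal.mul_top (by simpa using D.volume_cell_ne_top k x),
    ENNReal.top_rpow_of_pos (by linarith), ENNReal.mul_top] at this
  · exact hv.const_ne_top (top_le_iff.1 this)
  · exact mul_ne_zero (by simpa using D.volume_cell_ne_top k x)
      (withDensity_cell_ne_zero hv.measurable hv.ne_zero k x)

lemma regular_dual (hv : D.IsAp q v W) :
    D.Regular (volume.withDensity fun x => v x ^ (-(q - 1)⁻¹)) := fun k x => by
  rw [withDensity_apply _ (D.measurableSet_cell k x)]
  exact ⟨withDensity_cell_ne_zero (hv.measurable.pow_const _) hv.dual_ne_zero k x,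
    hv.dual_lintegral_ne_top k x⟩

/-- The pointwise bound behind Lerner's proof of Buckley's theorem. -/
lemma maximal_rpow_le (hv : D.IsAp q v W) {f : Rn n → ℝ≥0∞} (hf : Measurable f) (x : Rn n) :
    D.maximal volume f x ^ (q - 1) ≤ W * D.maximal (volume.withDensity v)
      (fun y => D.maximal (volume.withDensity fun x => v x ^ (-(q - 1)⁻¹))
        (fun z => (v z ^ (-(q - 1)⁻¹))⁻¹ * f z) y ^ (q - 1) * (v y)⁻¹) x := by
  have hq : 0 < q - 1 := by linarith [hv.one_lt]
  set σ : Rn n → ℝ≥0∞ := fun x => v x ^ (-(q - 1)⁻¹) with hσ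
  have hσm : Measurable σ := hv.measurable.pow_const _
  have hσf : Measurable fun z => (σ z)⁻¹ * f z := hσm.inv.mul hf
  set N := D.maximal (volume.withDensity σ) (fun z => (σ z)⁻¹ * f z) with hN
  set g : Rn n → ℝ≥0∞ := fun y => N y ^ (q - 1) * (v y)⁻¹ with hg
  have hgm : Measurable g := ((D.measurable_maximal _ _).pow_const _).mul hv.measurable.inv
  have key : ∀ k, D.avg volume f k x ^ (q - 1) ≤ W * D.maximal (volume.withDensity v) g x := by
    intro k
    set Q := D.cell k x with hQ
    have hQm := D.measurableSet_cell k x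
    set V := volume Q
    set u := ∫⁻ y in Q, v y
    set s := ∫⁻ y in Q, σ y
    set a := ∫⁻ y in Q, f y
    have hV0 : V ≠ 0 := D.volume_cell_ne_zero k x
    have hVt : V ≠ ∞ := D.volume_cell_ne_top k x
    have hu0 : u ≠ 0 := withDensity_cell_ne_zero hv.measurable hv.ne_zero k x
    have hut : u ≠ ∞ := hv.lintegral_ne_top k x
    have hs0 : s ≠ 0 := withDensity_cell_ne_zero hσm hv.dual_ne_zero k x
    have hst : s ≠ ∞ := hv.dual_lintegral_ne_top k x
    have hap : (V⁻¹ * u) * (V⁻¹ * s) ^ (q - 1) ≤ W := hv.le_const k x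
    -- The quotient a/s is the σ-average over Q of f/σ, hence below N at every point of Q.
    have h1 : ∀ y ∈ Q, s⁻¹ * a ≤ N y := by
      intro y hy
      have : D.avg (volume.withDensity σ) (fun z => (σ z)⁻¹ * f z) k y = s⁻¹ * a := by
        rw [D.avg_eq_of_mem hy, avg, withDensity_apply _ hQm,
          setLIntegral_withDensity_eq_setLIntegral_mul _ hσm hσf hQm]
        congr 1
        refine lintegral_congr fun z => ?_
        rw [Pi.mul_apply, ← mul_assoc, ENNReal.mul_inv_cancel (hv.dual_ne_zero z)
          (hv.dual_ne_top z), one_mul]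
      exact this ▸ D.avg_le_maximal _ _ k y
    -- A constant integrated over Q in Lebesgue measure is v⁻¹ times it integrated against v;
    -- bounding the constant by `N ^ (q - 1)` produces g and then its v-average.
    have h2 : V * (s⁻¹ * a) ^ (q - 1) ≤ u * D.maximal (volume.withDensity v) g x := by
      calc V * (s⁻¹ * a) ^ (q - 1) = ∫⁻ _ in Q, (s⁻¹ * a) ^ (q - 1) := by
            rw [setLIntegral_const, mul_comm]
        _ ≤ ∫⁻ y in Q, v y * g y := by
            refine setLIntegral_mono' hQm fun y hy => ?_
            rw [hg]
            dsimp only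
            rw [mul_comm (v y), mul_assoc, ENNReal.inv_mul_cancel (hv.ne_zero y) (hv.ne_top y),
              mul_one]
            exact ENNReal.rpow_le_rpow (h1 y hy) hq.le
        _ = u * D.avg (volume.withDensity v) g k x := by
            have h3 := measure_mul_avg hv.regular g k x
            rw [withDensity_apply _ hQm,
              setLIntegral_withDensity_eq_setLIntegral_mul _ hv.measurable hgm hQm] at h3
            exact h3.symm
        _ ≤ _ := by gcongr; exact D.avg_le_maximal _ _ k x
    have h3 : D.avg volume f k x = (V⁻¹ * s) * (s⁻¹ * a) := by
      rw [mul_assoc, ← mul_assoc s, ENNReal.mul_inv_cancel hs0 hst, one_mul, avg]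
    have h4 : (V⁻¹ * s) ^ (q - 1) ≤ W * (V * u⁻¹) := by
      calc (V⁻¹ * s) ^ (q - 1) = ((V⁻¹ * u) * (V⁻¹ * s) ^ (q - 1)) * (V * u⁻¹) := by
            rw [show (V⁻¹ * u) * (V⁻¹ * s) ^ (q - 1) * (V * u⁻¹)
              = (V⁻¹ * V) * (u * u⁻¹) * (V⁻¹ * s) ^ (q - 1) by ring,
              ENNReal.inv_mul_cancel hV0 hVt, ENNReal.mul_inv_cancel hu0 hut, one_mul, one_mul]
        _ ≤ _ := by gcongr
    rw [h3, ENNReal.mul_rpow_of_nonneg _ _ hq.le]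
    calc (V⁻¹ * s) ^ (q - 1) * (s⁻¹ * a) ^ (q - 1)
        ≤ W * (V * u⁻¹) * (s⁻¹ * a) ^ (q - 1) := by gcongr
      _ = W * u⁻¹ * (V * (s⁻¹ * a) ^ (q - 1)) := by ring
      _ ≤ W * u⁻¹ * (u * D.maximal (volume.withDensity v) g x) := by gcongr
      _ = W * D.maximal (volume.withDensity v) g x := by
          rw [mul_assoc, ← mul_assoc u⁻¹, ENNReal.inv_mul_cancel hu0 hut, one_mul]
  have : D.maximal volume f x ^ (q - 1) = ⨆ k, D.avg volume f k x ^ (q - 1) :=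
    (ENNReal.orderIsoRpow (q - 1) hq).map_iSup _
  rw [this]
  exact iSup_le key

/-- Buckley's theorem for the dyadic maximal function. -/
theorem lintegral_maximal_rpow_le (hv : D.IsAp q v W) {f : Rn n → ℝ≥0∞} (hf : Measurable f) :
    ∫⁻ x, D.maximal volume f x ^ q * v x ≤
      ENNReal.ofReal (2 * (q / (q - 1)) * (2 ^ (q / (q - 1) - 1) * (q / (q - 1) - 1)⁻¹)) *
      ENNReal.ofReal (2 * q * (2 ^ (q - 1) * (q - 1)⁻¹)) *
        (W ^ (q / (q - 1)) * ∫⁻ x, f x ^ q * v x) := by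
  have hq1 : 0 < q - 1 := by linarith [hv.one_lt]
  have hq : 1 < q := hv.one_lt
  set r := q / (q - 1) with hr
  have hr1 : 1 < r := by rw [hr, lt_div_iff₀ hq1]; linarith
  have hqr : (q - 1) * r = q := by rw [hr]; field_simp
  set σ : Rn n → ℝ≥0∞ := fun x => v x ^ (-(q - 1)⁻¹) with hσ
  have hσm : Measurable σ := hv.measurable.pow_const _
  have hσf : Measurable fun z => (σ z)⁻¹ * f z := hσm.inv.mul hf
  set N := D.maximal (volume.withDensity σ) (fun z => (σ z)⁻¹ * f z) with hN
  have hNm : Measurable N := D.measurable_maximal _ _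
  set g : Rn n → ℝ≥0∞ := fun y => N y ^ (q - 1) * (v y)⁻¹ with hg
  have hgm : Measurable g := (hNm.pow_const _).mul hv.measurable.inv
  have hWr : W ^ r ≠ ∞ := ENNReal.rpow_ne_top_of_nonneg (by linarith) hv.const_ne_top
  have step1 : ∫⁻ x, D.maximal volume f x ^ q * v x
      ≤ W ^ r * ∫⁻ x, D.maximal (volume.withDensity v) g x ^ r ∂(volume.withDensity v) := by
    rw [lintegral_withDensity_eq_lintegral_mul _ hv.measurable
      ((D.measurable_maximal _ _).pow_const _), ← lintegral_const_mul' _ _ hWr]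
    refine lintegral_mono fun x => ?_
    rw [Pi.mul_apply, mul_comm (v x), ← mul_assoc, ← ENNReal.mul_rpow_of_nonneg _ _ (by linarith)]
    gcongr
    conv_lhs => rw [← hqr, ENNReal.rpow_mul]
    exact ENNReal.rpow_le_rpow (hv.maximal_rpow_le hf x) (by linarith)
  -- With r = q/(q-1) one has 1 - r = -1/(q-1), so v · v^{-r} = σ, while (q-1)r = q.
  have step2 : ∫⁻ x, g x ^ r ∂(volume.withDensity v) = ∫⁻ x, N x ^ q ∂(volume.withDensity σ) := by
    rw [lintegral_withDensity_eq_lintegral_mul _ hv.measurable (hgm.pow_const _),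
      lintegral_withDensity_eq_lintegral_mul _ hσm (hNm.pow_const _)]
    refine lintegral_congr fun x => ?_
    rw [Pi.mul_apply, Pi.mul_apply, hg]
    dsimp only
    rw [ENNReal.mul_rpow_of_nonneg _ _ (by linarith), ← ENNReal.rpow_mul, hqr,
      ← ENNReal.rpow_neg_one, ← ENNReal.rpow_mul, mul_left_comm, mul_comm]
    congr 1
    conv_lhs => rw [← ENNReal.rpow_one (v x), ← ENNReal.rpow_mul,
      ← ENNReal.rpow_add _ _ (hv.ne_zero x) (hv.ne_top x)]
    rw [hσ]
    congr 1
    rw [hr]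
    field_simp
    ring
  -- Here σ^{1-q} = v. The weight enters the argument only through the one factor W of step1, since
  -- Doob's constants do not depend on the measure.
  have step3 : ∫⁻ x, ((σ x)⁻¹ * f x) ^ q ∂(volume.withDensity σ) = ∫⁻ x, f x ^ q * v x := by
    rw [lintegral_withDensity_eq_lintegral_mul _ hσm (hσf.pow_const _)]
    refine lintegral_congr fun x => ?_
    rw [Pi.mul_apply, ENNReal.mul_rpow_of_nonneg _ _ (by linarith), ← mul_assoc, mul_comm]
    congr 1
    rw [← ENNReal.rpow_neg_one (σ x), ← ENNReal.rpow_mul, hσ]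
    dsimp only
    rw [← ENNReal.rpow_mul, ← ENNReal.rpow_add _ _ (hv.ne_zero x) (hv.ne_top x)]
    conv_rhs => rw [← ENNReal.rpow_one (v x)]
    congr 1
    field_simp
    ring
  have d1 := Grid.lintegral_maximal_rpow_le hv.regular hgm hr1
  have d2 := Grid.lintegral_maximal_rpow_le hv.regular_dual hσf hq
  rw [step3] at d2
  rw [step2] at d1
  calc _ ≤ W ^ r * _ := step1
    _ ≤ W ^ r * (_ * (_ * _)) := by gcongr; exact d1.trans (by gcongr)
    _ = _ := by ring

/-- A subset of a cube of at least half its volume has a comparable weighted measure. -/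
lemma measure_le_of_half (hv : D.IsAp q v W) {k : ℤ} {x : Rn n} {E : Set (Rn n)}
    (hEQ : E ⊆ D.cell k x) (hhalf : volume (D.cell k x) ≤ 2 * volume E) :
    ∫⁻ y in D.cell k x, v y ≤ 2 ^ q * W * ∫⁻ y in E, v y := by
  have hq1 : 0 < q - 1 := by linarith [hv.one_lt]
  have hq : 1 < q := hv.one_lt
  have hq0 : 0 < q := by linarith
  set σ : Rn n → ℝ≥0∞ := fun x => v x ^ (-(q - 1)⁻¹) with hσ
  set V := volume (D.cell k x)
  set u := ∫⁻ y in D.cell k x, v y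
  set s := ∫⁻ y in D.cell k x, σ y
  set e := ∫⁻ y in E, v y
  have hV0 : V ≠ 0 := D.volume_cell_ne_zero k x
  have hVt : V ≠ ∞ := D.volume_cell_ne_top k x
  have hap : (V⁻¹ * u) * (V⁻¹ * s) ^ (q - 1) ≤ W := hv.le_const k x
  have hconj : q.HolderConjugate (q / (q - 1)) := Real.HolderConjugate.conjExponent hq
  -- Hölder's inequality for 1 = v^{1/q} · v^{-1/q} on E, after which the dual integral is enlarged
  -- to the whole cube.
  have hE1 : volume E ≤ e ^ (1 / q) * s ^ (1 / (q / (q - 1))) := by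
    have hh := ENNReal.lintegral_mul_le_Lp_mul_Lq (volume.restrict E) hconj
      (f := fun y => v y ^ (1 / q)) (g := fun y => v y ^ (-(1 / q)))
      (hv.measurable.pow_const _).aemeasurable (hv.measurable.pow_const _).aemeasurable
    have c1 : ∀ y, ((fun y => v y ^ (1 / q)) * fun y => v y ^ (-(1 / q))) y = 1 := by
      intro y
      rw [Pi.mul_apply, ← ENNReal.rpow_add _ _ (hv.ne_zero y) (hv.ne_top y)]
      simp
    have c2 : ∀ y, (v y ^ (1 / q)) ^ q = v y := by
      intro y; rw [← ENNReal.rpow_mul]; simp [hq0.ne']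
    have c3 : ∀ y, (v y ^ (-(1 / q))) ^ (q / (q - 1)) = σ y := by
      intro y; rw [← ENNReal.rpow_mul, hσ]; dsimp only; congr 1; field_simp
    simp only [c1, c2, c3, lintegral_one, Measure.restrict_apply_univ] at hh
    refine hh.trans ?_
    gcongr
    exact lintegral_mono_set hEQ
  have hE2 : V ^ q ≤ 2 ^ q * (e * s ^ (q - 1)) := by
    have : volume E ^ q ≤ e * s ^ (q - 1) := by
      refine (ENNReal.rpow_le_rpow hE1 hq0.le).trans_eq ?_
      rw [ENNReal.mul_rpow_of_nonneg _ _ hq0.le, ← ENNReal.rpow_mul, ← ENNReal.rpow_mul]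
      congr 2
      · field_simp; simp
      · field_simp
    calc V ^ q ≤ (2 * volume E) ^ q := ENNReal.rpow_le_rpow hhalf hq0.le
      _ = 2 ^ q * volume E ^ q := ENNReal.mul_rpow_of_nonneg _ _ hq0.le
      _ ≤ _ := by gcongr
  have hVq0 : V ^ q ≠ 0 := by simp [ENNReal.rpow_eq_zero_iff, hV0, hVt]
  have hVqt : V ^ q ≠ ∞ := ENNReal.rpow_ne_top_of_nonneg hq0.le hVt
  have h5 : u * s ^ (q - 1) ≤ W * V ^ q := by
    have hVV : V⁻¹ * V = 1 := ENNReal.inv_mul_cancel hV0 hVt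
    calc u * s ^ (q - 1) = ((V⁻¹ * u) * (V⁻¹ * s) ^ (q - 1)) * V ^ q := by
          rw [ENNReal.mul_rpow_of_nonneg _ _ hq1.le]
          have : V ^ q = V * V ^ (q - 1) := by
            conv_rhs => rw [← ENNReal.rpow_one V, ← ENNReal.rpow_mul, one_mul,
              ← ENNReal.rpow_add _ _ hV0 hVt]
            congr 1; ring
          rw [this, show V⁻¹ * u * (V⁻¹ ^ (q - 1) * s ^ (q - 1)) * (V * V ^ (q - 1))
            = (V⁻¹ * V) * (V⁻¹ ^ (q - 1) * V ^ (q - 1)) * (u * s ^ (q - 1)) by ring, hVV,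
            ← ENNReal.mul_rpow_of_nonneg _ _ hq1.le, hVV]
          simp
      _ ≤ _ := by gcongr
  have h6 : V ^ q * u ≤ V ^ q * (2 ^ q * W * e) := by
    calc V ^ q * u ≤ 2 ^ q * (e * s ^ (q - 1)) * u := by gcongr
      _ = 2 ^ q * e * (u * s ^ (q - 1)) := by ring
      _ ≤ 2 ^ q * e * (W * V ^ q) := by gcongr
      _ = _ := by ring
  exact (ENNReal.mul_le_mul_iff_right hVq0 hVqt).1 h6

end IsAp

end Grid

/-! ### Hölder atoms and the coefficients of a function -/

lemma continuous_of_norm_sub_le {E F : Type*} [NormedAddCommGroup E] [NormedAddCommGroup F]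
    {K : E → F} {C ℓ β : ℝ} (hβ : 0 < β)
    (h : ∀ y y', ‖K y - K y'‖ ≤ C * (‖y - y'‖ / ℓ) ^ β) : Continuous K := by
  rw [continuous_iff_continuousAt]
  intro y
  have h1 : Filter.Tendsto (fun z => C * (‖z - y‖ / ℓ) ^ β) (nhds y) (nhds 0) := by
    have h2 : Continuous fun z : E => C * (‖z - y‖ / ℓ) ^ β :=
      ((((continuous_id.sub continuous_const).norm).div_const ℓ).rpow_const
        fun _ => Or.inr hβ.le).const_mul C
    have := h2.tendsto y
    simpa [Real.zero_rpow hβ.ne'] using this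
  rw [ContinuousAt, tendsto_iff_norm_sub_tendsto_zero]
  exact squeeze_zero (fun _ => norm_nonneg _) (fun z => h z y) h1

/-- Normalized Hölder continuous functions with mean zero that are supported in `S`. -/
structure IsAtom {n : ℕ} (β : ℝ) (k : ℤ) (S : Set (Rn n)) (K : Rn n → ℂ) : Prop where
  eq_zero : ∀ y ∉ S, K y = 0
  integral_eq_zero : ∫ y, K y = 0
  norm_le : ∀ y, ‖K y‖ ≤ (((2 : ℝ) ^ k) ^ n)⁻¹
  holder : ∀ y y', ‖K y - K y'‖ ≤ (((2 : ℝ) ^ k) ^ n)⁻¹ * (‖y - y'‖ / 2 ^ k) ^ β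

lemma isAtom_zero {n : ℕ} (β : ℝ) (k : ℤ) (S : Set (Rn n)) : IsAtom β k S (fun _ => 0) where
  eq_zero _ _ := rfl
  integral_eq_zero := by simp
  norm_le _ := by rw [norm_zero]; positivity
  holder y y' := by rw [sub_self, norm_zero]; positivity

lemma IsAtom.continuous {n : ℕ} {β : ℝ} (hβ : 0 < β) {k : ℤ} {S : Set (Rn n)} {K : Rn n → ℂ}
    (h : IsAtom β k S K) : Continuous K := continuous_of_norm_sub_le hβ h.holder

/-- The largest pairing of `f` with an atom on `S`. -/
noncomputable def coef {n : ℕ} (β : ℝ) (f : Rn n → ℂ) (k : ℤ) (S : Set (Rn n)) : ℝ≥0∞ :=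
  ⨆ (K : Rn n → ℂ) (_ : IsAtom β k S K), ‖∫ y, K y * f y‖ₑ

lemma le_coef {n : ℕ} {β : ℝ} {k : ℤ} {S : Set (Rn n)} {K : Rn n → ℂ} (h : IsAtom β k S K)
    (f : Rn n → ℂ) : ‖∫ y, K y * f y‖ₑ ≤ coef β f k S :=
  le_iSup₂ (f := fun (K : Rn n → ℂ) (_ : IsAtom β k S K) => ‖∫ y, K y * f y‖ₑ) K h

/-- A nearly extremal atom replaces the supremum by a single pairing, linear in f, which the duality
argument for the L² bound needs. -/
lemma exists_coef_le {n : ℕ} (β : ℝ) (f : Rn n → ℂ) (k : ℤ) (S : Set (Rn n)) :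
    ∃ K, IsAtom β k S K ∧ (coef β f k S ≠ ∞ → coef β f k S ≤ 2 * ‖∫ y, K y * f y‖ₑ) := by
  by_cases h0 : coef β f k S = 0 ∨ coef β f k S = ∞
  · refine ⟨_, isAtom_zero β k S, fun h => ?_⟩
    rw [h0.resolve_right h]
    exact zero_le
  · push Not at h0
    have hlt : coef β f k S / 2 < coef β f k S := ENNReal.half_lt_self h0.1 h0.2
    conv_rhs at hlt => rw [coef]
    obtain ⟨K, hK⟩ := lt_iSup_iff.1 hlt
    obtain ⟨hK1, hK2⟩ := lt_iSup_iff.1 hK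
    refine ⟨K, hK1, fun _ => ?_⟩
    rw [mul_comm]
    exact (ENNReal.div_le_iff_le_mul (by simp) (by simp)).1 hK2.le

lemma two_zpow_div_rpow {j k : ℤ} (hjk : j ≤ k) (β : ℝ) :
    ((2 : ℝ) ^ j / 2 ^ k) ^ β = ((2 : ℝ) ^ (-β)) ^ (k - j).natAbs := by
  obtain ⟨m, rfl⟩ := Int.le.dest hjk
  rw [add_sub_cancel_left, Int.natAbs_natCast, zpow_add₀ (by norm_num), zpow_natCast,
    ← div_div, div_self (by positivity), ← Real.rpow_natCast, ← Real.rpow_natCast,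
    ← Real.rpow_mul (by norm_num), one_div, ← Real.rpow_neg (by norm_num),
    ← Real.rpow_mul (by norm_num)]
  congr 1
  ring

/-- The constant in the almost orthogonality estimate. -/
noncomputable def orthConst (n : ℕ) (β : ℝ) : ℝ :=
  ((n : ℝ) + 1) ^ β * ∑' i : ℤ, ((2 : ℝ) ^ (-β)) ^ i.natAbs

lemma summable_pow_natAbs {r : ℝ} (h0 : 0 ≤ r) (h1 : r < 1) :
    Summable fun i : ℤ => r ^ i.natAbs := by
  have := summable_geometric_of_lt_one h0 h1
  exact Summable.of_nat_of_neg (by simpa using this) (by simpa using this)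

lemma two_rpow_neg_lt_one {β : ℝ} (hβ : 0 < β) : (2 : ℝ) ^ (-β) < 1 :=
  Real.rpow_lt_one_of_one_lt_of_neg (by norm_num) (by linarith)

/-- The uniform row-sum bound for the Schur test below. -/
lemma sum_pow_natAbs_le {β : ℝ} (hβ : 0 < β) (s : Finset ℤ) (k : ℤ) :
    ∑ j ∈ s, ((2 : ℝ) ^ (-β)) ^ (k - j).natAbs ≤ ∑' i : ℤ, ((2 : ℝ) ^ (-β)) ^ i.natAbs := by
  have hs := summable_pow_natAbs (r := (2 : ℝ) ^ (-β)) (by positivity) (two_rpow_neg_lt_one hβ)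
  rw [← (Equiv.subLeft k).tsum_eq]
  exact ((Equiv.subLeft k).summable_iff.2 hs).sum_le_tsum s fun _ _ => by positivity

lemma orthConst_pos (n : ℕ) {β : ℝ} (hβ : 0 < β) : 0 < orthConst n β := by
  have h1 := sum_pow_natAbs_le hβ {0} 0
  simp only [Finset.sum_singleton, sub_self, Int.natAbs_zero, pow_zero] at h1
  have : 0 < ((n : ℝ) + 1) ^ β := by positivity
  exact mul_pos this (by linarith)

namespace Grid

variable {n : ℕ} (D : Grid n)

/-- The coefficient `coef` of the cube of scale `2 ^ k` containing `x`. -/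
noncomputable def cf (β : ℝ) (f : Rn n → ℂ) (k : ℤ) (x : Rn n) : ℝ≥0∞ :=
  coef β f k (D.cell k x)

lemma measurable_cf (β : ℝ) (f : Rn n → ℂ) (k : ℤ) : Measurable (D.cf β f k) :=
  D.measurable_fun_cell k _

lemma cf_eq_of_mem {β : ℝ} {f : Rn n → ℂ} {k : ℤ} {x y : Rn n} (hy : y ∈ D.cell k x) :
    D.cf β f k y = D.cf β f k x := by
  simp only [cf, D.cell_eq_of_mem hy]

/-- An atom lives on its cube and is at most the reciprocal of the volume. This crude bound gives
finiteness and handles the top scale in the stopping argument. -/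
lemma cf_le_avg (β : ℝ) (f : Rn n → ℂ) (k : ℤ) (x : Rn n) :
    D.cf β f k x ≤ D.avg volume (fun y => ‖f y‖ₑ) k x := by
  refine iSup₂_le fun K hK => ?_
  have h0 : (0 : ℝ) < ((2 : ℝ) ^ k) ^ n := by positivity
  calc ‖∫ y, K y * f y‖ₑ = ‖∫ y in D.cell k x, K y * f y‖ₑ := by
        rw [setIntegral_eq_integral_of_forall_compl_eq_zero]
        intro y hy; rw [hK.eq_zero y hy, zero_mul]
    _ ≤ ∫⁻ y in D.cell k x, ‖K y * f y‖ₑ := enorm_integral_le_lintegral_enorm _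
    _ ≤ ∫⁻ y in D.cell k x, (volume (D.cell k x))⁻¹ * ‖f y‖ₑ := by
        refine lintegral_mono fun y => ?_
        rw [enorm_mul, volume_cell, ← ENNReal.ofReal_inv_of_pos h0]
        gcongr
        rw [← ofReal_norm]
        exact ENNReal.ofReal_le_ofReal (hK.norm_le y)
    _ = _ := lintegral_const_mul' _ _ (by simpa using D.volume_cell_ne_zero k x)

variable {D}

lemma avg_le_of_norm_le {f : Rn n → ℂ} {B : ℝ} (h : ∀ y, ‖f y‖ ≤ B) (k : ℤ) (x : Rn n) :
    D.avg volume (fun y => ‖f y‖ₑ) k x ≤ ENNReal.ofReal B := by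
  calc D.avg volume (fun y => ‖f y‖ₑ) k x
      ≤ (volume (D.cell k x))⁻¹ * ∫⁻ _ in D.cell k x, ENNReal.ofReal B := by
        unfold avg
        refine mul_le_mul_right (lintegral_mono fun y => ?_) _
        rw [← ofReal_norm]
        exact ENNReal.ofReal_le_ofReal (h y)
    _ = ENNReal.ofReal B := by
        rw [setLIntegral_const, mul_comm _ (volume _), ← mul_assoc,
          ENNReal.inv_mul_cancel (D.volume_cell_ne_zero k x) (D.volume_cell_ne_top k x), one_mul]

/-! ### Almost orthogonality of atoms at different scales -/

section AlmostOrthogonality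

variable {β : ℝ} {g : Rn n → ℂ} {B : ℝ} {K : ℤ → Set (Rn n) → Rn n → ℂ}

/-- The pairing of `g` with the atom chosen on the cube of scale `2 ^ k` containing `x`. -/
noncomputable def pairing (D : Grid n) (K : ℤ → Set (Rn n) → Rn n → ℂ) (g : Rn n → ℂ) (k : ℤ)
    (x : Rn n) : ℂ := ∫ y, K k (D.cell k x) y * g y

/-- The part of scale `2 ^ k` in the dual expansion of `g`. -/
noncomputable def synthesis (D : Grid n) (K : ℤ → Set (Rn n) → Rn n → ℂ) (g : Rn n → ℂ) (k : ℤ)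
    (y : Rn n) : ℂ :=
  -- The volume factor and the conjugate are chosen so that integrating g against this function over
  -- a cube Q of scale `2 ^ k` gives |Q||c_Q|².
  ((((2 : ℝ) ^ k) ^ n : ℝ) : ℂ) * (starRingEnd ℂ) (D.pairing K g k y) * K k (D.cell k y) y

lemma measurable_pairing (k : ℤ) : Measurable (D.pairing K g k) :=
  D.measurable_fun_cell k fun S => ∫ y, K k S y * g y

lemma pairing_eq_of_mem {k : ℤ} {x y : Rn n} (hy : y ∈ D.cell k x) :
    D.pairing K g k y = D.pairing K g k x := by
  simp only [pairing, D.cell_eq_of_mem hy]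

lemma measurable_synthesis (hβ : 0 < β) (hK : ∀ k S, IsAtom β k S (K k S)) (k : ℤ) :
    Measurable (D.synthesis K g k) :=
  ((Complex.continuous_conj.measurable.comp (measurable_pairing k)).const_mul _).mul
    (D.measurable_uncurry_cell k (K k) fun S => ((hK k S).continuous hβ).measurable)

lemma norm_pairing_le (hK : ∀ k S, IsAtom β k S (K k S)) (hg : ∀ y, ‖g y‖ ≤ B) (k : ℤ)
    (x : Rn n) : ‖D.pairing K g k x‖ ≤ B := by
  have hB : 0 ≤ B := (norm_nonneg _).trans (hg 0)
  have h1 : ‖D.pairing K g k x‖ₑ ≤ ENNReal.ofReal B :=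
    ((le_coef (hK k _) g).trans (D.cf_le_avg β g k x)).trans (avg_le_of_norm_le hg k x)
  rw [← ofReal_norm] at h1
  exact (ENNReal.ofReal_le_ofReal_iff hB).1 h1

lemma norm_synthesis_le (hK : ∀ k S, IsAtom β k S (K k S)) (k : ℤ) (y : Rn n) :
    ‖D.synthesis K g k y‖ ≤ ‖D.pairing K g k y‖ := by
  have h0 : (0 : ℝ) < ((2 : ℝ) ^ k) ^ n := by positivity
  rw [synthesis, norm_mul, norm_mul, Complex.norm_real, RCLike.norm_conj, Real.norm_of_nonneg h0.le]
  calc _ ≤ ((2 : ℝ) ^ k) ^ n * ‖D.pairing K g k y‖ * (((2 : ℝ) ^ k) ^ n)⁻¹ := by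
        gcongr; exact (hK k _).norm_le y
    _ = _ := by field_simp

lemma integrableOn_of_bounded {F : Set (Rn n)} (hF : volume F ≠ ∞) {φ : Rn n → ℂ} {C : ℝ}
    (hm : AEStronglyMeasurable φ (volume.restrict F)) (h : ∀ y, ‖φ y‖ ≤ C) : IntegrableOn φ F :=
  IntegrableOn.of_bound (lt_top_iff_ne_top.2 hF) hm C (Filter.Eventually.of_forall h)

/-- On one cube Q the pairing is constant and the atom integrates against g to that pairing, so both
sides equal |Q||c_Q|²; the cubes inside the large cell are then summed. -/
lemma integral_mul_synthesis (hβ : 0 < β) (hK : ∀ k S, IsAtom β k S (K k S))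
    (hgm : AEStronglyMeasurable g volume) (hg : ∀ y, ‖g y‖ ≤ B) {k k₁ : ℤ} (hk : k ≤ k₁)
    (x : Rn n) :
    ∫ y in D.cell k₁ x, g y * D.synthesis K g k y
      = ∫ y in D.cell k₁ x, ((‖D.pairing K g k y‖ ^ 2 : ℝ) : ℂ) := by
  have hB : 0 ≤ B := (norm_nonneg _).trans (hg 0)
  have hc := norm_pairing_le (D := D) hK hg
  have hfin := D.volume_cell_ne_top k₁ x
  have hs := measurable_synthesis (D := D) (g := g) hβ hK k
  have i1 : IntegrableOn (fun y => g y * D.synthesis K g k y) (D.cell k₁ x) := by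
    refine integrableOn_of_bounded (C := B * B) hfin
      (hgm.restrict.mul hs.aestronglyMeasurable) fun y => ?_
    rw [norm_mul]
    exact mul_le_mul (hg y) ((norm_synthesis_le hK k y).trans (hc k y)) (norm_nonneg _) hB
  have i2 : IntegrableOn (fun y => ((‖D.pairing K g k y‖ ^ 2 : ℝ) : ℂ)) (D.cell k₁ x) := by
    refine integrableOn_of_bounded (C := B ^ 2) hfin
      (Complex.measurable_ofReal.comp
        ((measurable_pairing k).norm.pow_const 2)).aestronglyMeasurable fun y => ?_
    rw [Complex.norm_real, Real.norm_of_nonneg (by positivity)]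
    exact pow_le_pow_left₀ (norm_nonneg _) (hc k y) 2
  -- The difference of the two integrals is bounded cube by cube by zero.
  rw [← sub_eq_zero, ← integral_sub i1 i2, ← enorm_eq_zero, ← nonpos_iff_eq_zero]
  have := (isCellUnion_const (D := D) hk x).enorm_integral_le (i1.sub i2)
    (ψ := fun _ => 0) (ν := volume) ?_
  · simpa using this
  · intro z hz
    have hsub := D.cell_subset_of_mem hk hz
    rw [lintegral_zero, nonpos_iff_eq_zero, enorm_eq_zero]
    simp only [Pi.sub_apply]
    rw [integral_sub (i1.mono_set hsub) (i2.mono_set hsub), sub_eq_zero]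
    have e1 : ∫ y in D.cell k z, g y * D.synthesis K g k y
        = ∫ y in D.cell k z, ((((2 : ℝ) ^ k) ^ n : ℝ) : ℂ) *
          (starRingEnd ℂ) (D.pairing K g k z) * (K k (D.cell k z) y * g y) := by
      refine setIntegral_congr_fun (D.measurableSet_cell k z) fun y hy => ?_
      simp only [synthesis, pairing_eq_of_mem hy, D.cell_eq_of_mem hy]
      ring
    have e2 : ∫ y in D.cell k z, ((‖D.pairing K g k y‖ ^ 2 : ℝ) : ℂ)
        = ∫ _ in D.cell k z, ((‖D.pairing K g k z‖ ^ 2 : ℝ) : ℂ) := by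
      refine setIntegral_congr_fun (D.measurableSet_cell k z) fun y hy => ?_
      simp only [pairing_eq_of_mem hy]
    rw [e1, e2, integral_const_mul, setIntegral_eq_integral_of_forall_compl_eq_zero,
      setIntegral_const,
      measureReal_def, volume_cell, ENNReal.toReal_ofReal (by positivity)]
    · change _ * _ * D.pairing K g k z = _
      rw [mul_assoc, mul_comm ((starRingEnd ℂ) _), Complex.mul_conj, Complex.normSq_eq_norm_sq]
      simp
    · intro y hy; rw [(hK k _).eq_zero y hy, zero_mul]

/-- On a cube R of the finer scale j the finer atom has mean zero, so the coarser atom may be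
replaced by its oscillation on R; its Hölder bound gains the factor 2^{-β(k-j)}. -/
lemma enorm_integral_synthesis_mul_le (hβ : 0 < β) (hK : ∀ k S, IsAtom β k S (K k S))
    (hg : ∀ y, ‖g y‖ ≤ B) {j k k₁ : ℤ} (hjk : j ≤ k) (hk : k ≤ k₁) (x : Rn n) :
    ‖∫ y in D.cell k₁ x, D.synthesis K g k y * (starRingEnd ℂ) (D.synthesis K g j y)‖ₑ
      ≤ ∫⁻ y in D.cell k₁ x, ENNReal.ofReal ((((n : ℝ) + 1) ^ β *
          ((2 : ℝ) ^ (-β)) ^ (k - j).natAbs) *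
            (‖D.pairing K g k y‖ * ‖D.pairing K g j y‖)) := by
  have hB : 0 ≤ B := (norm_nonneg _).trans (hg 0)
  have hc := norm_pairing_le (D := D) hK hg
  have hfin := D.volume_cell_ne_top k₁ x
  have hsk := measurable_synthesis (D := D) (g := g) hβ hK k
  have hsj := measurable_synthesis (D := D) (g := g) hβ hK j
  refine (isCellUnion_const (D := D) (hjk.trans hk) x).enorm_integral_le ?_ fun z hz => ?_
  · refine integrableOn_of_bounded (C := B * B) hfin (hsk.mul
      (Complex.continuous_conj.measurable.comp hsj)).aestronglyMeasurable fun y => ?_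
    rw [norm_mul, RCLike.norm_conj]
    exact mul_le_mul ((norm_synthesis_le hK k y).trans (hc k y))
      ((norm_synthesis_le hK j y).trans (hc j y)) (norm_nonneg _) hB
  · have hjm := D.measurableSet_cell j z
    set ck := D.pairing K g k z
    set cj := D.pairing K g j z
    set KQ := K k (D.cell k z)
    set KR := K j (D.cell j z)
    set vk : ℝ := ((2 : ℝ) ^ k) ^ n
    set vj : ℝ := ((2 : ℝ) ^ j) ^ n with hvj
    have hvk0 : 0 < vk := by positivity
    have hvj0 : 0 < vj := by positivity
    have hvol : volume.real (D.cell j z) = vj := by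
      rw [measureReal_def, volume_cell, ENNReal.toReal_ofReal (by positivity)]
    have hKR := hK j (D.cell j z)
    have hKQ := hK k (D.cell k z)
    have iR : IntegrableOn (fun y => (starRingEnd ℂ) (KR y)) (D.cell j z) :=
      integrableOn_of_bounded (C := vj⁻¹) (D.volume_cell_ne_top j z)
        (Complex.continuous_conj.comp (hKR.continuous hβ)).aestronglyMeasurable
        fun y => by rw [RCLike.norm_conj]; exact hKR.norm_le y
    have iQR : IntegrableOn (fun y => KQ y * (starRingEnd ℂ) (KR y)) (D.cell j z) :=
      integrableOn_of_bounded (C := vk⁻¹ * vj⁻¹) (D.volume_cell_ne_top j z)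
        ((hKQ.continuous hβ).mul
          (Complex.continuous_conj.comp (hKR.continuous hβ))).aestronglyMeasurable
        fun y => by
          rw [norm_mul, RCLike.norm_conj]
          exact mul_le_mul (hKQ.norm_le y) (hKR.norm_le y) (norm_nonneg _) (by positivity)
    have hR0 : ∫ y in D.cell j z, (starRingEnd ℂ) (KR y) = 0 := by
      rw [integral_conj,
        setIntegral_eq_integral_of_forall_compl_eq_zero fun y hy => hKR.eq_zero y hy,
        hKR.integral_eq_zero, map_zero]
    have e1 : ∫ y in D.cell j z, D.synthesis K g k y * (starRingEnd ℂ) (D.synthesis K g j y)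
        = ((vk : ℂ) * (starRingEnd ℂ) ck * ((vj : ℂ) * cj)) *
          ∫ y in D.cell j z, (KQ y - KQ z) * (starRingEnd ℂ) (KR y) := by
      simp_rw [sub_mul]
      rw [integral_sub iQR (iR.const_mul _), integral_const_mul, hR0, mul_zero, sub_zero,
        ← integral_const_mul]
      refine setIntegral_congr_fun hjm fun y hy => ?_
      have hyk : y ∈ D.cell k z := D.cell_mono hjk z hy
      simp only [synthesis, pairing_eq_of_mem hy, D.cell_eq_of_mem hy, pairing_eq_of_mem hyk,
        D.cell_eq_of_mem hyk, map_mul, Complex.conj_conj, Complex.conj_ofReal]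
      ring
    have hdist : ∀ y ∈ D.cell j z, ‖KQ y - KQ z‖ ≤
        vk⁻¹ * (((n : ℝ) + 1) ^ β * ((2 : ℝ) ^ (-β)) ^ (k - j).natAbs) := by
      intro y hy
      refine (hKQ.holder y z).trans ?_
      gcongr
      rw [← two_zpow_div_rpow hjk, ← Real.mul_rpow (by positivity) (by positivity), ← mul_div_assoc,
        norm_sub_rev]
      gcongr
      exact D.norm_sub_le hy
    have e2 : ‖∫ y in D.cell j z, (KQ y - KQ z) * (starRingEnd ℂ) (KR y)‖ ≤
        (vk⁻¹ * (((n : ℝ) + 1) ^ β * ((2 : ℝ) ^ (-β)) ^ (k - j).natAbs)) * vj⁻¹ * vj := by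
      rw [← hvol]
      refine norm_setIntegral_le_of_norm_le_const (lt_top_iff_ne_top.2 (D.volume_cell_ne_top j z))
        fun y hy => ?_
      rw [norm_mul, RCLike.norm_conj]
      exact mul_le_mul (hdist y hy) (by rw [hvol]; exact hKR.norm_le y) (norm_nonneg _)
          (by positivity)
    have e3 : ∫⁻ y in D.cell j z, ENNReal.ofReal ((((n : ℝ) + 1) ^ β *
          ((2 : ℝ) ^ (-β)) ^ (k - j).natAbs) * (‖D.pairing K g k y‖ * ‖D.pairing K g j y‖))
        = ENNReal.ofReal ((((n : ℝ) + 1) ^ β *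
          ((2 : ℝ) ^ (-β)) ^ (k - j).natAbs) * (‖ck‖ * ‖cj‖) * vj) := by
      rw [ENNReal.ofReal_mul (by positivity), hvj, ← volume_cell D j z, ← setLIntegral_const]
      refine setLIntegral_congr_fun hjm fun y hy => ?_
      simp only [pairing_eq_of_mem hy, pairing_eq_of_mem (D.cell_mono hjk z hy), ck, cj]
    rw [e3, e1, ← ofReal_norm]
    refine ENNReal.ofReal_le_ofReal ?_
    rw [norm_mul, norm_mul, norm_mul, norm_mul, RCLike.norm_conj, Complex.norm_real,
      Complex.norm_real,
      Real.norm_of_nonneg hvk0.le, Real.norm_of_nonneg hvj0.le]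
    calc _ ≤ vk * ‖ck‖ * (vj * ‖cj‖) * ((vk⁻¹ * (((n : ℝ) + 1) ^ β *
          ((2 : ℝ) ^ (-β)) ^ (k - j).natAbs)) * vj⁻¹ * vj) := by gcongr
      _ = _ := by field_simp

/-- A Schur test: the square is expanded, each cross term is bounded by almost orthogonality,
products are split by the arithmetic–geometric mean inequality, and the rows of the resulting matrix
sum to at most `orthConst`. -/
lemma integral_norm_sum_synthesis_sq_le (hβ : 0 < β) (hK : ∀ k S, IsAtom β k S (K k S))
    (hg : ∀ y, ‖g y‖ ≤ B) (k₀ k₁ : ℤ) (x : Rn n) :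
    ∫ y in D.cell k₁ x, ‖∑ k ∈ Finset.Icc k₀ k₁, D.synthesis K g k y‖ ^ 2
      ≤ orthConst n β * ∑ k ∈ Finset.Icc k₀ k₁, ∫ y in D.cell k₁ x, ‖D.pairing K g k y‖ ^ 2 := by
  have hB : 0 ≤ B := (norm_nonneg _).trans (hg 0)
  have hc := norm_pairing_le (D := D) hK hg
  have hfin := D.volume_cell_ne_top k₁ x
  set F := D.cell k₁ x
  set s := Finset.Icc k₀ k₁
  set h := D.synthesis K g
  set c := D.pairing K g
  have hsm : ∀ k, Measurable (h k) := fun k => measurable_synthesis hβ hK k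
  have hcm : ∀ k, Measurable (c k) := fun k => measurable_pairing k
  have hhB : ∀ k y, ‖h k y‖ ≤ B := fun k y => (norm_synthesis_le hK k y).trans (hc k y)
  set a : ℤ → ℤ → ℝ := fun k j => ((n : ℝ) + 1) ^ β * ((2 : ℝ) ^ (-β)) ^ (k - j).natAbs with ha
  have ha0 : ∀ k j, 0 ≤ a k j := fun k j => by positivity
  have hasymm : ∀ k j, a k j = a j k := fun k j => by
    simp only [ha]; rw [← Int.natAbs_neg, neg_sub]
  have hasum : ∀ k, ∑ j ∈ s, a k j ≤ orthConst n β := fun k => by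
    rw [← Finset.mul_sum]
    exact mul_le_mul_of_nonneg_left (sum_pow_natAbs_le hβ s k) (by positivity)
  set I : ℤ → ℝ := fun k => ∫ y in F, ‖c k y‖ ^ 2 with hI
  have hI0 : ∀ k, 0 ≤ I k := fun k => integral_nonneg fun y => by positivity
  have intc : ∀ k j, IntegrableOn (fun y => ‖c k y‖ * ‖c j y‖) F := fun k j =>
    IntegrableOn.of_bound (lt_top_iff_ne_top.2 hfin)
      ((hcm k).norm.mul (hcm j).norm).aestronglyMeasurable (B * B)
      (Filter.Eventually.of_forall fun y => by
        rw [Real.norm_of_nonneg (by positivity)]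
        exact mul_le_mul (hc k y) (hc j y) (norm_nonneg _) hB)
  have inth : ∀ k j, IntegrableOn (fun y => h k y * (starRingEnd ℂ) (h j y)) F := fun k j =>
    integrableOn_of_bounded (C := B * B) hfin ((hsm k).mul
      (Complex.continuous_conj.measurable.comp (hsm j))).aestronglyMeasurable fun y => by
        rw [norm_mul, RCLike.norm_conj]
        exact mul_le_mul (hhB k y) (hhB j y) (norm_nonneg _) hB
  have hoff : ∀ j ∈ s, ∀ k ∈ s, j ≤ k →
      ‖∫ y in F, h k y * (starRingEnd ℂ) (h j y)‖ ≤ a k j * ∫ y in F, ‖c k y‖ * ‖c j y‖ := by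
    intro j hj k hk hjk
    have h1 := enorm_integral_synthesis_mul_le (D := D) hβ hK hg hjk (Finset.mem_Icc.1 hk).2 x
    rw [← ofReal_norm, ← ofReal_integral_eq_lintegral_ofReal ((intc k j).const_mul _)
      (Filter.Eventually.of_forall fun y => by positivity), integral_const_mul] at h1
    exact (ENNReal.ofReal_le_ofReal_iff (mul_nonneg (ha0 k j)
      (integral_nonneg fun y => by positivity))).1 h1
  have hoff' : ∀ k ∈ s, ∀ j ∈ s,
      ‖∫ y in F, h k y * (starRingEnd ℂ) (h j y)‖ ≤ a k j * ∫ y in F, ‖c k y‖ * ‖c j y‖ := by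
    intro k hk j hj
    rcases le_total j k with hjk | hjk
    · exact hoff j hj k hk hjk
    · have h1 := hoff k hk j hj hjk
      have h2 : ∫ y in F, h k y * (starRingEnd ℂ) (h j y)
          = (starRingEnd ℂ) (∫ y in F, h j y * (starRingEnd ℂ) (h k y)) := by
        rw [← integral_conj]
        simp [mul_comm]
      rw [h2, RCLike.norm_conj, hasymm]
      refine h1.trans_eq ?_
      simp_rw [mul_comm ‖c k _‖]
  have hcs : ∀ k j, ∫ y in F, ‖c k y‖ * ‖c j y‖ ≤ (I k + I j) / 2 := by
    intro k j
    have i1 : ∀ k, IntegrableOn (fun y => ‖c k y‖ ^ 2) F := fun k => by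
      simpa [sq] using intc k k
    rw [hI, ← integral_add (i1 k) (i1 j), ← integral_div]
    refine setIntegral_mono (intc k j) (((i1 k).add (i1 j)).div_const 2) fun y => ?_
    simp only
    nlinarith [sq_nonneg (‖c k y‖ - ‖c j y‖)]
  have hexp : ((∫ y in F, ‖∑ k ∈ s, h k y‖ ^ 2 : ℝ) : ℂ)
      = ∑ k ∈ s, ∑ j ∈ s, ∫ y in F, h k y * (starRingEnd ℂ) (h j y) := by
    rw [← integral_complex_ofReal]
    calc _ = ∫ y in F, ∑ k ∈ s, ∑ j ∈ s, h k y * (starRingEnd ℂ) (h j y) := by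
          congr with y
          rw [← Finset.sum_mul_sum, ← map_sum, Complex.mul_conj, Complex.normSq_eq_norm_sq]
      _ = _ := by
          rw [integral_finsetSum _ fun k _ => integrable_finsetSum _ fun j _ => inth k j]
          exact Finset.sum_congr rfl fun k _ => integral_finsetSum _ fun j _ => inth k j
  calc ∫ y in F, ‖∑ k ∈ s, h k y‖ ^ 2
      ≤ ‖((∫ y in F, ‖∑ k ∈ s, h k y‖ ^ 2 : ℝ) : ℂ)‖ := by
        rw [Complex.norm_real]; exact le_abs_self _
    _ ≤ ∑ k ∈ s, ∑ j ∈ s, a k j * ((I k + I j) / 2) := by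
        rw [hexp]
        refine (norm_sum_le _ _).trans (Finset.sum_le_sum fun k hk =>
          (norm_sum_le _ _).trans (Finset.sum_le_sum fun j hj => (hoff' k hk j hj).trans ?_))
        exact mul_le_mul_of_nonneg_left (hcs k j) (ha0 k j)
    _ = (∑ k ∈ s, (∑ j ∈ s, a k j) * I k) / 2 + (∑ j ∈ s, (∑ k ∈ s, a j k) * I j) / 2 := by
        have h1 : ∑ k ∈ s, ∑ j ∈ s, a k j * ((I k + I j) / 2)
            = ∑ k ∈ s, ∑ j ∈ s, a k j * I k / 2 + ∑ k ∈ s, ∑ j ∈ s, a k j * I j / 2 := by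
          rw [← Finset.sum_add_distrib]
          refine Finset.sum_congr rfl fun k _ => ?_
          rw [← Finset.sum_add_distrib]
          exact Finset.sum_congr rfl fun j _ => by ring
        rw [h1]
        congr 1
        · rw [Finset.sum_div]
          exact Finset.sum_congr rfl fun k _ => by rw [Finset.sum_mul, Finset.sum_div]
        · rw [Finset.sum_comm, Finset.sum_div]
          refine Finset.sum_congr rfl fun k _ => ?_
          rw [Finset.sum_mul, Finset.sum_div]
          exact Finset.sum_congr rfl fun j _ => by rw [hasymm]
    _ ≤ orthConst n β * ∑ k ∈ s, I k := by
        rw [add_halves, Finset.mul_sum]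
        exact Finset.sum_le_sum fun k _ => mul_le_mul_of_nonneg_right (hasum k) (hI0 k)

/-- Duality with absorption. The left side V equals the integral of g against H, the sum of the
synthesized parts. Young's inequality bounds it by a multiple of ‖g‖² plus a multiple of ‖H‖² ≤ O·V,
with O = `orthConst n β`. -/
lemma sum_integral_pairing_sq_le (hβ : 0 < β) (hK : ∀ k S, IsAtom β k S (K k S))
    (hgm : AEStronglyMeasurable g volume) (hg : ∀ y, ‖g y‖ ≤ B) (k₀ k₁ : ℤ) (x : Rn n) :
    ∑ k ∈ Finset.Icc k₀ k₁, ∫ y in D.cell k₁ x, ‖D.pairing K g k y‖ ^ 2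
      ≤ orthConst n β * ∫ y in D.cell k₁ x, ‖g y‖ ^ 2 := by
  have hB : 0 ≤ B := (norm_nonneg _).trans (hg 0)
  have hc := norm_pairing_le (D := D) hK hg
  have hfin := D.volume_cell_ne_top k₁ x
  have hO := orthConst_pos n hβ
  have hW := integral_norm_sum_synthesis_sq_le (D := D) hβ hK hg k₀ k₁ x
  have hsum := fun (k : ℤ) (hk : k ∈ Finset.Icc k₀ k₁) =>
    integral_mul_synthesis (D := D) hβ hK hgm hg (Finset.mem_Icc.1 hk).2 x
  set F := D.cell k₁ x
  set s := Finset.Icc k₀ k₁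
  set h := D.synthesis K g
  set c := D.pairing K g
  set O := orthConst n β
  set V := ∑ k ∈ s, ∫ y in F, ‖c k y‖ ^ 2 with hV
  have hsm : ∀ k, Measurable (h k) := fun k => measurable_synthesis hβ hK k
  have hhB : ∀ k y, ‖h k y‖ ≤ B := fun k y => (norm_synthesis_le hK k y).trans (hc k y)
  have hHm : Measurable fun y => ∑ k ∈ s, h k y := Finset.measurable_sum _ fun k _ => hsm k
  have hHB : ∀ y, ‖∑ k ∈ s, h k y‖ ≤ s.card * B := fun y => by
    refine (norm_sum_le _ _).trans ((Finset.sum_le_sum fun k _ => hhB k y).trans_eq ?_)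
    simp
  have intg : IntegrableOn (fun y => ‖g y‖ ^ 2) F :=
    IntegrableOn.of_bound (lt_top_iff_ne_top.2 hfin) (hgm.norm.pow 2).restrict (B ^ 2)
      (Filter.Eventually.of_forall fun y => by
        rw [Real.norm_of_nonneg (by positivity)]
        exact pow_le_pow_left₀ (norm_nonneg _) (hg y) 2)
  have intH : IntegrableOn (fun y => ‖∑ k ∈ s, h k y‖ ^ 2) F :=
    IntegrableOn.of_bound (lt_top_iff_ne_top.2 hfin)
      (hHm.norm.pow_const 2).aestronglyMeasurable ((s.card * B) ^ 2)
      (Filter.Eventually.of_forall fun y => by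
        rw [Real.norm_of_nonneg (by positivity)]
        exact pow_le_pow_left₀ (norm_nonneg _) (hHB y) 2)
  have intgh : ∀ k, IntegrableOn (fun y => g y * h k y) F := fun k =>
    integrableOn_of_bounded (C := B * B) hfin (hgm.restrict.mul (hsm k).aestronglyMeasurable)
      fun y => by
        rw [norm_mul]
        exact mul_le_mul (hg y) (hhB k y) (norm_nonneg _) hB
  have hVc : (V : ℂ) = ∫ y in F, g y * ∑ k ∈ s, h k y := by
    simp_rw [Finset.mul_sum]
    rw [integral_finsetSum _ fun k _ => intgh k, hV, Complex.ofReal_sum]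
    refine Finset.sum_congr rfl fun k hk => ?_
    rw [hsum k hk, integral_complex_ofReal]
  -- The weights in Young's inequality make the second term at most V/2, which is subtracted from
  -- the left side.
  have hVle : V ≤ ∫ y in F, ((O / 2) * ‖g y‖ ^ 2 + (2 * O)⁻¹ * ‖∑ k ∈ s, h k y‖ ^ 2) := by
    have h1 : V ≤ ‖(V : ℂ)‖ := by rw [Complex.norm_real]; exact le_abs_self _
    refine h1.trans ?_
    rw [hVc]
    refine norm_integral_le_of_norm_le ((intg.const_mul _).add (intH.const_mul _))
      (Filter.Eventually.of_forall fun y => ?_)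
    rw [norm_mul]
    set u := ‖g y‖
    set w := ‖∑ k ∈ s, h k y‖
    have : (O / 2) * u ^ 2 + (2 * O)⁻¹ * w ^ 2 - u * w = (2 * O)⁻¹ * (O * u - w) ^ 2 := by
      field_simp; ring
    have h2 : 0 ≤ (2 * O)⁻¹ * (O * u - w) ^ 2 := by positivity
    linarith
  rw [integral_add (intg.const_mul _) (intH.const_mul _), integral_const_mul,
    integral_const_mul] at hVle
  have h3 : (2 * O)⁻¹ * ∫ y in F, ‖∑ k ∈ s, h k y‖ ^ 2 ≤ V / 2 := by
    calc _ ≤ (2 * O)⁻¹ * (O * V) := by gcongr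
      _ = V / 2 := by field_simp
  linarith

end AlmostOrthogonality

/-- The `L²` estimate for the local square function of a bounded function. -/
lemma sum_lintegral_cf_sq_le {β : ℝ} (hβ : 0 < β) {g : Rn n → ℂ}
    (hgm : AEStronglyMeasurable g volume) {B : ℝ} (hg : ∀ y, ‖g y‖ ≤ B) (k₀ k₁ : ℤ) (x : Rn n) :
    ∑ k ∈ Finset.Icc k₀ k₁, ∫⁻ y in D.cell k₁ x, D.cf β g k y ^ 2
      ≤ ENNReal.ofReal (4 * orthConst n β * B ^ 2) * volume (D.cell k₁ x) := by
  choose K hK hKle using fun k S => exists_coef_le β g k S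
  have hB : 0 ≤ B := (norm_nonneg _).trans (hg 0)
  have hO := orthConst_pos n hβ
  have hc := norm_pairing_le (D := D) hK hg
  have hfin := D.volume_cell_ne_top k₁ x
  have h1 := sum_integral_pairing_sq_le (D := D) hβ hK hgm hg k₀ k₁ x
  have hint : ∀ k, IntegrableOn (fun y => ‖D.pairing K g k y‖ ^ 2) (D.cell k₁ x) := fun k =>
    IntegrableOn.of_bound (lt_top_iff_ne_top.2 hfin)
      ((measurable_pairing k).norm.pow_const 2).aestronglyMeasurable (B ^ 2)
      (Filter.Eventually.of_forall fun y => by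
        rw [Real.norm_of_nonneg (by positivity)]
        exact pow_le_pow_left₀ (norm_nonneg _) (hc k y) 2)
  have h2 : ∫ y in D.cell k₁ x, ‖g y‖ ^ 2 ≤ B ^ 2 * volume.real (D.cell k₁ x) := by
    refine (Real.le_norm_self _).trans (norm_setIntegral_le_of_norm_le_const
      (lt_top_iff_ne_top.2 hfin) fun y _ => ?_)
    rw [Real.norm_of_nonneg (by positivity)]
    exact pow_le_pow_left₀ (norm_nonneg _) (hg y) 2
  -- The factor 4 is the square of the loss 2 in choosing nearly extremal atoms.
  have h3 : ∀ k, ∫⁻ y in D.cell k₁ x, D.cf β g k y ^ 2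
      ≤ 4 * ENNReal.ofReal (∫ y in D.cell k₁ x, ‖D.pairing K g k y‖ ^ 2) := by
    intro k
    rw [ofReal_integral_eq_lintegral_ofReal (hint k)
      (Filter.Eventually.of_forall fun y => by positivity), ← lintegral_const_mul' _ _ (by simp)]
    refine lintegral_mono fun y => ?_
    have hle : D.cf β g k y ≤ 2 * ‖D.pairing K g k y‖ₑ := hKle k _
      (ne_top_of_le_ne_top ENNReal.ofReal_ne_top
        ((D.cf_le_avg β g k y).trans (avg_le_of_norm_le hg k y)))
    rw [ENNReal.ofReal_pow (norm_nonneg _), ofReal_norm]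
    calc D.cf β g k y ^ 2 ≤ (2 * ‖D.pairing K g k y‖ₑ) ^ 2 := by gcongr
      _ = _ := by rw [mul_pow]; norm_num
  calc _ ≤ ∑ k ∈ Finset.Icc k₀ k₁,
        4 * ENNReal.ofReal (∫ y in D.cell k₁ x, ‖D.pairing K g k y‖ ^ 2) :=
        Finset.sum_le_sum fun k _ => h3 k
    _ = 4 * ENNReal.ofReal (∑ k ∈ Finset.Icc k₀ k₁,
          ∫ y in D.cell k₁ x, ‖D.pairing K g k y‖ ^ 2) := by
        rw [← Finset.mul_sum, ENNReal.ofReal_sum_of_nonneg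
          fun k _ => integral_nonneg fun y => by positivity]
    _ ≤ 4 * ENNReal.ofReal (orthConst n β * (B ^ 2 * volume.real (D.cell k₁ x))) := by
        gcongr
        exact h1.trans (by gcongr)
    _ = _ := by
        rw [← mul_assoc (orthConst n β), ENNReal.ofReal_mul (mul_nonneg hO.le (sq_nonneg B)),
          ofReal_measureReal hfin, mul_assoc (4 : ℝ),
          ENNReal.ofReal_mul (p := 4) (by norm_num), ENNReal.ofReal_ofNat, mul_assoc]

end Grid

/-- Superadditivity of the lower integral needs no measurability; it is applied to error terms that
involve the stopping function. -/
lemma sum_lintegral_le_lintegral_sum {α ι : Type*} [MeasurableSpace α] (μ : Measure α)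
    (s : Finset ι) (u : ι → α → ℝ≥0∞) : ∑ i ∈ s, ∫⁻ x, u i x ∂μ ≤ ∫⁻ x, ∑ i ∈ s, u i x ∂μ := by
  classical
  induction s using Finset.induction_on with
  | empty => simp
  | insert a s ha ih =>
    simp only [Finset.sum_insert ha]
    exact (add_le_add_right ih _).trans (le_lintegral_add _ _)

lemma sum_sq_le_sq_sum {ι : Type*} (s : Finset ι) (a : ι → ℝ≥0∞) :
    ∑ i ∈ s, a i ^ 2 ≤ (∑ i ∈ s, a i) ^ 2 := by
  rw [sq, Finset.sum_mul]
  refine Finset.sum_le_sum fun i hi => ?_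
  rw [sq]
  gcongr
  exact Finset.single_le_sum (f := a) (fun _ _ => zero_le) hi

/-! ### Calderón–Zygmund decomposition and the local weak type estimate -/

namespace Grid

variable {n : ℕ} {D : Grid n}

lemma avg_le_succ (h : Rn n → ℝ≥0∞) (k : ℤ) (x : Rn n) :
    D.avg volume h k x ≤ 2 ^ n * D.avg volume h (k + 1) x := by
  have hV : volume (D.cell (k + 1) x) = 2 ^ n * volume (D.cell k x) := by
    rw [volume_cell, volume_cell, zpow_add₀ (by norm_num), zpow_one, mul_pow, mul_comm,
      ENNReal.ofReal_mul (by positivity), ENNReal.ofReal_pow (by norm_num), ENNReal.ofReal_ofNat]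
  have hinv : 2 ^ n * (volume (D.cell (k + 1) x))⁻¹ = (volume (D.cell k x))⁻¹ := by
    rw [hV, ENNReal.mul_inv (by simp) (by simp), ← mul_assoc,
      ENNReal.mul_inv_cancel (by simp) (by simp), one_mul]
  unfold avg
  rw [← mul_assoc, hinv]
  gcongr
  exact D.cell_mono (by lia) x

lemma avg_mul_volume (h : Rn n → ℝ≥0∞) (k : ℤ) (x : Rn n) :
    D.avg volume h k x * volume (D.cell k x) = ∫⁻ y in D.cell k x, h y := by
  rw [mul_comm, measure_mul_avg D.regular_volume]

lemma lintegral_avg (h : Rn n → ℝ≥0∞) {k k₁ : ℤ} (hk : k ≤ k₁) (x : Rn n) :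
    ∫⁻ y in D.cell k₁ x, D.avg volume h k y ≤ ∫⁻ y in D.cell k₁ x, h y := by
  refine (isCellUnion_const hk x).lintegral_le fun z _ => ?_
  rw [← avg_mul_volume h k z, ← setLIntegral_const]
  refine (setLIntegral_congr_fun (D.measurableSet_cell k z) fun y hy => ?_).le
  exact D.avg_eq_of_mem hy

/-- The Calderón–Zygmund decomposition of `f` at height `8 m` on a cube, with `m` the mean of `|f|`,
using only cubes of scale at least `2 ^ k₀`. -/
lemma exists_stopping (h : Rn n → ℝ≥0∞) {k₀ k₁ : ℤ} (hk : k₀ ≤ k₁) (x : Rn n) :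
    ∃ τ : Rn n → ℤ, D.IsCellUnion (D.cell k₁ x) τ ∧
      (∀ y ∈ D.cell k₁ x, D.avg volume h (τ y) y ≤ 2 ^ n * (8 * D.avg volume h k₁ x)) ∧
      ∀ y ∈ D.cell k₁ x, τ y ≤ k₁ ∧ k₀ ≤ τ y ∧
        (τ y ≠ k₀ → 8 * D.avg volume h k₁ x < D.avg volume h (τ y) y) := by
  set F := D.cell k₁ x with hF
  set m := D.avg volume h k₁ x with hm
  -- The finest scale is admitted without condition, so every point has a stopping cube and the
  -- whole cell is partitioned.
  let good : ℤ → Rn n → Prop := fun k y =>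
    k₀ ≤ k ∧ k ≤ k₁ ∧ (k ≠ k₀ → 8 * m < D.avg volume h k y)
  have good_congr : ∀ {k y z}, z ∈ D.cell k y → good k y → good k z := by
    intro k y z hz hs
    refine ⟨hs.1, hs.2.1, fun h0 => ?_⟩
    rw [D.avg_eq_of_mem hz]
    exact hs.2.2 h0
  have hex : ∀ y, ∃ k, good k y ∧ ∀ j, good j y → j ≤ k := fun y =>
    Int.exists_greatest_of_bdd ⟨k₁, fun z hz => hz.2.1⟩ ⟨k₀, le_rfl, hk, fun h0 => absurd rfl h0⟩
  choose τ hτ hmax using hex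
  refine ⟨τ, ?_, ?_, fun y _ => ⟨(hτ y).2.1, (hτ y).1, (hτ y).2.2⟩⟩
  · intro y hy z hz
    have hzF : z ∈ F := D.cell_subset_of_mem (hτ y).2.1 hy hz
    have h1 : τ y ≤ τ z := hmax z _ (good_congr hz (hτ y))
    have h2 : z ∈ D.cell (τ z) y := D.cell_mono h1 y hz
    exact ⟨hzF, le_antisymm (hmax y _ (good_congr (D.mem_cell_comm.1 h2) (hτ z))) h1⟩
  · intro y hy
    have h1 : (1 : ℝ≥0∞) ≤ 2 ^ n := one_le_pow₀ (by norm_num)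
    -- Below the top scale, the parent of a stopping cube fails the condition, and passing from
    -- parent to child costs at most the factor `2 ^ n`.
    rcases eq_or_lt_of_le (hτ y).2.1 with heq | hlt
    · rw [heq, D.avg_eq_of_mem hy, ← hm, ← mul_assoc]
      calc m = 1 * m := (one_mul m).symm
        _ ≤ (2 ^ n * 8) * m := by
          gcongr
          calc (1 : ℝ≥0∞) = 1 * 1 := (one_mul 1).symm
            _ ≤ 2 ^ n * 8 := mul_le_mul' h1 (by norm_num)
    · refine (avg_le_succ h (τ y) y).trans (mul_le_mul_right ?_ _)
      by_contra! hcon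
      have : good (τ y + 1) y := ⟨(hτ y).1.trans (by lia), by lia, fun _ => hcon⟩
      have := hmax y _ this
      lia

/-- The error term in the Calderón–Zygmund decomposition. -/
noncomputable def errorTerm (β : ℝ) (f : Rn n → ℂ) (τ : Rn n → ℤ) (k : ℤ) (z : Rn n) : ℝ≥0∞ :=
  ENNReal.ofReal (2 * (((n : ℝ) + 1) ^ β * ((2 : ℝ) ^ (-β)) ^ (k - τ z).natAbs)) * ‖f z‖ₑ

/-- The conditional expectation of `f` with respect to the cubes `cell (τ x) x`. -/
noncomputable def stoppedAvg (D : Grid n) (f : Rn n → ℂ) (τ : Rn n → ℤ) (F : Set (Rn n)) :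
    Rn n → ℂ :=
  F.indicator fun y => ((volume.real (D.cell (τ y) y) : ℝ) : ℂ)⁻¹ * ∫ z in D.cell (τ y) y, f z

lemma enorm_stoppedAvg_le (f : Rn n → ℂ) (τ : Rn n → ℤ) (F : Set (Rn n)) (y : Rn n) :
    ‖D.stoppedAvg f τ F y‖ₑ ≤ D.avg volume (fun z => ‖f z‖ₑ) (τ y) y := by
  by_cases hy : y ∈ F
  · have h0 : 0 < volume.real (D.cell (τ y) y) :=
      ENNReal.toReal_pos (D.volume_cell_ne_zero _ _) (D.volume_cell_ne_top _ _)
    rw [stoppedAvg, Set.indicator_of_mem hy, enorm_mul, avg, ← ofReal_norm, norm_inv,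
      Complex.norm_real, Real.norm_of_nonneg h0.le, ENNReal.ofReal_inv_of_pos h0,
      ofReal_measureReal (D.volume_cell_ne_top _ _)]
    gcongr
    exact enorm_integral_le_lintegral_enorm _
  · simp [stoppedAvg, hy]

lemma stoppedAvg_eq {f : Rn n → ℂ} {τ : Rn n → ℤ} {F : Set (Rn n)} (hF : D.IsCellUnion F τ)
    {y z : Rn n} (hy : y ∈ F) (hz : z ∈ D.cell (τ y) y) :
    D.stoppedAvg f τ F z = D.stoppedAvg f τ F y := by
  obtain ⟨h1, h2⟩ := hF y hy z hz
  rw [stoppedAvg, Set.indicator_of_mem h1, Set.indicator_of_mem hy, h2, D.cell_eq_of_mem hz]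

lemma aestronglyMeasurable_stoppedAvg {f : Rn n → ℂ} {τ : Rn n → ℤ} {F : Set (Rn n)}
    (hF : D.IsCellUnion F τ) : AEStronglyMeasurable (D.stoppedAvg f τ F) volume := by
  have h1 : AEStronglyMeasurable (D.stoppedAvg f τ F) (volume.restrict F) := by
    refine hF.aestronglyMeasurable fun y hy => ?_
    refine (aestronglyMeasurable_const (b := D.stoppedAvg f τ F y)).congr ?_
    filter_upwards [ae_restrict_mem (D.measurableSet_cell (τ y) y)] with z hz
    exact (stoppedAvg_eq hF hy hz).symm
  have h2 : D.stoppedAvg f τ F = F.indicator (D.stoppedAvg f τ F) := by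
    rw [stoppedAvg, Set.indicator_indicator, Set.inter_self]
  rw [h2]
  exact (aestronglyMeasurable_indicator_iff hF.measurableSet).2 h1

lemma integral_stoppedAvg {f : Rn n → ℂ} {τ : Rn n → ℤ} {F : Set (Rn n)}
    (hF : D.IsCellUnion F τ) {y : Rn n} (hy : y ∈ F) :
    ∫ z in D.cell (τ y) y, D.stoppedAvg f τ F z = ∫ z in D.cell (τ y) y, f z := by
  have h0 : 0 < volume.real (D.cell (τ y) y) :=
    ENNReal.toReal_pos (D.volume_cell_ne_zero _ _) (D.volume_cell_ne_top _ _)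
  rw [setIntegral_congr_fun (D.measurableSet_cell _ _)
    (g := fun _ => D.stoppedAvg f τ F y) fun z hz => stoppedAvg_eq hF hy hz,
    setIntegral_const, stoppedAvg, Set.indicator_of_mem hy, Complex.real_smul, ← mul_assoc,
    mul_inv_cancel₀ (by exact_mod_cast h0.ne'), one_mul]

lemma integrableOn_stoppedAvg {f : Rn n → ℂ} {τ : Rn n → ℤ} {F : Set (Rn n)}
    (hF : D.IsCellUnion F τ) {B : ℝ} (hB : ∀ y, ‖D.stoppedAvg f τ F y‖ ≤ B) {S : Set (Rn n)}
    (hS : volume S ≠ ∞) : IntegrableOn (D.stoppedAvg f τ F) S :=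
  integrableOn_of_bounded hS (aestronglyMeasurable_stoppedAvg hF).restrict hB

/-- Away from the exceptional set, the coefficients of `f` are controlled by those of the good part
and a summable error. -/
lemma cf_le_add_errorTerm {β : ℝ} (hβ : 0 < β) {f : Rn n → ℂ} {τ : Rn n → ℤ} {F : Set (Rn n)}
    (hF : D.IsCellUnion F τ) {B : ℝ} (hB : ∀ y, ‖D.stoppedAvg f τ F y‖ ≤ B) {k : ℤ} {y : Rn n}
    (hyF : D.cell k y ⊆ F) (hf : IntegrableOn f (D.cell k y)) (hτ : ∀ z ∈ D.cell k y, τ z ≤ k) :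
    D.cf β f k y ≤ D.cf β (D.stoppedAvg f τ F) k y + D.avg volume (errorTerm β f τ k) k y := by
  set g := D.stoppedAvg f τ F with hg
  set Q := D.cell k y with hQ
  have hQm := D.measurableSet_cell k y
  have hQt := D.volume_cell_ne_top k y
  have hv0 : (0 : ℝ) < ((2 : ℝ) ^ k) ^ n := by positivity
  have hgi : IntegrableOn g Q := integrableOn_stoppedAvg hF hB hQt
  refine iSup₂_le fun K hK => ?_
  have hKc := hK.continuous hβ
  have hset : ∀ φ : Rn n → ℂ, ∫ z, K z * φ z = ∫ z in Q, K z * φ z := fun φ =>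
    (setIntegral_eq_integral_of_forall_compl_eq_zero fun z hz => by
      rw [hK.eq_zero z hz, zero_mul]).symm
  have hmul : ∀ {φ : Rn n → ℂ}, IntegrableOn φ Q → IntegrableOn (fun z => K z * φ z) Q :=
    fun hφ => hφ.bdd_mul hKc.aestronglyMeasurable (Filter.Eventually.of_forall hK.norm_le)
  have hQu : D.IsCellUnion Q τ := fun z hz w hw =>
    ⟨D.cell_subset_of_mem (hτ z hz) hz hw, (hF z (hyF hz) w hw).2⟩
  have hfg : IntegrableOn (fun z => K z * (f z - g z)) Q := hmul (hf.sub hgi)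
  have hsplit : ∫ z, K z * f z = (∫ z, K z * g z) + ∫ z in Q, K z * (f z - g z) := by
    rw [hset, hset, ← integral_add (hmul hgi) hfg]
    congr with z
    ring
  rw [hsplit]
  refine (enorm_add_le _ _).trans (add_le_add (le_coef hK g) ?_)
  have : D.avg volume (errorTerm β f τ k) k y
      = ∫⁻ z in Q, (volume Q)⁻¹ * errorTerm β f τ k z :=
    (lintegral_const_mul' _ _ (by simpa using D.volume_cell_ne_zero k y)).symm
  rw [this]
  refine hQu.enorm_integral_le hfg fun z hz => ?_
  set P := D.cell (τ z) z with hP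
  have hPm := D.measurableSet_cell (τ z) z
  have hPQ : P ⊆ Q := D.cell_subset_of_mem (hτ z hz) hz
  have hfP : IntegrableOn f P := hf.mono_set hPQ
  have hgP : IntegrableOn g P := hgi.mono_set hPQ
  -- f - g has mean zero on each stopping cube P, so K may be replaced by its oscillation on P,
  -- which is small when P is much smaller than Q.
  have hzero : ∫ w in P, K z * (f w - g w) = 0 := by
    rw [integral_const_mul, integral_sub hfP hgP, integral_stoppedAvg hF (hyF hz), sub_self,
      mul_zero]
  have e1 : ∫ w in P, K w * (f w - g w) = ∫ w in P, (K w - K z) * (f w - g w) := by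
    simp_rw [sub_mul]
    rw [integral_sub (hfg.mono_set hPQ) (Integrable.const_mul (f := fun w => f w - g w)
      (hfP.sub hgP) _), hzero, sub_zero]
  set c : ℝ := ((n : ℝ) + 1) ^ β * ((2 : ℝ) ^ (-β)) ^ (k - τ z).natAbs with hc
  have hc0 : 0 ≤ c := by positivity
  have hosc : ∀ w ∈ P, ‖K w - K z‖ₑ ≤ (volume Q)⁻¹ * ENNReal.ofReal c := by
    intro w hw
    rw [← ofReal_norm, volume_cell, ← ENNReal.ofReal_inv_of_pos hv0,
      ← ENNReal.ofReal_mul (by positivity)]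
    refine ENNReal.ofReal_le_ofReal ((hK.holder w z).trans ?_)
    gcongr
    rw [hc, ← two_zpow_div_rpow (hτ z hz), ← Real.mul_rpow (by positivity) (by positivity),
      ← mul_div_assoc, norm_sub_rev]
    gcongr
    exact D.norm_sub_le hw
  have hg1 : ∫⁻ w in P, ‖g w‖ₑ ≤ ∫⁻ w in P, ‖f w‖ₑ := by
    calc ∫⁻ w in P, ‖g w‖ₑ ≤ ∫⁻ _ in P, D.avg volume (fun z => ‖f z‖ₑ) (τ z) z := by
          refine setLIntegral_mono' hPm fun w hw => ?_
          rw [hg, stoppedAvg_eq hF (hyF hz) hw]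
          exact enorm_stoppedAvg_le f τ F z
      _ = ∫⁻ w in P, ‖f w‖ₑ := by rw [setLIntegral_const, avg_mul_volume]
  rw [e1]
  calc ‖∫ w in P, (K w - K z) * (f w - g w)‖ₑ
      ≤ ∫⁻ w in P, ‖(K w - K z) * (f w - g w)‖ₑ := enorm_integral_le_lintegral_enorm _
    _ ≤ ∫⁻ w in P, ((volume Q)⁻¹ * ENNReal.ofReal c) * (‖f w‖ₑ + ‖g w‖ₑ) := by
        refine setLIntegral_mono' hPm fun w hw => ?_
        rw [enorm_mul]
        exact mul_le_mul' (hosc w hw) enorm_sub_le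
    _ = ((volume Q)⁻¹ * ENNReal.ofReal c) * ((∫⁻ w in P, ‖f w‖ₑ) + ∫⁻ w in P, ‖g w‖ₑ) := by
        rw [lintegral_const_mul' _ _ (ENNReal.mul_ne_top
          (by simpa using D.volume_cell_ne_zero k y) ENNReal.ofReal_ne_top),
          lintegral_add_left' hfP.aestronglyMeasurable.enorm]
    _ ≤ ((volume Q)⁻¹ * ENNReal.ofReal c) * (2 * ∫⁻ w in P, ‖f w‖ₑ) := by
        rw [two_mul]; gcongr
    _ = ∫⁻ w in P, (volume Q)⁻¹ * errorTerm β f τ k w := by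
        have e3 : ∀ w ∈ P, (volume Q)⁻¹ * errorTerm β f τ k w
            = ((volume Q)⁻¹ * (ENNReal.ofReal c * 2)) * ‖f w‖ₑ := by
          intro w hw
          rw [errorTerm, (hF z (hyF hz) w hw).2, ← hc, mul_comm 2 c,
            ENNReal.ofReal_mul hc0, ENNReal.ofReal_ofNat]
          ring
        rw [setLIntegral_congr_fun hPm e3, lintegral_const_mul' _ _ (ENNReal.mul_ne_top
          (by simpa using D.volume_cell_ne_zero k y)
          (ENNReal.mul_ne_top ENNReal.ofReal_ne_top (by simp)))]
        ring

lemma sum_errorTerm_le {β : ℝ} (hβ : 0 < β) (f : Rn n → ℂ) (τ : Rn n → ℤ) (s : Finset ℤ)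
    (z : Rn n) : ∑ k ∈ s, errorTerm β f τ k z ≤ ENNReal.ofReal (2 * orthConst n β) * ‖f z‖ₑ := by
  simp only [errorTerm]
  rw [← Finset.sum_mul, ← ENNReal.ofReal_sum_of_nonneg fun k _ => by positivity]
  gcongr
  rw [← Finset.mul_sum, ← Finset.mul_sum, orthConst]
  gcongr
  refine le_trans (le_of_eq ?_) (sum_pow_natAbs_le hβ s (τ z))
  refine Finset.sum_congr rfl fun k _ => ?_
  rw [← Int.natAbs_neg, neg_sub]

/-- The constant in the local weak type estimate for the square function. -/
noncomputable def weakConst (n : ℕ) (β : ℝ) : ℝ := 2048 * 4 ^ n * (1 + orthConst n β)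

/-- The local weak type `(1, 1)` estimate for the dyadic square function. -/
theorem weak_type_square {β : ℝ} (hβ : 0 < β) {f : Rn n → ℂ} {k₀ k₁ : ℤ} (hk : k₀ ≤ k₁)
    (x : Rn n) (hf : IntegrableOn f (D.cell k₁ x)) :
    2 * volume {y ∈ D.cell k₁ x |
        4 * (ENNReal.ofReal (weakConst n β) * D.avg volume (fun z => ‖f z‖ₑ) k₁ x) ^ 2
          < ∑ k ∈ Finset.Icc k₀ k₁, D.cf β f k y ^ 2} ≤ volume (D.cell k₁ x) := by
  set F := D.cell k₁ x with hF
  set A : ℤ → Rn n → ℝ≥0∞ := D.avg volume (fun z => ‖f z‖ₑ) with hA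
  set m := A k₁ x with hm
  set O := orthConst n β with hO
  have hO0 : 0 < O := orthConst_pos n hβ
  set Y := ENNReal.ofReal (weakConst n β) * m with hY
  have hFm : MeasurableSet F := D.measurableSet_cell k₁ x
  have hFt : volume F ≠ ∞ := D.volume_cell_ne_top k₁ x
  have hF0 : volume F ≠ 0 := D.volume_cell_ne_zero k₁ x
  have hmt : m ≠ ∞ := by
    rw [hm, hA, avg]
    exact ENNReal.mul_ne_top (by simpa using hF0) (ne_of_lt hf.2)
  have hmF : m * volume F = ∫⁻ z in F, ‖f z‖ₑ := avg_mul_volume _ _ _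
  -- If the mean vanishes, all coefficients vanish on F; otherwise m can be cancelled below.
  rcases eq_or_ne m 0 with h0 | h0
  · have : {y ∈ F | 4 * Y ^ 2 < ∑ k ∈ Finset.Icc k₀ k₁, D.cf β f k y ^ 2} = ∅ := by
      refine Set.eq_empty_of_forall_notMem fun y hy => ?_
      have : ∀ k ∈ Finset.Icc k₀ k₁, D.cf β f k y ^ 2 = 0 := by
        intro k hk
        have h1 : D.cf β f k y ≤ 0 := by
          refine (D.cf_le_avg β f k y).trans ?_
          rw [avg]
          have : ∫⁻ z in D.cell k y, ‖f z‖ₑ ≤ 0 := by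
            refine (lintegral_mono_set (D.cell_subset_of_mem (Finset.mem_Icc.1 hk).2 hy.1)).trans ?_
            rw [← hF, ← hmF, h0, zero_mul]
          rw [nonpos_iff_eq_zero.1 this, mul_zero]
        rw [nonpos_iff_eq_zero.1 h1]; simp
      have h2 := hy.2
      rw [Finset.sum_eq_zero this] at h2
      exact not_lt_zero h2
    rw [this]; simp
  obtain ⟨τ, hτF, hτavg, hτ⟩ := exists_stopping (D := D) (fun z => ‖f z‖ₑ) hk x
  set g := D.stoppedAvg f τ F with hg
  set B : ℝ := 2 ^ n * (8 * m.toReal) with hB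
  have hgB : ∀ y, ‖g y‖ ≤ B := by
    intro y
    by_cases hy : y ∈ F
    · have h1 := (enorm_stoppedAvg_le (D := D) f τ F y).trans (hτavg y hy)
      have h2 : (2 : ℝ≥0∞) ^ n * (8 * m) = ENNReal.ofReal B := by
        rw [hB, ENNReal.ofReal_mul (by positivity), ENNReal.ofReal_mul (by positivity),
          ENNReal.ofReal_toReal hmt, ENNReal.ofReal_pow (by norm_num)]
        simp
      rw [h2, ← ofReal_norm] at h1
      exact (ENNReal.ofReal_le_ofReal_iff (by positivity)).1 h1
    · simp only [hg, stoppedAvg, Set.indicator_of_notMem hy, norm_zero]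
      positivity
  -- The union of the cubes of large average, of volume at most |F|/8 by the weak type bound for the
  -- maximal function.
  set Ω := {y | ∃ k ≤ k₁, 8 * m < D.avg volume (F.indicator fun z => ‖f z‖ₑ) k y} with hΩ
  have hΩle : 8 * volume Ω ≤ volume F := by
    have h1 := weak_type_maximal_trunc (D := D) D.regular_volume (F.indicator fun z => ‖f z‖ₑ)
      k₁ (8 * m)
    rw [lintegral_indicator hFm, ← hmF, mul_right_comm, mul_comm] at h1
    exact (ENNReal.mul_le_mul_iff_right h0 hmt).1 h1
  set T : ℤ → Rn n → ℝ≥0∞ := fun k => D.avg volume (errorTerm β f τ k) k with hT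
  have hpt : ∀ y ∈ F, y ∉ Ω → ∀ k ∈ Finset.Icc k₀ k₁, D.cf β f k y ≤ D.cf β g k y + T k y := by
    intro y hy hyΩ k hk
    obtain ⟨hk0, hk1⟩ := Finset.mem_Icc.1 hk
    have hsub : D.cell k y ⊆ F := D.cell_subset_of_mem hk1 hy
    refine cf_le_add_errorTerm hβ hτF hgB hsub (hf.mono_set hsub) fun z hz => ?_
    -- A stopping cube strictly larger than `D.cell k y` would contain y, and having scale above k₀
    -- it would have average above 8m, forcing y into Ω.
    by_contra! hlt
    have hzF := hsub hz
    have hzy : z ∈ D.cell (τ z) y := D.cell_mono hlt.le y hz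
    refine hyΩ ⟨τ z, (hτ z hzF).1, ?_⟩
    have h2 := (hτ z hzF).2.2 (by lia)
    rw [D.avg_eq_of_mem hzy] at h2
    refine h2.trans_eq ?_
    rw [avg, avg]
    congr 1
    refine setLIntegral_congr_fun (D.measurableSet_cell _ _) fun w hw => ?_
    exact (Set.indicator_of_mem (D.cell_subset_of_mem (hτ z hzF).1 hy hw) fun z => ‖f z‖ₑ).symm
  set c := weakConst n β with hcdef
  have h4n : (1 : ℝ) ≤ 4 ^ n := one_le_pow₀ (by norm_num)
  have hc0 : 0 < c := by rw [hcdef, weakConst]; positivity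
  have hY0 : Y ≠ 0 := mul_ne_zero (by simpa using hc0) h0
  have hYt : Y ≠ ∞ := ENNReal.mul_ne_top ENNReal.ofReal_ne_top hmt
  set E₁ := {y | Y ^ 2 ≤ ∑ k ∈ Finset.Icc k₀ k₁, D.cf β g k y ^ 2} ∩ F with hE₁
  set E₂ := {y | Y ≤ ∑ k ∈ Finset.Icc k₀ k₁, T k y} ∩ F with hE₂
  have hE₁le : 8 * volume E₁ ≤ volume F := by
    have hmeas : Measurable fun y => ∑ k ∈ Finset.Icc k₀ k₁, D.cf β g k y ^ 2 :=
      Finset.measurable_sum _ fun k _ => (D.measurable_cf β g k).pow_const 2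
    have h1 := mul_meas_ge_le_lintegral (μ := volume.restrict F) hmeas (Y ^ 2)
    rw [Measure.restrict_apply (measurableSet_le measurable_const hmeas),
      lintegral_finsetSum _ fun k _ => (D.measurable_cf β g k).pow_const 2] at h1
    have h2 := h1.trans (sum_lintegral_cf_sq_le hβ (aestronglyMeasurable_stoppedAvg hτF) hgB
      k₀ k₁ x)
    -- Chebyshev on the good part, bounded by B = 2^n · 8m: the constant 2048 · 4^n in `weakConst`
    -- is 8 · 4 · (8 · 2^n)².
    have h3 : 8 * ENNReal.ofReal (4 * orthConst n β * B ^ 2) ≤ Y ^ 2 := by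
      rw [hY, ← ENNReal.ofReal_toReal hmt, ← ENNReal.ofReal_mul hc0.le,
        ← ENNReal.ofReal_pow (by positivity), show (8 : ℝ≥0∞) = ENNReal.ofReal 8 by simp,
          ← ENNReal.ofReal_mul (by norm_num)]
      refine ENNReal.ofReal_le_ofReal ?_
      rw [hB, ← hO]
      have h5 : 8 * (4 * O * (2 ^ n * (8 * m.toReal)) ^ 2) = (2048 * 4 ^ n * O) * m.toReal ^ 2 := by
        rw [show (4 : ℝ) ^ n = (2 ^ n) ^ 2 by rw [← pow_mul, mul_comm, pow_mul]; norm_num]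
        ring
      rw [h5, mul_pow]
      gcongr
      have h6 : 1 ≤ c := by rw [hcdef, weakConst, ← hO]; nlinarith
      calc 2048 * 4 ^ n * O ≤ c := by rw [hcdef, weakConst, ← hO]; nlinarith
        _ ≤ c ^ 2 := by nlinarith
    have hY20 : Y ^ 2 ≠ 0 := pow_ne_zero 2 hY0
    refine (ENNReal.mul_le_mul_iff_right hY20 (ENNReal.pow_ne_top hYt)).1 ?_
    calc Y ^ 2 * (8 * volume E₁) = 8 * (Y ^ 2 * volume E₁) := by ring
      _ ≤ 8 * (ENNReal.ofReal (4 * orthConst n β * B ^ 2) * volume F) := by gcongr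
      _ ≤ _ := by rw [← mul_assoc]; gcongr
  have hE₂le : 8 * volume E₂ ≤ volume F := by
    have hTm : ∀ k, Measurable (T k) := fun k => D.measurable_avg _ _ _
    have hmeas : Measurable fun y => ∑ k ∈ Finset.Icc k₀ k₁, T k y :=
      Finset.measurable_sum _ fun k _ => hTm k
    have h1 := mul_meas_ge_le_lintegral (μ := volume.restrict F) hmeas Y
    rw [Measure.restrict_apply (measurableSet_le measurable_const hmeas),
      lintegral_finsetSum _ fun k _ => hTm k] at h1
    have h2 : ∑ k ∈ Finset.Icc k₀ k₁, ∫⁻ y in F, T k y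
        ≤ ENNReal.ofReal (2 * O) * (m * volume F) := by
      calc _ ≤ ∑ k ∈ Finset.Icc k₀ k₁, ∫⁻ y in F, errorTerm β f τ k y :=
            Finset.sum_le_sum fun k hk => lintegral_avg _ (Finset.mem_Icc.1 hk).2 x
        _ ≤ ∫⁻ y in F, ∑ k ∈ Finset.Icc k₀ k₁, errorTerm β f τ k y :=
            sum_lintegral_le_lintegral_sum _ _ _
        _ ≤ ∫⁻ y in F, ENNReal.ofReal (2 * O) * ‖f y‖ₑ :=
            lintegral_mono fun y => sum_errorTerm_le hβ f τ _ y
        _ = _ := by rw [lintegral_const_mul' _ _ ENNReal.ofReal_ne_top, hmF]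
    have h3 : 8 * (ENNReal.ofReal (2 * O) * m) ≤ Y := by
      rw [hY, ← mul_assoc]
      gcongr
      rw [show (8 : ℝ≥0∞) = ENNReal.ofReal 8 by simp,
          ← ENNReal.ofReal_mul (by norm_num)]
      refine ENNReal.ofReal_le_ofReal ?_
      rw [hcdef, weakConst, ← hO]
      nlinarith
    refine (ENNReal.mul_le_mul_iff_right hY0 hYt).1 ?_
    calc Y * (8 * volume E₂) = 8 * (Y * volume E₂) := by ring
      _ ≤ 8 * (ENNReal.ofReal (2 * O) * (m * volume F)) := mul_le_mul_right (h1.trans h2) _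
      _ = 8 * (ENNReal.ofReal (2 * O) * m) * volume F := by ring
      _ ≤ _ := by gcongr
  -- Outside the three sets, (a + b)² ≤ 2a² + 2b² and the sum of squares being at most the square of
  -- the sum bound the total by 2Y² + 2Y².
  have hcover : {y ∈ F | 4 * Y ^ 2 < ∑ k ∈ Finset.Icc k₀ k₁, D.cf β f k y ^ 2}
      ⊆ Ω ∪ (E₁ ∪ E₂) := by
    rintro y ⟨hyF, hy⟩
    by_contra hcon
    simp only [Set.mem_union, not_or] at hcon
    obtain ⟨hyΩ, hy1, hy2⟩ := hcon
    have h1 : ∑ k ∈ Finset.Icc k₀ k₁, D.cf β g k y ^ 2 ≤ Y ^ 2 :=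
      (not_le.1 fun h => hy1 ⟨h, hyF⟩).le
    have h2 : ∑ k ∈ Finset.Icc k₀ k₁, T k y ≤ Y := (not_le.1 fun h => hy2 ⟨h, hyF⟩).le
    have h3 : ∑ k ∈ Finset.Icc k₀ k₁, D.cf β f k y ^ 2 ≤ 4 * Y ^ 2 := by
      calc _ ≤ ∑ k ∈ Finset.Icc k₀ k₁, (2 * D.cf β g k y ^ 2 + 2 * T k y ^ 2) := by
            refine Finset.sum_le_sum fun k hk => ?_
            refine (pow_le_pow_left' (hpt y hyF hyΩ k hk) 2).trans ?_
            have := ENNReal.rpow_add_le_mul_rpow_add_rpow (D.cf β g k y) (T k y)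
              (p := 2) (by norm_num)
            norm_num at this
            rwa [mul_add] at this
        _ = 2 * ∑ k ∈ Finset.Icc k₀ k₁, D.cf β g k y ^ 2
              + 2 * ∑ k ∈ Finset.Icc k₀ k₁, T k y ^ 2 := by
            rw [Finset.sum_add_distrib, Finset.mul_sum, Finset.mul_sum]
        _ ≤ 2 * Y ^ 2 + 2 * Y ^ 2 := by
            gcongr
            exact (sum_sq_le_sq_sum _ _).trans (by gcongr)
        _ = 4 * Y ^ 2 := by ring
    exact absurd hy (not_lt.2 h3)
  -- Three sets of relative volume at most 1/8 stay below one half.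
  have hsum : 8 * volume {y ∈ F | 4 * Y ^ 2 < ∑ k ∈ Finset.Icc k₀ k₁, D.cf β f k y ^ 2}
      ≤ 4 * volume F := by
    calc _ ≤ 8 * (volume Ω + (volume E₁ + volume E₂)) := by
          gcongr
          exact (measure_mono hcover).trans ((measure_union_le _ _).trans
            (by gcongr; exact measure_union_le _ _))
      _ = 8 * volume Ω + (8 * volume E₁ + 8 * volume E₂) := by ring
      _ ≤ volume F + (volume F + volume F) := by gcongr
      _ ≤ volume F + (volume F + volume F) + volume F := le_self_add
      _ = _ := by ring
  refine (ENNReal.mul_le_mul_iff_right (a := 4) (by simp) (by simp)).1 ?_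
  rw [← mul_assoc]
  norm_num
  exact hsum

end Grid

/-! ### Stopping-time domination and the weighted bound for the dyadic square function -/

namespace Grid

variable {n : ℕ} (D : Grid n)

/-- The dyadic square function restricted to the scales `2 ^ k`, `k₀ ≤ k ≤ k₁`. -/
noncomputable def squareTrunc (β : ℝ) (f : Rn n → ℂ) (k₀ k₁ : ℤ) (x : Rn n) : ℝ≥0∞ :=
  (∑ k ∈ Finset.Icc k₀ k₁, D.cf β f k x ^ 2) ^ (1 / 2 : ℝ)

/-- The dyadic square function. -/
noncomputable def square (β : ℝ) (f : Rn n → ℂ) (x : Rn n) : ℝ≥0∞ :=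
  (∑' k, D.cf β f k x ^ 2) ^ (1 / 2 : ℝ)

lemma measurable_squareTrunc (β : ℝ) (f : Rn n → ℂ) (k₀ k₁ : ℤ) :
    Measurable (D.squareTrunc β f k₀ k₁) :=
  (Finset.measurable_sum _ fun k _ => (D.measurable_cf β f k).pow_const 2).pow_const _

lemma measurable_square (β : ℝ) (f : Rn n → ℂ) : Measurable (D.square β f) :=
  (Measurable.tsum fun k => (D.measurable_cf β f k).pow_const 2).pow_const _

variable {D}

lemma sq_rpow_half (a : ℝ≥0∞) : (a ^ 2) ^ (1 / 2 : ℝ) = a := by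
  rw [← ENNReal.rpow_natCast, ← ENNReal.rpow_mul]; norm_num

/-- Stopping scales for the square function. -/
lemma exists_square_stopping {β : ℝ} {f : Rn n → ℂ} {k₀ k₁ : ℤ} (x : Rn n) (X : ℝ≥0∞)
    (hX : D.cf β f k₁ x ^ 2 ≤ X) :
    ∃ τ : Rn n → ℤ, D.IsCellUnion
        {y ∈ D.cell k₁ x | X < ∑ k ∈ Finset.Icc k₀ k₁, D.cf β f k y ^ 2} τ ∧
      ∀ y ∈ {y ∈ D.cell k₁ x | X < ∑ k ∈ Finset.Icc k₀ k₁, D.cf β f k y ^ 2}, τ y < k₁ ∧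
        D.squareTrunc β f k₀ k₁ y ≤ X ^ (1 / 2 : ℝ) + D.squareTrunc β f k₀ (τ y) y := by
  set F := D.cell k₁ x with hF
  set Ω := {y ∈ F | X < ∑ k ∈ Finset.Icc k₀ k₁, D.cf β f k y ^ 2} with hΩ
  -- The sum runs over the coarse scales from j to k₁, so it is constant on cubes of scale `2 ^ j`,
  -- and stopping at the largest such j yields cubes.
  let good : ℤ → Rn n → Prop := fun j y =>
    k₀ ≤ j ∧ j ≤ k₁ ∧ X < ∑ k ∈ Finset.Icc j k₁, D.cf β f k y ^ 2
  have good_congr : ∀ {k y z}, z ∈ D.cell k y → good k y → good k z := by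
    intro k y z hz hs
    refine ⟨hs.1, hs.2.1, hs.2.2.trans_eq (Finset.sum_congr rfl fun j hj => ?_)⟩
    rw [D.cf_eq_of_mem (D.cell_mono (Finset.mem_Icc.1 hj).1 y hz)]
  have hle : ∀ {y}, y ∈ Ω → k₀ ≤ k₁ := by
    intro y hy
    by_contra! hlt
    have := hy.2
    rw [Finset.Icc_eq_empty (by lia), Finset.sum_empty] at this
    exact not_lt_zero this
  have hex : ∀ y ∈ Ω, ∃ k, good k y ∧ ∀ j, good j y → j ≤ k := fun y hy =>
    Int.exists_greatest_of_bdd ⟨k₁, fun z hz => hz.2.1⟩ ⟨k₀, le_rfl, hle hy, hy.2⟩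
  have hmem : ∀ {j y}, y ∈ F → good j y → y ∈ Ω := fun {j y} hy hs =>
    ⟨hy, hs.2.2.trans_le (Finset.sum_le_sum_of_subset (Finset.Icc_subset_Icc_left hs.1))⟩
  choose! τ hτ hmax using hex
  refine ⟨τ, ?_, ?_⟩
  · intro y hy z hz
    have hzF : z ∈ F := D.cell_subset_of_mem (hτ y hy).2.1 hy.1 hz
    have hz1 := good_congr hz (hτ y hy)
    have hzΩ := hmem hzF hz1
    have h1 : τ y ≤ τ z := hmax z hzΩ _ hz1
    have h2 : z ∈ D.cell (τ z) y := D.cell_mono h1 y hz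
    exact ⟨hzΩ, le_antisymm (hmax y hy _ (good_congr (D.mem_cell_comm.1 h2) (hτ z hzΩ))) h1⟩
  · intro y hy
    have hlt : τ y < k₁ := by
      refine lt_of_le_of_ne (hτ y hy).2.1 fun heq => ?_
      have h1 := (hτ y hy).2.2
      rw [heq, Finset.Icc_self, Finset.sum_singleton, D.cf_eq_of_mem hy.1] at h1
      exact absurd h1 (not_lt.2 hX)
    refine ⟨hlt, ?_⟩
    -- By maximality the scales strictly above the stopping cube contribute at most X. The rest is
    -- the square function truncated at the stopping cube, and the square root is subadditive.
    have hnot : ∑ k ∈ Finset.Icc (τ y + 1) k₁, D.cf β f k y ^ 2 ≤ X := by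
      by_contra! hcon
      have : τ y + 1 ≤ τ y := hmax y hy _ ⟨(hτ y hy).1.trans (by lia), by lia, hcon⟩
      lia
    have hsplit : ∑ k ∈ Finset.Icc k₀ k₁, D.cf β f k y ^ 2 ≤
        X + ∑ k ∈ Finset.Icc k₀ (τ y), D.cf β f k y ^ 2 := by
      have : Finset.Icc k₀ k₁ ⊆ Finset.Icc (τ y + 1) k₁ ∪ Finset.Icc k₀ (τ y) := by
        intro k hk
        simp only [Finset.mem_union, Finset.mem_Icc] at hk ⊢
        lia
      calc _ ≤ ∑ k ∈ Finset.Icc (τ y + 1) k₁ ∪ Finset.Icc k₀ (τ y), D.cf β f k y ^ 2 :=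
            Finset.sum_le_sum_of_subset this
        _ ≤ ∑ k ∈ Finset.Icc (τ y + 1) k₁, D.cf β f k y ^ 2
            + ∑ k ∈ Finset.Icc k₀ (τ y), D.cf β f k y ^ 2 := by
            rw [← Finset.sum_union_inter]; exact le_self_add
        _ ≤ _ := by gcongr
    calc D.squareTrunc β f k₀ k₁ y
        ≤ (X + ∑ k ∈ Finset.Icc k₀ (τ y), D.cf β f k y ^ 2) ^ (1 / 2 : ℝ) :=
          ENNReal.rpow_le_rpow hsplit (by norm_num)
      _ ≤ _ := ENNReal.rpow_add_le_add_rpow _ _ (by norm_num) (by norm_num)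

lemma one_le_weakConst (n : ℕ) {β : ℝ} (hβ : 0 < β) : 1 ≤ weakConst n β := by
  have h1 := orthConst_pos n hβ
  have h4n : (1 : ℝ) ≤ 4 ^ n := one_le_pow₀ (by norm_num)
  rw [weakConst]
  nlinarith

/-- The bilinear form of the truncated square function is dominated by maximal functions. -/
lemma lintegral_squareTrunc_mul_le {q : ℝ} {v : Rn n → ℝ≥0∞} {W : ℝ≥0∞} (hv : D.IsAp q v W)
    {β : ℝ} (hβ : 0 < β) {f : Rn n → ℂ} (hf : ∀ k x, IntegrableOn f (D.cell k x))
    {h : Rn n → ℝ≥0∞} (hh : Measurable h) (k₀ : ℤ) (N : ℕ) :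
    ∀ k₁ < k₀ + N, ∀ x,
      ∫⁻ y in D.cell k₁ x, D.squareTrunc β f k₀ k₁ y * h y ∂(volume.withDensity v) ≤
      ∫⁻ y in D.cell k₁ x, (2 * ENNReal.ofReal (weakConst n β) * 2 ^ q * W) *
        (D.maximal volume (fun z => ‖f z‖ₑ) y * D.maximal (volume.withDensity v) h y)
          ∂(volume.withDensity v) := by
  -- Induction on the number of scales: stopping cubes are strictly smaller than the given cube, so
  -- the claim is already known on each of them.
  induction N with
  | zero =>
    intro k₁ hk x
    have h0 : ∀ y, D.squareTrunc β f k₀ k₁ y = 0 := fun y => by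
      rw [squareTrunc, Finset.Icc_eq_empty (by push_cast at hk; lia), Finset.sum_empty]
      exact ENNReal.zero_rpow_of_pos (by norm_num)
    simp [h0]
  | succ N ih =>
    intro k₁ hk₁ x
    rcases lt_or_ge k₁ k₀ with hlt | hk
    · have h0 : ∀ y, D.squareTrunc β f k₀ k₁ y = 0 := fun y => by
        rw [squareTrunc, Finset.Icc_eq_empty (by lia), Finset.sum_empty]
        exact ENNReal.zero_rpow_of_pos (by norm_num)
      simp [h0]
    set μ := volume.withDensity v with hμ
    set F := D.cell k₁ x with hF
    have hFm : MeasurableSet F := D.measurableSet_cell k₁ x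
    have hFt : volume F ≠ ∞ := D.volume_cell_ne_top k₁ x
    set c := ENNReal.ofReal (weakConst n β) with hc
    have hc1 : 1 ≤ c := by
      rw [hc, ← ENNReal.ofReal_one]
      exact ENNReal.ofReal_le_ofReal (one_le_weakConst n hβ)
    set m := D.avg volume (fun z => ‖f z‖ₑ) k₁ x with hm
    set X := 4 * (c * m) ^ 2 with hX
    have hXhalf : X ^ (1 / 2 : ℝ) = 2 * (c * m) := by
      rw [← sq_rpow_half (2 * (c * m)), mul_pow]; norm_num [hX]
    have hweak := weak_type_square hβ hk x (hf k₁ x)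
    have hcf : D.cf β f k₁ x ^ 2 ≤ X := by
      calc D.cf β f k₁ x ^ 2 ≤ (1 * m) ^ 2 := by rw [one_mul]; gcongr; exact D.cf_le_avg β f k₁ x
        _ ≤ (c * m) ^ 2 := by gcongr
        _ ≤ X := le_mul_of_one_le_left' (by norm_num)
    obtain ⟨τ, hΩ, hτ⟩ := exists_square_stopping (k₀ := k₀) x X hcf
    set Ω := {y ∈ F | X < ∑ k ∈ Finset.Icc k₀ k₁, D.cf β f k y ^ 2} with hΩdef
    have hΩF : Ω ⊆ F := fun y hy => hy.1
    have hΩm : MeasurableSet Ω := hΩ.measurableSet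
    set MM : Rn n → ℝ≥0∞ := fun y =>
      D.maximal volume (fun z => ‖f z‖ₑ) y * D.maximal μ h y with hMM
    have hMMm : Measurable MM := (D.measurable_maximal _ _).mul (D.measurable_maximal _ _)
    set E := F \ Ω with hE
    have hEm : MeasurableSet E := hFm.diff hΩm
    -- The weak type estimate is calibrated so that the stopping cubes fill at most half of F.
    have hhalf : volume F ≤ 2 * volume E := by
      have h1 : volume Ω + volume E = volume F := by
        rw [hE, measure_sdiff hΩF hΩm.nullMeasurableSet
          (ne_top_of_le_ne_top hFt (measure_mono hΩF))]
        exact add_tsub_cancel_of_le (measure_mono hΩF)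
      have h2 : volume F + volume F ≤ volume F + 2 * volume E := by
        calc volume F + volume F = 2 * volume Ω + 2 * volume E := by
              rw [← mul_add, h1, two_mul]
          _ ≤ _ := by gcongr
      exact (ENNReal.add_le_add_iff_left hFt).1 h2
    have hμFE : μ F ≤ 2 ^ q * W * μ E := by
      rw [hμ, withDensity_apply _ hFm, withDensity_apply _ hEm]
      exact hv.measure_le_of_half Set.sdiff_subset hhalf
    have hpt : ∀ y ∈ F, D.squareTrunc β f k₀ k₁ y * h y ≤
        2 * (c * m) * h y + Ω.indicator (fun y => D.squareTrunc β f k₀ (τ y) y * h y) y := by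
      intro y hy
      by_cases hyΩ : y ∈ Ω
      · rw [Set.indicator_of_mem hyΩ, ← add_mul, ← hXhalf]
        gcongr
        exact (hτ y hyΩ).2
      · rw [Set.indicator_of_notMem hyΩ, add_zero, ← hXhalf]
        gcongr
        exact ENNReal.rpow_le_rpow (not_lt.1 fun hlt => hyΩ ⟨hy, hlt⟩) (by norm_num)
    -- The contribution of the unstopped scales on all of F is charged to E alone, at the price `2 ^
    -- q * W`. Since E and Ω are disjoint and Ω is left to the induction, the constant does not grow
    -- with the number of scales.
    have hA : ∫⁻ y in F, 2 * (c * m) * h y ∂μ ≤ ∫⁻ y in E, 2 * c * 2 ^ q * W * MM y ∂μ := by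
      have h1 : ∀ y ∈ E, m * D.avg μ h k₁ x ≤ MM y := fun y hy => by
        have e1 := D.avg_le_maximal volume (fun z => ‖f z‖ₑ) k₁ y
        have e2 := D.avg_le_maximal μ h k₁ y
        rw [D.avg_eq_of_mem hy.1] at e1 e2
        exact mul_le_mul' e1 e2
      calc ∫⁻ y in F, 2 * (c * m) * h y ∂μ = 2 * (c * m) * (μ F * D.avg μ h k₁ x) := by
            rw [lintegral_const_mul _ hh, measure_mul_avg hv.regular]
        _ ≤ 2 * (c * m) * ((2 ^ q * W * μ E) * D.avg μ h k₁ x) := by gcongr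
        _ = 2 * c * 2 ^ q * W * ∫⁻ _ in E, m * D.avg μ h k₁ x ∂μ := by
            rw [setLIntegral_const]; ring
        _ ≤ 2 * c * 2 ^ q * W * ∫⁻ y in E, MM y ∂μ := by
            gcongr 1
            exact setLIntegral_mono' hEm h1
        _ = _ := (lintegral_const_mul _ hMMm).symm
    have hB : ∫⁻ y in Ω, D.squareTrunc β f k₀ (τ y) y * h y ∂μ ≤
        ∫⁻ y in Ω, 2 * c * 2 ^ q * W * MM y ∂μ := by
      refine hΩ.lintegral_le fun y hy => ?_
      refine le_trans (le_of_eq ?_) (ih (τ y) (by have := (hτ y hy).1; push_cast at hk₁; lia) y)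
      refine setLIntegral_congr_fun (D.measurableSet_cell _ _) fun z hz => ?_
      simp only [(hΩ y hy z hz).2]
    calc ∫⁻ y in F, D.squareTrunc β f k₀ k₁ y * h y ∂μ
        ≤ ∫⁻ y in F, (2 * (c * m) * h y
            + Ω.indicator (fun y => D.squareTrunc β f k₀ (τ y) y * h y) y) ∂μ :=
          setLIntegral_mono' hFm hpt
      _ = ∫⁻ y in F, 2 * (c * m) * h y ∂μ
            + ∫⁻ y in Ω, D.squareTrunc β f k₀ (τ y) y * h y ∂μ := by
          rw [lintegral_add_left (hh.const_mul _), lintegral_indicator hΩm,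
            Measure.restrict_restrict hΩm, Set.inter_eq_left.2 hΩF]
      _ ≤ ∫⁻ y in E, 2 * c * 2 ^ q * W * MM y ∂μ + ∫⁻ y in Ω, 2 * c * 2 ^ q * W * MM y ∂μ :=
          add_le_add hA hB
      _ = ∫⁻ y in F, 2 * c * 2 ^ q * W * MM y ∂μ := by
          rw [← lintegral_union hΩm Set.disjoint_sdiff_left, Set.sdiff_union_of_subset hΩF]

/-- A bilinear estimate with the maximal function of the test function gives an `L^q` bound. -/
lemma lintegral_rpow_le_of_bilinear {μ : Measure (Rn n)} [SigmaFinite μ] (hμ : D.Regular μ)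
    {G U : Rn n → ℝ≥0∞} (hG : Measurable G) (hU : Measurable U) {q : ℝ} (hq : 1 < q)
    {Z : ℝ≥0∞}
    (h : ∀ h : Rn n → ℝ≥0∞, Measurable h →
      ∫⁻ x, G x * h x ∂μ ≤ Z * ∫⁻ x, U x * D.maximal μ h x ∂μ) :
    ∫⁻ x, G x ^ q ∂μ ≤ Z ^ q * ENNReal.ofReal
      (2 * (q / (q - 1)) * (2 ^ (q / (q - 1) - 1) * (q / (q - 1) - 1)⁻¹)) ^ (q - 1) *
        ∫⁻ x, U x ^ q ∂μ := by
  have hq1 : 0 < q - 1 := by linarith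
  have hq0 : 0 < q := by linarith
  set r := q / (q - 1) with hr
  have hr1 : 1 < r := by rw [hr, lt_div_iff₀ hq1]; linarith
  have hqr : (q - 1) * r = q := by rw [hr]; field_simp
  have hconj : q.HolderConjugate r := Real.HolderConjugate.conjExponent hq
  set Cr := ENNReal.ofReal (2 * r * (2 ^ (r - 1) * (r - 1)⁻¹)) with hCr
  set S := spanningSets μ
  set H : ℕ → Rn n → ℝ≥0∞ := fun N => (S N).indicator fun x => min (G x) N with hH
  have hSm : ∀ N, MeasurableSet (S N) := measurableSet_spanningSets μ
  have hHm : ∀ N, Measurable (H N) := fun N => (hG.min measurable_const).indicator (hSm N)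
  have hHG : ∀ N x, H N x ≤ G x := fun N x =>
    (Set.indicator_le_self _ _ _).trans (min_le_left _ _)
  have main : ∀ N, ∫⁻ x, H N x ^ q ∂μ ≤ Z ^ q * Cr ^ (q - 1) * ∫⁻ x, U x ^ q ∂μ := by
    intro N
    -- Truncation in height and support makes I finite, so that a power of it can be divided out.
    set I := ∫⁻ x, H N x ^ q ∂μ with hI
    have hIt : I ≠ ∞ := by
      have : I ≤ ∫⁻ x in S N, (N : ℝ≥0∞) ^ q ∂μ := by
        rw [hI, ← lintegral_indicator (hSm N)]
        refine lintegral_mono fun x => ?_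
        by_cases hx : x ∈ S N
        · simp only [hH, Set.indicator_of_mem hx]
          gcongr
          exact min_le_right _ _
        · simp [hH, Set.indicator_of_notMem hx, hq0]
      refine ne_top_of_le_ne_top ?_ this
      rw [setLIntegral_const]
      exact ENNReal.mul_ne_top (ENNReal.rpow_ne_top_of_nonneg hq0.le (ENNReal.natCast_ne_top N))
        (measure_spanningSets_lt_top μ N).ne
    have hpow : ∀ a : ℝ≥0∞, a ^ q = a * a ^ (q - 1) := by
      intro a
      conv_lhs => rw [show q = 1 + (q - 1) by ring,
        ENNReal.rpow_add_of_nonneg _ _ (by norm_num) hq1.le, ENNReal.rpow_one]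
    -- The test function H^{q-1} is dual to H: its maximal function has L^r norm controlled by
    -- Doob's inequality, and (q-1)r = q turns this back into I.
    have h1 : I ≤ Z * ((∫⁻ x, U x ^ q ∂μ) ^ (1 / q) * (Cr * I) ^ (1 / r)) := by
      calc I ≤ ∫⁻ x, G x * H N x ^ (q - 1) ∂μ := by
            refine lintegral_mono fun x => ?_
            rw [hpow]
            exact mul_le_mul_left (hHG N x) _
        _ ≤ Z * ∫⁻ x, U x * D.maximal μ (fun x => H N x ^ (q - 1)) x ∂μ :=
            h _ ((hHm N).pow_const _)
        _ ≤ Z * ((∫⁻ x, U x ^ q ∂μ) ^ (1 / q) *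
              (∫⁻ x, D.maximal μ (fun x => H N x ^ (q - 1)) x ^ r ∂μ) ^ (1 / r)) := by
            gcongr
            exact ENNReal.lintegral_mul_le_Lp_mul_Lq μ hconj hU.aemeasurable
              (D.measurable_maximal _ _).aemeasurable
        _ ≤ _ := by
            gcongr
            refine (lintegral_maximal_rpow_le hμ ((hHm N).pow_const _) hr1).trans_eq ?_
            simp_rw [← ENNReal.rpow_mul, hqr]
            rfl
    rcases eq_or_ne I 0 with h0 | h0
    · rw [h0]; exact zero_le
    have hIr0 : I ^ (1 / r) ≠ 0 := by simp [ENNReal.rpow_eq_zero_iff, h0, hIt]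
    have hIrt : I ^ (1 / r) ≠ ∞ := ENNReal.rpow_ne_top_of_nonneg (by positivity) hIt
    have h2 : I ^ (1 / q) ≤ Z * ((∫⁻ x, U x ^ q ∂μ) ^ (1 / q) * Cr ^ (1 / r)) := by
      refine (ENNReal.mul_le_mul_iff_right hIr0 hIrt).1 ?_
      have e1 : I ^ (1 / r) * I ^ (1 / q) = I := by
        rw [← ENNReal.rpow_add _ _ h0 hIt, one_div, one_div, add_comm, hconj.inv_add_inv_eq_one,
          ENNReal.rpow_one]
      rw [e1]
      refine h1.trans_eq ?_
      rw [ENNReal.mul_rpow_of_nonneg _ _ (by positivity)]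
      ring
    have h3 := ENNReal.rpow_le_rpow h2 hq0.le
    rw [← ENNReal.rpow_mul, one_div_mul_cancel hq0.ne', ENNReal.rpow_one,
      ENNReal.mul_rpow_of_nonneg _ _ hq0.le, ENNReal.mul_rpow_of_nonneg _ _ hq0.le,
      ← ENNReal.rpow_mul, one_div_mul_cancel hq0.ne', ENNReal.rpow_one, ← ENNReal.rpow_mul,
      show 1 / r * q = q - 1 by rw [hr]; field_simp] at h3
    refine h3.trans_eq ?_
    ring
  have hmono : ∀ x, Monotone fun N => H N x := by
    intro x N M hNM
    by_cases hx : x ∈ S N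
    · have hx' : x ∈ S M := monotone_spanningSets μ hNM hx
      simp only [hH, Set.indicator_of_mem hx, Set.indicator_of_mem hx']
      gcongr
    · simp [hH, Set.indicator_of_notMem hx]
  have hsup : ∀ x, G x ^ q = ⨆ N, H N x ^ q := by
    intro x
    have h1 : G x = ⨆ N, H N x := by
      refine le_antisymm ?_ (iSup_le fun N => hHG N x)
      obtain ⟨N₀, hN₀⟩ := Set.mem_iUnion.1 ((iUnion_spanningSets μ).symm ▸ Set.mem_univ x)
      have h2 : G x = ⨆ R : ℕ, min (G x) (R : ℝ≥0∞) := by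
        have := (inf_iSup_eq (G x) (fun R : ℕ => (R : ℝ≥0∞)))
        rw [ENNReal.iSup_natCast, inf_top_eq] at this
        exact this
      conv_lhs => rw [h2]
      refine iSup_le fun R => ?_
      refine le_trans ?_ (le_iSup _ (max R N₀))
      have hx' : x ∈ S (max R N₀) := monotone_spanningSets μ (le_max_right _ _) hN₀
      simp only [hH, Set.indicator_of_mem hx']
      gcongr
      exact le_max_left _ _
    conv_lhs => rw [h1]
    exact (ENNReal.orderIsoRpow q hq0).map_iSup _
  simp_rw [hsup]
  rw [lintegral_iSup (fun N => (hHm N).pow_const q)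
    fun N M hNM x => ENNReal.rpow_le_rpow (hmono x hNM) hq0.le]
  exact iSup_le main

lemma square_eq_iSup (β : ℝ) (f : Rn n → ℂ) (x : Rn n) :
    D.square β f x = ⨆ N : ℕ, D.squareTrunc β f (-N) N x := by
  have h1 : ∑' k, D.cf β f k x ^ 2 = ⨆ N : ℕ, ∑ k ∈ Finset.Icc (-(N : ℤ)) N, D.cf β f k x ^ 2 := by
    refine ENNReal.tsum_eq_iSup_sum' (fun N : ℕ => Finset.Icc (-(N : ℤ)) N) fun t => ?_
    obtain ⟨N, hN⟩ := (t.image Int.natAbs).bddAbove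
    refine ⟨N, fun k hk => ?_⟩
    have : k.natAbs ≤ N := hN (Finset.mem_coe.2 (Finset.mem_image_of_mem _ hk))
    rw [Finset.mem_Icc]
    lia
  rw [square, h1]
  exact (ENNReal.orderIsoRpow (1 / 2) (by norm_num)).map_iSup _

/-- The weighted `L^q` bound for the dyadic square function. -/
theorem exists_lintegral_square_rpow_le (n : ℕ) {q β : ℝ} (hq : 1 < q) (hβ : 0 < β) :
    ∃ C : ℝ≥0∞, C ≠ ∞ ∧ ∀ (D : Grid n) (v : Rn n → ℝ≥0∞) (W : ℝ≥0∞), D.IsAp q v W →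
      ∀ f : Rn n → ℂ, AEStronglyMeasurable f volume → (∀ k x, IntegrableOn f (D.cell k x)) →
        ∫⁻ x, D.square β f x ^ q * v x
          ≤ C * (W ^ (q + q / (q - 1)) * ∫⁻ x, ‖f x‖ₑ ^ q * v x) := by
  have hq0 : 0 < q := by linarith
  have hq1 : 0 < q - 1 := by linarith
  set c₁ := 2 * ENNReal.ofReal (weakConst n β) * 2 ^ q
  set c₂ := ENNReal.ofReal
    (2 * (q / (q - 1)) * (2 ^ (q / (q - 1) - 1) * (q / (q - 1) - 1)⁻¹)) with hc₂
  set c₃ := ENNReal.ofReal (2 * q * (2 ^ (q - 1) * (q - 1)⁻¹)) with hc₃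
  have hc₁ : c₁ ≠ ∞ := ENNReal.mul_ne_top (ENNReal.mul_ne_top (by simp) ENNReal.ofReal_ne_top)
    (ENNReal.rpow_ne_top_of_nonneg hq0.le (by simp))
  refine ⟨c₁ ^ q * c₂ ^ (q - 1) * (c₂ * c₃), ?_, ?_⟩
  · exact ENNReal.mul_ne_top (ENNReal.mul_ne_top (ENNReal.rpow_ne_top_of_nonneg hq0.le hc₁)
      (ENNReal.rpow_ne_top_of_nonneg hq1.le ENNReal.ofReal_ne_top))
      (ENNReal.mul_ne_top ENNReal.ofReal_ne_top ENNReal.ofReal_ne_top)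
  · intro D v W hv f hfm hf
    set μ := volume.withDensity v with hμ
    have : SigmaFinite μ := SigmaFinite.withDensity_of_ne_top
      (Filter.Eventually.of_forall hv.ne_top)
    set u : Rn n → ℝ≥0∞ := hfm.enorm.mk with hu
    have hum : Measurable u := hfm.enorm.measurable_mk
    have hueq : (fun z => ‖f z‖ₑ) =ᵐ[volume] u := hfm.enorm.ae_eq_mk
    have hmax : D.maximal volume (fun z => ‖f z‖ₑ) = D.maximal volume u := D.maximal_congr hueq
    have hbuck := hv.lintegral_maximal_rpow_le hum
    rw [← hmax] at hbuck
    have hfu : ∫⁻ x, u x ^ q * v x = ∫⁻ x, ‖f x‖ₑ ^ q * v x :=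
      lintegral_congr_ae (by filter_upwards [hueq] with x hx; rw [hx])
    rw [hfu] at hbuck
    have htrunc : ∀ N : ℕ, ∫⁻ x, D.squareTrunc β f (-N) N x ^ q ∂μ ≤
        (c₁ * W) ^ q * c₂ ^ (q - 1) *
          ∫⁻ x, D.maximal volume (fun z => ‖f z‖ₑ) x ^ q ∂μ := by
      intro N
      refine lintegral_rpow_le_of_bilinear hv.regular (D.measurable_squareTrunc _ _ _ _)
        (D.measurable_maximal _ _) hq fun h hh => ?_
      rw [← lintegral_const_mul' _ _ (ENNReal.mul_ne_top hc₁ hv.const_ne_top),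
        ← setLIntegral_univ, ← setLIntegral_univ (μ := μ) (f := fun _ => _ * _)]
      -- Space is partitioned into cubes of the top scale N; the scales from -N to N number 2N + 1.
      exact (isCellUnion_univ (N : ℤ)).lintegral_le fun x _ =>
        lintegral_squareTrunc_mul_le hv hβ hf hh (-N) (2 * N + 1) N (by push_cast; lia) x
    have hsq : ∫⁻ x, D.square β f x ^ q ∂μ ≤ (c₁ * W) ^ q * c₂ ^ (q - 1) *
          ∫⁻ x, D.maximal volume (fun z => ‖f z‖ₑ) x ^ q ∂μ := by
      have hsup : ∀ x, D.square β f x ^ q = ⨆ N : ℕ, D.squareTrunc β f (-N) N x ^ q := by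
        intro x
        rw [square_eq_iSup]
        exact (ENNReal.orderIsoRpow q hq0).map_iSup _
      simp_rw [hsup]
      rw [lintegral_iSup fun N => (D.measurable_squareTrunc _ _ _ _).pow_const q]
      · exact iSup_le htrunc
      · intro N M hNM x
        refine ENNReal.rpow_le_rpow (ENNReal.rpow_le_rpow (Finset.sum_le_sum_of_subset
          (Finset.Icc_subset_Icc ?_ ?_)) (by norm_num)) hq0.le
        · have : (N : ℤ) ≤ M := by exact_mod_cast hNM
          lia
        · exact_mod_cast hNM
    rw [lintegral_withDensity_eq_lintegral_mul _ hv.measurable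
        ((D.measurable_square _ _).pow_const _),
      lintegral_withDensity_eq_lintegral_mul _ hv.measurable
        ((D.measurable_maximal _ _).pow_const _)] at hsq
    simp only [Pi.mul_apply, mul_comm (v _)] at hsq
    -- The domination contributes W^q and Buckley's theorem W^{q/(q-1)}.
    calc _ ≤ _ := hsq
      _ ≤ (c₁ * W) ^ q * c₂ ^ (q - 1) *
          (c₂ * c₃ * (W ^ (q / (q - 1)) * ∫⁻ x, ‖f x‖ₑ ^ q * v x)) := by gcongr
      _ = _ := by
          rw [ENNReal.mul_rpow_of_nonneg _ _ hq0.le,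
            ENNReal.rpow_add_of_nonneg _ _ hq0.le (by positivity)]
          ring

end Grid

/-! ### Shifted grids: from balls and bumps to dyadic cubes -/

/-- The dyadic grid that is shifted by one third in the directions selected by `α`. -/
noncomputable def shiftedGrid {n : ℕ} (α : Fin n → Bool) : Grid n where
  -- The alternating sign makes consecutive shifts differ by exactly ±2^k, so the grids remain
  -- nested.
  shift k i := if α i then (-1) ^ k * 2 ^ k / 3 else 0
  shift_succ k i := by
    by_cases h : α i
    · simp only [h, if_true]
      rcases Int.even_or_odd k with hk | hk
      · refine ⟨-1, ?_⟩
        rw [hk.neg_one_zpow, (hk.add_one).neg_one_zpow, zpow_add₀ (by norm_num)]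
        push_cast; ring
      · refine ⟨1, ?_⟩
        rw [hk.neg_one_zpow, (hk.add_one).neg_one_zpow, zpow_add₀ (by norm_num)]
        push_cast; ring
    · exact ⟨0, by simp [h]⟩

lemma exists_int_near_of_floor_ne {u u' δ : ℝ} (h : |u' - u| ≤ δ) (hne : ⌊u'⌋ ≠ ⌊u⌋) :
    ∃ m : ℤ, |u - m| ≤ δ := by
  rw [abs_le] at h
  rcases lt_or_gt_of_ne hne with hlt | hlt
  · refine ⟨⌊u⌋, ?_⟩
    have h1 := Int.floor_le u
    have h2 := Int.floor_lt.1 hlt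
    rw [abs_le]; constructor <;> linarith
  · refine ⟨⌊u'⌋, ?_⟩
    have h1 := Int.floor_le u'
    have h2 := Int.floor_lt.1 hlt
    rw [abs_le]; constructor <;> linarith

/-- One of the two grids on the line contains a given short interval in one of its cells. -/
lemma exists_shift_floor_eq (a L r s : ℝ) (hL : 0 < L) (hr : 8 * r ≤ L)
    (hs : s = L / 3 ∨ s = -(L / 3)) :
    ∃ b : Bool, ∀ y, |y - a| ≤ r →
      ⌊(y - if b then s else 0) / L⌋ = ⌊(a - if b then s else 0) / L⌋ := by
  by_contra! hcon
  obtain ⟨y₀, hy₀, hne₀⟩ := hcon false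
  obtain ⟨y₁, hy₁, hne₁⟩ := hcon true
  have hδ : ∀ y c, |y - a| ≤ r → |(y - c) / L - (a - c) / L| ≤ 1 / 8 := by
    intro y c hy
    rw [← sub_div, sub_sub_sub_cancel_right, abs_div, abs_of_pos hL, div_le_iff₀ hL]
    linarith
  obtain ⟨m₀, hm₀⟩ := exists_int_near_of_floor_ne (hδ y₀ _ hy₀) hne₀
  obtain ⟨m₁, hm₁⟩ := exists_int_near_of_floor_ne (hδ y₁ _ hy₁) hne₁
  simp only [Bool.false_eq_true, if_false, if_true, sub_zero, sub_div] at hm₀ hm₁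
  rw [abs_le] at hm₀ hm₁
  have hs' : s / L = 1 / 3 ∨ s / L = -(1 / 3) := by
    rcases hs with rfl | rfl
    · left; field_simp
    · right; field_simp
  -- If both grids cut the interval, an integer m₀ - m₁ lies within 1/4 of ±1/3, which is
  -- impossible.
  rcases lt_trichotomy (m₀ - m₁) 0 with h | h | h
  · have : m₀ - m₁ ≤ -1 := by lia
    have : (m₀ : ℝ) - m₁ ≤ -1 := by exact_mod_cast this
    rcases hs' with h' | h' <;> rw [h'] at hm₁ <;> linarith
  · have : (m₀ : ℝ) - m₁ = 0 := by exact_mod_cast h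
    rcases hs' with h' | h' <;> rw [h'] at hm₁ <;> linarith
  · have : 1 ≤ m₀ - m₁ := by lia
    have : 1 ≤ (m₀ : ℝ) - m₁ := by exact_mod_cast this
    rcases hs' with h' | h' <;> rw [h'] at hm₁ <;> linarith

/-- Every ball is contained in a cube of comparable size of one of the shifted grids. -/
lemma exists_closedBall_subset_cell {n : ℕ} (x : Rn n) {ρ : ℝ} {k : ℤ} (hρ : 16 * ρ ≤ 2 ^ k) :
    ∃ α : Fin n → Bool, Metric.closedBall x (2 * ρ) ⊆ (shiftedGrid α).cell k x := by
  have hs : ((-1 : ℝ) ^ k * 2 ^ k / 3) = 2 ^ k / 3 ∨ ((-1 : ℝ) ^ k * 2 ^ k / 3) = -(2 ^ k / 3) := by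
    rcases Int.even_or_odd k with hk | hk
    · left; rw [hk.neg_one_zpow, one_mul]
    · right; rw [hk.neg_one_zpow]; ring
  choose α hα using fun i => exists_shift_floor_eq (x i) (2 ^ k) (2 * ρ) _ (by positivity)
    (by linarith) hs
  refine ⟨α, fun y hy => funext fun i => hα i (y i) ?_⟩
  rw [Metric.mem_closedBall, dist_eq_norm] at hy
  exact (PiLp.norm_apply_le (y - x) i).trans hy

variable {n : ℕ}

/-- The sum of the coefficients over all shifted grids. -/
noncomputable def cfSum (β : ℝ) (f : Rn n → ℂ) (k : ℤ) (x : Rn n) : ℝ≥0∞ :=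
  ∑ α : Fin n → Bool, (shiftedGrid α).cf β f k x

/-- The sum of the dyadic maximal functions over all shifted grids. -/
noncomputable def maxSum (h : Rn n → ℝ≥0∞) (x : Rn n) : ℝ≥0∞ :=
  ∑ α : Fin n → Bool, (shiftedGrid α).maximal volume h x

/-- Pairings with bump functions of mean zero are controlled by the dyadic coefficients. -/
lemma enorm_integral_le_cfSum {β : ℝ} (hβ : 0 < β) (hβ1 : β ≤ 1) {x : Rn n} {ρ : ℝ} (hρ : 0 < ρ)
    {k : ℤ} (h16 : 16 * ρ ≤ 2 ^ k) (h32 : 2 ^ k ≤ 32 * ρ) {u : Rn n → ℂ} {A : ℝ} (hA : 0 ≤ A)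
    (hsupp : ∀ y ∉ Metric.closedBall x (2 * ρ), u y = 0) (hint : ∫ y, u y = 0)
    (hbd : ∀ y, ‖u y‖ ≤ A * (ρ ^ n)⁻¹)
    (hhol : ∀ y y', ‖u y - u y'‖ ≤ A * (ρ ^ n)⁻¹ * (‖y - y'‖ / ρ) ^ β) (f : Rn n → ℂ) :
    ‖∫ y, u y * f y‖ₑ ≤ ENNReal.ofReal (32 ^ (n + 1) * A) * cfSum β f k x := by
  rcases hA.eq_or_lt with rfl | hA
  · have : ∀ y, u y = 0 := fun y => by simpa using hbd y
    simp [this]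
  obtain ⟨α, hα⟩ := exists_closedBall_subset_cell x h16
  -- 32^n compares ρ^n with the volume of the cube, and one more 32 compares the Hölder quotients,
  -- as β ≤ 1.
  set c : ℝ := 32 ^ (n + 1) * A with hc
  have hc0 : 0 < c := by positivity
  have h2k : (0 : ℝ) < 2 ^ k := by positivity
  have hvol : (ρ ^ n)⁻¹ ≤ 32 ^ n * (((2 : ℝ) ^ k) ^ n)⁻¹ := by
    rw [← div_eq_mul_inv, inv_eq_one_div, div_le_div_iff₀ (by positivity) (by positivity), one_mul,
      ← mul_pow]
    exact pow_le_pow_left₀ h2k.le h32 n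
  have hatom : IsAtom β k ((shiftedGrid α).cell k x) fun y => ((c⁻¹ : ℝ) : ℂ) * u y := by
    refine ⟨fun y hy => ?_, ?_, fun y => ?_, fun y y' => ?_⟩
    · rw [hsupp y fun h => hy (hα h), mul_zero]
    · rw [integral_const_mul, hint, mul_zero]
    · rw [norm_mul, Complex.norm_real, Real.norm_of_nonneg (by positivity), inv_mul_le_iff₀ hc0]
      calc ‖u y‖ ≤ A * (32 ^ n * (((2 : ℝ) ^ k) ^ n)⁻¹) := (hbd y).trans (by gcongr)
        _ ≤ A * (32 ^ (n + 1) * (((2 : ℝ) ^ k) ^ n)⁻¹) := by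
          gcongr
          · norm_num
          · lia
        _ = _ := by rw [hc]; ring
    · rw [← mul_sub, norm_mul, Complex.norm_real, Real.norm_of_nonneg (by positivity),
        inv_mul_le_iff₀ hc0]
      have h1 : (‖y - y'‖ / ρ) ^ β ≤ 32 * (‖y - y'‖ / 2 ^ k) ^ β := by
        calc (‖y - y'‖ / ρ) ^ β ≤ (32 * (‖y - y'‖ / 2 ^ k)) ^ β := by
              gcongr
              rw [div_le_iff₀ hρ]
              calc ‖y - y'‖ = ‖y - y'‖ / 2 ^ k * 2 ^ k := by field_simp
                _ ≤ ‖y - y'‖ / 2 ^ k * (32 * ρ) := by gcongr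
                _ = _ := by ring
          _ = 32 ^ β * (‖y - y'‖ / 2 ^ k) ^ β := Real.mul_rpow (by norm_num) (by positivity)
          _ ≤ 32 * (‖y - y'‖ / 2 ^ k) ^ β := by
              gcongr
              calc (32 : ℝ) ^ β ≤ 32 ^ (1 : ℝ) := Real.rpow_le_rpow_of_exponent_le (by norm_num) hβ1
                _ = 32 := Real.rpow_one _
      calc ‖u y - u y'‖ ≤ A * (32 ^ n * (((2 : ℝ) ^ k) ^ n)⁻¹) * (32 * (‖y - y'‖ / 2 ^ k) ^ β) :=
            (hhol y y').trans (by gcongr)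
        _ = _ := by rw [hc]; ring
  have h1 := le_coef hatom f
  simp_rw [mul_assoc] at h1
  rw [integral_const_mul, enorm_mul] at h1
  have h2 : ‖((c⁻¹ : ℝ) : ℂ)‖ₑ = (ENNReal.ofReal c)⁻¹ := by
    rw [← ofReal_norm, Complex.norm_real, Real.norm_of_nonneg (by positivity),
      ENNReal.ofReal_inv_of_pos hc0]
  rw [h2] at h1
  have hc' : ENNReal.ofReal c ≠ 0 := by simpa using hc0
  calc ‖∫ y, u y * f y‖ₑ
      = ENNReal.ofReal c * ((ENNReal.ofReal c)⁻¹ * ‖∫ y, u y * f y‖ₑ) := by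
        rw [← mul_assoc, ENNReal.mul_inv_cancel hc' ENNReal.ofReal_ne_top, one_mul]
    _ ≤ ENNReal.ofReal c * cfSum β f k x := by
        gcongr
        exact h1.trans (Finset.single_le_sum (f := fun α => (shiftedGrid α).cf β f k x)
          (fun _ _ => zero_le) (Finset.mem_univ α))

/-- The ball lies in a cube of side at most 32ρ around x in one of the shifted grids, and the
average over that cube is below the maximal function at x. -/
lemma lintegral_closedBall_le {x : Rn n} {ρ : ℝ} (hρ : 0 < ρ) (h : Rn n → ℝ≥0∞) :
    ∫⁻ y in Metric.closedBall x (2 * ρ), h y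
      ≤ ENNReal.ofReal (32 ^ n * ρ ^ n) * maxSum h x := by
  obtain ⟨j, hj1, hj2⟩ := exists_mem_Ioc_zpow hρ (by norm_num : (1 : ℝ) < 2)
  have e5 : (2 : ℝ) ^ (j + 5) = 32 * 2 ^ j := by rw [zpow_add₀ (by norm_num)]; norm_num; ring
  have e1 : (2 : ℝ) ^ (j + 1) = 2 * 2 ^ j := by rw [zpow_add₀ (by norm_num)]; norm_num; ring
  obtain ⟨α, hα⟩ := exists_closedBall_subset_cell x (ρ := ρ) (k := j + 5) (by rw [e5]; linarith)
  calc ∫⁻ y in Metric.closedBall x (2 * ρ), h y ≤ ∫⁻ y in (shiftedGrid α).cell (j + 5) x, h y :=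
        lintegral_mono_set hα
    _ = (shiftedGrid α).avg volume h (j + 5) x * volume ((shiftedGrid α).cell (j + 5) x) :=
        (Grid.avg_mul_volume _ _ _).symm
    _ ≤ maxSum h x * ENNReal.ofReal (32 ^ n * ρ ^ n) := by
        refine mul_le_mul' (((shiftedGrid α).avg_le_maximal volume h _ x).trans ?_) ?_
        · exact Finset.single_le_sum (f := fun α => (shiftedGrid α).maximal volume h x)
            (fun _ _ => zero_le) (Finset.mem_univ α)
        · rw [Grid.volume_cell, ← mul_pow]
          refine ENNReal.ofReal_le_ofReal (pow_le_pow_left₀ (by positivity) ?_ n)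
          rw [e5]; linarith
    _ = _ := mul_comm _ _

/-! ### Decaying kernels and maximal functions -/

/-- The size bound for the kernels, as a function of the distance `s`. -/
noncomputable def decay (n : ℕ) (M t s : ℝ) : ℝ := t ^ (-(n : ℤ)) / (1 + t⁻¹ * s) ^ M

lemma decay_nonneg (n : ℕ) {M t s : ℝ} (ht : 0 < t) (hs : 0 ≤ s) : 0 ≤ decay n M t s := by
  unfold decay; positivity

lemma decay_le (n : ℕ) {M t s : ℝ} (ht : 0 < t) (hs : 0 ≤ s) (hM : 0 ≤ M) :
    decay n M t s ≤ (t ^ n)⁻¹ := by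
  unfold decay
  rw [zpow_neg, zpow_natCast]
  refine div_le_self (by positivity) (Real.one_le_rpow ?_ hM)
  have : 0 ≤ t⁻¹ * s := by positivity
  linarith

/-- The constant in `decay_le_dyadic`. -/
noncomputable def decayConst (n : ℕ) (β : ℝ) : ℝ := 2 ^ ((n : ℝ) + 2 * β)

lemma decayConst_pos (n : ℕ) (β : ℝ) : 0 < decayConst n β := by unfold decayConst; positivity

/-- At distance about 2^r t, the decay (2^r)^{-(n+2β)} provides the normalization by volume and two
factors 2^{-βr}. One will be spent on rescaling Hölder quotients or on telescoping averages, and the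
other makes the sum over r converge. -/
lemma decay_le_dyadic (n : ℕ) {β t s : ℝ} (hβ : 0 < β) (ht : 0 < t) (hs : 0 ≤ s) (r : ℕ)
    (h : r = 0 ∨ 2 ^ r * t / 2 ≤ s) :
    decay n (n + 2 * β) t s ≤
      decayConst n β * (((2 : ℝ) ^ (-β)) ^ r) ^ 2 * ((2 ^ r * t) ^ n)⁻¹ := by
  have h1 : (2 : ℝ) ^ r / 2 ≤ 1 + t⁻¹ * s := by
    rcases h with rfl | h
    · have : 0 ≤ t⁻¹ * s := by positivity
      rw [pow_zero]; linarith
    · have : t⁻¹ * (2 ^ r * t / 2) ≤ t⁻¹ * s := by gcongr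
      have e : t⁻¹ * (2 ^ r * t / 2) = 2 ^ r / 2 := by field_simp
      linarith
  have hM : 0 ≤ (n : ℝ) + 2 * β := by positivity
  have h2 : ((2 : ℝ) ^ r / 2) ^ ((n : ℝ) + 2 * β) ≤ (1 + t⁻¹ * s) ^ ((n : ℝ) + 2 * β) :=
    Real.rpow_le_rpow (by positivity) h1 hM
  have h3 : ((2 : ℝ) ^ r / 2) ^ ((n : ℝ) + 2 * β) =
      (decayConst n β * (((2 : ℝ) ^ (-β)) ^ r) ^ 2)⁻¹ * (2 ^ r) ^ n := by
    rw [Real.div_rpow (by positivity) (by positivity), Real.rpow_add (by positivity),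
      Real.rpow_natCast, decayConst]
    have : (((2 : ℝ) ^ (-β)) ^ r) ^ 2 = (((2 : ℝ) ^ r) ^ (2 * β))⁻¹ := by
      rw [← Real.rpow_natCast 2 r, ← Real.rpow_natCast _ r, ← Real.rpow_natCast _ 2,
        ← Real.rpow_mul (by positivity), ← Real.rpow_mul (by positivity),
        ← Real.rpow_mul (by positivity), ← Real.rpow_neg (by positivity)]
      congr 1
      push_cast; ring
    rw [this]
    field_simp
  rw [h3] at h2
  unfold decay
  rw [div_le_iff₀ (by positivity), zpow_neg, zpow_natCast]
  have hc := decayConst_pos n β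
  calc (t ^ n)⁻¹ = decayConst n β * (((2 : ℝ) ^ (-β)) ^ r) ^ 2 * ((2 ^ r * t) ^ n)⁻¹ *
        ((decayConst n β * (((2 : ℝ) ^ (-β)) ^ r) ^ 2)⁻¹ * (2 ^ r) ^ n) := by
        rw [mul_pow]; field_simp
    _ ≤ _ := by gcongr

/-- The constant in `lintegral_decay_mul_le`. -/
noncomputable def maxConst (n : ℕ) (β : ℝ) : ℝ≥0∞ :=
  ∑' r : ℕ, ENNReal.ofReal (32 ^ n * decayConst n β * (((2 : ℝ) ^ (-β)) ^ r) ^ 2)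

lemma maxConst_ne_top (n : ℕ) {β : ℝ} (hβ : 0 < β) : maxConst n β ≠ ∞ := by
  have h1 := two_rpow_neg_lt_one hβ
  have h0 : (0 : ℝ) < 2 ^ (-β) := by positivity
  have hc := decayConst_pos n β
  have hs : Summable fun r : ℕ => 32 ^ n * decayConst n β * (((2 : ℝ) ^ (-β)) ^ r) ^ 2 := by
    simp_rw [← pow_mul, mul_comm _ 2, pow_mul]
    exact (summable_geometric_of_lt_one (by positivity)
      (pow_lt_one₀ h0.le h1 (by norm_num))).mul_left _
  exact hs.tsum_ofReal_ne_top

/-- The kernel is dominated by a geometrically convergent sum of normalized indicators of the balls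
of radius 2 · 2^r t. -/
lemma lintegral_decay_mul_le {β : ℝ} (hβ : 0 < β) {t : ℝ} (ht : 0 < t) (x : Rn n)
    {h : Rn n → ℝ≥0∞} (hh : AEMeasurable h volume) :
    ∫⁻ y, ENNReal.ofReal (decay n (n + 2 * β) t ‖x - y‖) * h y ≤ maxConst n β * maxSum h x := by
  set b : ℕ → ℝ := fun r =>
    decayConst n β * (((2 : ℝ) ^ (-β)) ^ r) ^ 2 * ((2 ^ r * t) ^ n)⁻¹ with hb
  have hc := decayConst_pos n β
  have hpt : ∀ y, ENNReal.ofReal (decay n (n + 2 * β) t ‖x - y‖) * h y ≤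
      ∑' r : ℕ, (Metric.closedBall x (2 * (2 ^ r * t))).indicator
        (fun y => ENNReal.ofReal (b r) * h y) y := by
    intro y
    have hex : ∃ r : ℕ, ‖x - y‖ ≤ 2 * (2 ^ r * t) := by
      obtain ⟨r, hr⟩ := pow_unbounded_of_one_lt (‖x - y‖ / (2 * t)) (by norm_num : (1 : ℝ) < 2)
      refine ⟨r, ?_⟩
      rw [div_lt_iff₀ (by positivity)] at hr
      linarith
    classical
    set r := Nat.find hex with hr
    have hr1 : ‖x - y‖ ≤ 2 * (2 ^ r * t) := Nat.find_spec hex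
    have hr2 : r = 0 ∨ 2 ^ r * t / 2 ≤ ‖x - y‖ := by
      rcases Nat.eq_zero_or_pos r with h0 | h0
      · exact Or.inl h0
      · right
        have h3 := Nat.find_min hex (m := r - 1) (Nat.sub_lt h0 one_pos)
        rw [not_le] at h3
        have h4 : (2 : ℝ) ^ r = 2 * 2 ^ (r - 1) := by
          rw [← pow_succ']; congr 1; lia
        have h5 : 0 ≤ 2 ^ (r - 1) * t := by positivity
        rw [h4]; linarith
    refine le_trans ?_ (ENNReal.le_tsum r)
    rw [Set.indicator_of_mem (by rw [Metric.mem_closedBall, dist_comm, dist_eq_norm]; exact hr1)]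
    gcongr
    exact decay_le_dyadic n hβ ht (norm_nonneg _) r hr2
  calc _ ≤ ∫⁻ y, ∑' r : ℕ, (Metric.closedBall x (2 * (2 ^ r * t))).indicator
        (fun y => ENNReal.ofReal (b r) * h y) y := lintegral_mono hpt
    _ = ∑' r : ℕ, ∫⁻ y, (Metric.closedBall x (2 * (2 ^ r * t))).indicator
        (fun y => ENNReal.ofReal (b r) * h y) y :=
        lintegral_tsum fun r => (hh.const_mul _).indicator Metric.isClosed_closedBall.measurableSet
    _ ≤ ∑' r : ℕ, ENNReal.ofReal (32 ^ n * decayConst n β * (((2 : ℝ) ^ (-β)) ^ r) ^ 2)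
          * maxSum h x := by
        refine ENNReal.tsum_le_tsum fun r => ?_
        rw [lintegral_indicator Metric.isClosed_closedBall.measurableSet,
          lintegral_const_mul' _ _ ENNReal.ofReal_ne_top]
        refine (mul_le_mul_right (lintegral_closedBall_le (by positivity) h) _).trans_eq ?_
        rw [← mul_assoc, ← ENNReal.ofReal_mul (by positivity)]
        congr 2
        simp only [hb]
        field_simp
    _ = _ := ENNReal.tsum_mul_right

lemma maxSum_one_le (x : Rn n) : maxSum (fun _ => 1) x ≤ 2 ^ n := by
  have : ∀ α : Fin n → Bool, (shiftedGrid α).maximal volume (fun _ => 1) x ≤ 1 := by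
    intro α
    refine iSup_le fun k => ?_
    rw [Grid.avg, setLIntegral_one, ENNReal.inv_mul_cancel (Grid.volume_cell_ne_zero _ _ _)
      (Grid.volume_cell_ne_top _ _ _)]
  refine (Finset.sum_le_sum fun α _ => this α).trans_eq ?_
  simp

lemma continuous_decay {M t : ℝ} (ht : 0 < t) (x : Rn n) :
    Continuous fun y : Rn n => decay n M t ‖x - y‖ := by
  unfold decay
  refine continuous_const.div ?_ fun y => ?_
  · refine Continuous.rpow_const (by fun_prop) fun y => Or.inl ?_
    positivity
  · positivity

lemma integrable_decay {β : ℝ} (hβ : 0 < β) {t : ℝ} (ht : 0 < t) (x : Rn n) :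
    Integrable fun y : Rn n => decay n (n + 2 * β) t ‖x - y‖ := by
  refine ⟨(continuous_decay ht x).aestronglyMeasurable, ?_⟩
  have h1 := lintegral_decay_mul_le hβ ht x (h := fun _ => 1) aemeasurable_const
  simp only [mul_one] at h1
  have h2 : maxConst n β * maxSum (fun _ => 1) x < ∞ :=
    ENNReal.mul_lt_top (lt_top_iff_ne_top.2 (maxConst_ne_top n hβ))
      ((maxSum_one_le x).trans_lt (by simp))
  refine lt_of_le_of_lt (lintegral_mono fun y => ?_) (h1.trans_lt h2)
  rw [← ofReal_norm, Real.norm_of_nonneg (decay_nonneg n ht (norm_nonneg _))]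

/-! ### Annular cutoffs and bump averages -/

/-- A Lipschitz cutoff on the line: one on `[0, ρ]`, zero beyond `2 ρ`. -/
noncomputable def eta (ρ s : ℝ) : ℝ := max 0 (min 1 (2 - s / ρ))

lemma eta_nonneg (ρ s : ℝ) : 0 ≤ eta ρ s := le_max_left _ _

lemma eta_le_one (ρ s : ℝ) : eta ρ s ≤ 1 := max_le zero_le_one (min_le_left _ _)

lemma eta_eq_one {ρ s : ℝ} (hρ : 0 < ρ) (h : s ≤ ρ) : eta ρ s = 1 := by
  have : s / ρ ≤ 1 := (div_le_one hρ).2 h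
  rw [eta, min_eq_left (by linarith), max_eq_right zero_le_one]

lemma eta_eq_zero {ρ s : ℝ} (hρ : 0 < ρ) (h : 2 * ρ ≤ s) : eta ρ s = 0 := by
  have : 2 ≤ s / ρ := (le_div_iff₀ hρ).2 h
  rw [eta, min_eq_right (by linarith), max_eq_left (by linarith)]

lemma continuous_eta (ρ : ℝ) : Continuous (eta ρ) := by unfold eta; fun_prop

/-- The cutoff is bounded by 1 and Lipschitz with constant 1/ρ, and min(1, s) ≤ s^β for 0 < β ≤ 1.
-/
lemma abs_eta_sub_le {ρ β : ℝ} (hρ : 0 < ρ) (hβ : 0 < β) (hβ1 : β ≤ 1) {s s' d : ℝ}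
    (hd : |s - s'| ≤ d) : |eta ρ s - eta ρ s'| ≤ (d / ρ) ^ β := by
  have hd0 : 0 ≤ d := (abs_nonneg _).trans hd
  have h1 : |eta ρ s - eta ρ s'| ≤ 1 := by
    rw [abs_le]
    constructor <;> linarith [eta_nonneg ρ s, eta_nonneg ρ s', eta_le_one ρ s, eta_le_one ρ s']
  have h2 : |eta ρ s - eta ρ s'| ≤ d / ρ := by
    have h3 : |eta ρ s - eta ρ s'| ≤ |(2 - s / ρ) - (2 - s' / ρ)| := by
      unfold eta
      refine (abs_max_sub_max_le_max _ _ _ _).trans (max_le (by simp) ?_)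
      exact (abs_min_sub_min_le_max _ _ _ _).trans (max_le (by simp) le_rfl)
    refine h3.trans ?_
    rw [sub_sub_sub_cancel_left, ← sub_div, abs_div, abs_of_pos hρ, abs_sub_comm]
    gcongr
  rcases le_total (d / ρ) 1 with h | h
  · refine h2.trans ?_
    have := Real.rpow_le_rpow_of_exponent_ge' (by positivity) h hβ.le hβ1
    rwa [Real.rpow_one] at this
  · exact h1.trans (Real.one_le_rpow h hβ.le)

/-- A partition of unity on the half line adapted to the intervals
`[2 ^ (r - 1) t, 2 ^ (r + 1) t]`. -/
noncomputable def psi (t : ℝ) : ℕ → ℝ → ℝ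
  | 0, s => eta t s
  | r + 1, s => eta (2 ^ (r + 1) * t) s - eta (2 ^ r * t) s

lemma sum_psi (t s : ℝ) (R : ℕ) : ∑ r ∈ Finset.range (R + 1), psi t r s = eta (2 ^ R * t) s := by
  induction R with
  | zero => simp [psi]
  | succ R ih => rw [Finset.sum_range_succ, ih, psi]; ring

lemma continuous_psi (t : ℝ) (r : ℕ) : Continuous (psi t r) := by
  cases r with
  | zero => exact continuous_eta t
  | succ r => exact (continuous_eta _).sub (continuous_eta _)

lemma abs_psi_le_one (t : ℝ) (r : ℕ) (s : ℝ) : |psi t r s| ≤ 1 := by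
  cases r with
  | zero => rw [psi, abs_of_nonneg (eta_nonneg _ _)]; exact eta_le_one _ _
  | succ r =>
    rw [psi, abs_le]
    have h1 := eta_nonneg (2 ^ (r + 1) * t) s
    have h2 := eta_nonneg (2 ^ r * t) s
    have h3 := eta_le_one (2 ^ (r + 1) * t) s
    have h4 := eta_le_one (2 ^ r * t) s
    constructor <;> linarith

lemma psi_eq_zero_of_le {t : ℝ} (ht : 0 < t) (r : ℕ) {s : ℝ} (h : 2 * (2 ^ r * t) ≤ s) :
    psi t r s = 0 := by
  cases r with
  | zero => exact eta_eq_zero ht (by simpa using h)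
  | succ r =>
    have : 0 < 2 ^ r * t := by positivity
    rw [pow_succ] at h
    rw [psi, eta_eq_zero (by positivity) (by rw [pow_succ]; exact h),
      eta_eq_zero (by positivity) (by linarith), sub_zero]

lemma psi_eq_zero_of_ge {t : ℝ} (ht : 0 < t) (r : ℕ) {s : ℝ} (h : ¬(r = 0 ∨ 2 ^ r * t / 2 ≤ s)) :
    psi t r s = 0 := by
  push Not at h
  obtain ⟨r, rfl⟩ := Nat.exists_eq_succ_of_ne_zero h.1
  have h2 := h.2
  have : 0 < 2 ^ r * t := by positivity
  rw [Nat.succ_eq_add_one, pow_succ] at h2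
  rw [Nat.succ_eq_add_one, psi, eta_eq_one (by positivity) (by rw [pow_succ]; linarith),
    eta_eq_one (by positivity) (by linarith), sub_self]

lemma abs_psi_sub_le {t β : ℝ} (ht : 0 < t) (hβ : 0 < β) (hβ1 : β ≤ 1) (r : ℕ) {s s' d : ℝ}
    (hd : |s - s'| ≤ d) : |psi t r s - psi t r s'| ≤ 3 * (d / (2 ^ r * t)) ^ β := by
  have hd0 : 0 ≤ d := (abs_nonneg _).trans hd
  cases r with
  | zero =>
    have h1 := abs_eta_sub_le ht hβ hβ1 hd
    have h2 : 0 ≤ (d / t) ^ β := by positivity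
    simp only [psi, pow_zero, one_mul]
    linarith
  | succ r =>
    have hr : 0 < 2 ^ r * t := by positivity
    have h1 := abs_eta_sub_le (ρ := 2 ^ (r + 1) * t) (by positivity) hβ hβ1 hd
    have h2 := abs_eta_sub_le hr hβ hβ1 hd
    have h3 : (d / (2 ^ r * t)) ^ β ≤ 2 * (d / (2 ^ (r + 1) * t)) ^ β := by
      rw [show d / (2 ^ r * t) = 2 * (d / (2 ^ (r + 1) * t)) by rw [pow_succ]; field_simp,
        Real.mul_rpow (by norm_num) (by positivity)]
      gcongr
      calc (2 : ℝ) ^ β ≤ 2 ^ (1 : ℝ) := Real.rpow_le_rpow_of_exponent_le (by norm_num) hβ1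
        _ = 2 := Real.rpow_one _
    rw [psi, psi]
    calc _ = |(eta (2 ^ (r + 1) * t) s - eta (2 ^ (r + 1) * t) s')
          - (eta (2 ^ r * t) s - eta (2 ^ r * t) s')| := by congr 1; ring
      _ ≤ _ := (abs_sub _ _).trans (by linarith)

/-- The volume of the unit ball. -/
noncomputable def ballVol (n : ℕ) : ℝ := volume.real (Metric.ball (0 : Rn n) 1)

lemma ballVol_pos (n : ℕ) : 0 < ballVol n :=
  ENNReal.toReal_pos (Metric.measure_ball_pos _ _ one_pos).ne' measure_ball_lt_top.ne

lemma volume_real_closedBall (x : Rn n) {ρ : ℝ} (hρ : 0 ≤ ρ) :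
    volume.real (Metric.closedBall x ρ) = ρ ^ n * ballVol n := by
  rw [Measure.addHaar_real_closedBall volume x hρ, finrank_euclideanSpace_fin, ballVol]

/-- A normalized bump function of scale `ρ` centred at `x`. -/
noncomputable def bump (x : Rn n) (ρ : ℝ) (y : Rn n) : ℝ :=
  eta ρ ‖x - y‖ / ∫ z, eta ρ ‖x - z‖

lemma continuous_eta_norm (x : Rn n) (ρ : ℝ) : Continuous fun y => eta ρ ‖x - y‖ :=
  (continuous_eta ρ).comp (by fun_prop)

lemma eta_norm_eq_zero {x : Rn n} {ρ : ℝ} (hρ : 0 < ρ) {y : Rn n}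
    (hy : y ∉ Metric.closedBall x (2 * ρ)) : eta ρ ‖x - y‖ = 0 := by
  rw [Metric.mem_closedBall, dist_comm, dist_eq_norm, not_le] at hy
  exact eta_eq_zero hρ hy.le

lemma integrable_eta_norm (x : Rn n) {ρ : ℝ} (hρ : 0 < ρ) : Integrable fun y => eta ρ ‖x - y‖ :=
  (continuous_eta_norm x ρ).integrable_of_hasCompactSupport
    (HasCompactSupport.intro (isCompact_closedBall x (2 * ρ)) fun _ hy => eta_norm_eq_zero hρ hy)

lemma le_integral_eta (x : Rn n) {ρ : ℝ} (hρ : 0 < ρ) :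
    ballVol n * ρ ^ n ≤ ∫ z, eta ρ ‖x - z‖ := by
  calc ballVol n * ρ ^ n = ∫ z in Metric.closedBall x ρ, eta ρ ‖x - z‖ := by
        rw [setIntegral_congr_fun (g := fun _ => (1 : ℝ)) Metric.isClosed_closedBall.measurableSet
          fun y hy => ?_]
        · simp [volume_real_closedBall x hρ.le, mul_comm]
        · rw [Metric.mem_closedBall, dist_comm, dist_eq_norm] at hy
          exact eta_eq_one hρ hy
    _ ≤ _ := setIntegral_le_integral (integrable_eta_norm x hρ)
        (Filter.Eventually.of_forall fun y => eta_nonneg _ _)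

lemma integral_eta_pos (x : Rn n) {ρ : ℝ} (hρ : 0 < ρ) : 0 < ∫ z, eta ρ ‖x - z‖ := by
  have := ballVol_pos n
  exact lt_of_lt_of_le (by positivity) (le_integral_eta x hρ)

lemma bump_nonneg (x : Rn n) {ρ : ℝ} (hρ : 0 < ρ) (y : Rn n) : 0 ≤ bump x ρ y :=
  div_nonneg (eta_nonneg _ _) (integral_eta_pos x hρ).le

lemma bump_le (x : Rn n) {ρ : ℝ} (hρ : 0 < ρ) (y : Rn n) :
    bump x ρ y ≤ (ballVol n)⁻¹ * (ρ ^ n)⁻¹ := by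
  have := ballVol_pos n
  rw [← mul_inv, ← one_div]
  exact div_le_div₀ zero_le_one (eta_le_one _ _) (by positivity) (le_integral_eta x hρ)

lemma bump_eq_zero {x : Rn n} {ρ : ℝ} (hρ : 0 < ρ) {y : Rn n}
    (hy : y ∉ Metric.closedBall x (2 * ρ)) : bump x ρ y = 0 := by
  rw [bump, eta_norm_eq_zero hρ hy, zero_div]

lemma continuous_bump (x : Rn n) (ρ : ℝ) : Continuous (bump x ρ) :=
  (continuous_eta_norm x ρ).div_const _

lemma integrable_bump (x : Rn n) {ρ : ℝ} (hρ : 0 < ρ) : Integrable (bump x ρ) :=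
  (integrable_eta_norm x hρ).div_const _

lemma integral_bump (x : Rn n) {ρ : ℝ} (hρ : 0 < ρ) : ∫ y, bump x ρ y = 1 := by
  simp only [bump]
  rw [integral_div, div_self (integral_eta_pos x hρ).ne']

lemma abs_norm_sub_sub_le (x y y' : Rn n) : |‖x - y‖ - ‖x - y'‖| ≤ ‖y - y'‖ := by
  refine (abs_norm_sub_norm_le _ _).trans_eq ?_
  rw [sub_sub_sub_cancel_left, norm_sub_rev]

lemma abs_bump_sub_le (x : Rn n) {ρ β : ℝ} (hρ : 0 < ρ) (hβ : 0 < β) (hβ1 : β ≤ 1) (y y' : Rn n) :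
    |bump x ρ y - bump x ρ y'| ≤ (ballVol n)⁻¹ * (ρ ^ n)⁻¹ * (‖y - y'‖ / ρ) ^ β := by
  have := ballVol_pos n
  have hI := le_integral_eta x hρ
  rw [bump, bump, ← sub_div, abs_div, abs_of_pos (integral_eta_pos x hρ), div_eq_inv_mul, ← mul_inv]
  gcongr
  exact abs_eta_sub_le hρ hβ hβ1 (abs_norm_sub_sub_le x y y')

lemma bump_antitone_bound (n r : ℕ) (t : ℝ) (ht : 0 < t) :
    ((2 ^ r * t) ^ n)⁻¹ = 2 ^ n * ((2 ^ (r + 1) * t) ^ n)⁻¹ := by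
  rw [pow_succ, show (2 : ℝ) ^ r * 2 * t = 2 * (2 ^ r * t) by ring, mul_pow 2]
  field_simp

/-- Differences of consecutive bump averages are controlled by the dyadic coefficients. -/
lemma enorm_bump_sub_le {β : ℝ} (hβ : 0 < β) (hβ1 : β ≤ 1) {t : ℝ} (ht : 0 < t) {k : ℤ}
    (h16 : 16 * t ≤ 2 ^ k) (h32 : 2 ^ k ≤ 32 * t) (x : Rn n) {f : Rn n → ℂ}
    (hf : LocallyIntegrable f) (r : ℕ) :
    ‖(∫ y, (bump x (2 ^ (r + 1) * t) y : ℂ) * f y) - ∫ y, (bump x (2 ^ r * t) y : ℂ) * f y‖ₑ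
      ≤ ENNReal.ofReal (32 ^ (n + 1) * ((1 + 2 ^ (n + 1)) * (ballVol n)⁻¹)) *
        cfSum β f (k + (r + 1 : ℕ)) x := by
  have hv := ballVol_pos n
  have hr : 0 < 2 ^ r * t := by positivity
  have hr1 : 0 < 2 ^ (r + 1) * t := by positivity
  have hint : ∀ ρ : ℝ, 0 < ρ → Integrable fun y => (bump x ρ y : ℂ) * f y := fun ρ hρ =>
    hf.integrable_smul_left_of_hasCompactSupport (𝕜 := ℂ)
      (Complex.continuous_ofReal.comp (continuous_bump x ρ))
      (HasCompactSupport.intro (isCompact_closedBall x (2 * ρ)) fun y hy => by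
        simp [bump_eq_zero hρ hy])
  have h2 : (2 : ℝ) ^ (k + (r + 1 : ℕ)) = 2 ^ k * 2 ^ (r + 1) := by
    rw [zpow_add₀ (by norm_num), zpow_natCast]
  rw [← integral_sub (hint _ hr1) (hint _ hr)]
  simp_rw [← sub_mul]
  -- Both bumps have integral one, so their difference has mean zero and is a multiple of an atom at
  -- the larger scale.
  refine enorm_integral_le_cfSum hβ hβ1 hr1
    (by rw [h2]; nlinarith [pow_pos (two_pos (α := ℝ)) (r + 1)])
    (by rw [h2]; nlinarith [pow_pos (two_pos (α := ℝ)) (r + 1)]) (by positivity) ?_ ?_ ?_ ?_ f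
  · intro y hy
    have : y ∉ Metric.closedBall x (2 * (2 ^ r * t)) := fun h => hy
      (Metric.closedBall_subset_closedBall (by rw [pow_succ]; linarith) h)
    rw [bump_eq_zero hr1 hy, bump_eq_zero hr this, sub_self]
  · rw [integral_sub (integrable_bump x hr1).ofReal (integrable_bump x hr).ofReal,
      integral_complex_ofReal, integral_complex_ofReal, integral_bump x hr1, integral_bump x hr,
      sub_self]
  · intro y
    rw [← Complex.ofReal_sub, Complex.norm_real, Real.norm_eq_abs]
    have h3 := bump_le x hr1 y
    have h4 := bump_le x hr y
    rw [bump_antitone_bound n r t ht] at h4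
    have h5 := bump_nonneg x hr1 y
    have h6 := bump_nonneg x hr y
    set a := (ballVol n)⁻¹ * ((2 ^ (r + 1) * t) ^ n)⁻¹ with ha
    have ha0 : 0 ≤ a := by positivity
    have h7 : (ballVol n)⁻¹ * (2 ^ n * ((2 ^ (r + 1) * t) ^ n)⁻¹) = 2 ^ n * a := by rw [ha]; ring
    have h8 : (1 + 2 ^ (n + 1)) * (ballVol n)⁻¹ * ((2 ^ (r + 1) * t) ^ n)⁻¹
        = a + 2 * (2 ^ n * a) := by rw [ha]; ring
    rw [h7] at h4
    have h9 : 0 ≤ 2 ^ n * a := by positivity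
    rw [h8, abs_le]
    constructor <;> linarith
  · intro y y'
    rw [← Complex.ofReal_sub, ← Complex.ofReal_sub, ← Complex.ofReal_sub, Complex.norm_real,
      Real.norm_eq_abs]
    have h3 := abs_bump_sub_le x hr1 hβ hβ1 y y'
    have h4 := abs_bump_sub_le x hr hβ hβ1 y y'
    have h5 : (‖y - y'‖ / (2 ^ r * t)) ^ β ≤ 2 * (‖y - y'‖ / (2 ^ (r + 1) * t)) ^ β := by
      rw [show ‖y - y'‖ / (2 ^ r * t) = 2 * (‖y - y'‖ / (2 ^ (r + 1) * t)) by
        rw [pow_succ]; field_simp, Real.mul_rpow (by norm_num) (by positivity)]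
      gcongr
      calc (2 : ℝ) ^ β ≤ 2 ^ (1 : ℝ) := Real.rpow_le_rpow_of_exponent_le (by norm_num) hβ1
        _ = 2 := Real.rpow_one _
    calc _ = |(bump x (2 ^ (r + 1) * t) y - bump x (2 ^ (r + 1) * t) y')
          - (bump x (2 ^ r * t) y - bump x (2 ^ r * t) y')| := by congr 1; ring
      _ ≤ (ballVol n)⁻¹ * ((2 ^ (r + 1) * t) ^ n)⁻¹ * (‖y - y'‖ / (2 ^ (r + 1) * t)) ^ β
          + (ballVol n)⁻¹ * (2 ^ n * ((2 ^ (r + 1) * t) ^ n)⁻¹)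
            * (2 * (‖y - y'‖ / (2 ^ (r + 1) * t)) ^ β) := by
          refine (abs_sub _ _).trans (add_le_add h3 (h4.trans ?_))
          rw [← bump_antitone_bound n r t ht]
          gcongr
      _ = _ := by ring

/-- Averages against bump functions are controlled by the maximal function. -/
lemma enorm_bump_average_le (x : Rn n) {t : ℝ} (ht : 0 < t) (f : Rn n → ℂ) :
    ‖∫ y, (bump x t y : ℂ) * f y‖ₑ
      ≤ ENNReal.ofReal ((ballVol n)⁻¹ * 32 ^ n) * maxSum (fun y => ‖f y‖ₑ) x := by
  have hv := ballVol_pos n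
  calc ‖∫ y, (bump x t y : ℂ) * f y‖ₑ
      = ‖∫ y in Metric.closedBall x (2 * t), (bump x t y : ℂ) * f y‖ₑ := by
        rw [setIntegral_eq_integral_of_forall_compl_eq_zero]
        intro y hy; simp [bump_eq_zero ht hy]
    _ ≤ ∫⁻ y in Metric.closedBall x (2 * t), ‖(bump x t y : ℂ) * f y‖ₑ :=
        enorm_integral_le_lintegral_enorm _
    _ ≤ ∫⁻ y in Metric.closedBall x (2 * t),
          ENNReal.ofReal ((ballVol n)⁻¹ * (t ^ n)⁻¹) * ‖f y‖ₑ := by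
        refine lintegral_mono fun y => ?_
        rw [enorm_mul, ← ofReal_norm (bump x t y : ℂ), Complex.norm_real,
          Real.norm_of_nonneg (bump_nonneg x ht y)]
        gcongr
        exact bump_le x ht y
    _ ≤ ENNReal.ofReal ((ballVol n)⁻¹ * (t ^ n)⁻¹) *
          (ENNReal.ofReal (32 ^ n * t ^ n) * maxSum (fun y => ‖f y‖ₑ) x) := by
        rw [lintegral_const_mul' _ _ ENNReal.ofReal_ne_top]
        gcongr
        exact lintegral_closedBall_le ht _
    _ = _ := by
        rw [← mul_assoc, ← ENNReal.ofReal_mul (by positivity)]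
        congr 2
        field_simp

/-! ### One-variable kernels cut into atoms -/

/-- The ratio of the geometric weights. -/
noncomputable def ratio (β : ℝ) (r : ℕ) : ℝ := ((2 : ℝ) ^ (-β)) ^ r

lemma ratio_pos (β : ℝ) (r : ℕ) : 0 < ratio β r := by unfold ratio; positivity

lemma ratio_anti {β : ℝ} (hβ : 0 < β) {s r : ℕ} (h : s ≤ r) : ratio β r ≤ ratio β s :=
  pow_le_pow_of_le_one (by positivity) (two_rpow_neg_lt_one hβ).le h

lemma ratio_le_one {β : ℝ} (hβ : 0 < β) (r : ℕ) : ratio β r ≤ 1 :=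
  pow_le_one₀ (by positivity) (two_rpow_neg_lt_one hβ).le

lemma ratio_mul_rpow {β : ℝ} (r : ℕ) {t d : ℝ} (ht : 0 < t) (hd : 0 ≤ d) :
    ratio β r * (d / t) ^ β = (d / (2 ^ r * t)) ^ β := by
  have h1 : ratio β r = ((2 : ℝ) ^ r) ^ (-β) := by
    rw [ratio, ← Real.rpow_natCast, ← Real.rpow_natCast 2, ← Real.rpow_mul (by norm_num),
      ← Real.rpow_mul (by norm_num), mul_comm]
  rw [h1, Real.rpow_neg (by positivity), Real.div_rpow hd ht.le, Real.div_rpow hd (by positivity),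
    Real.mul_rpow (by positivity) ht.le]
  field_simp

lemma tsum_ratio_ne_top {β : ℝ} (hβ : 0 < β) : ∑' r : ℕ, ENNReal.ofReal (ratio β r) ≠ ∞ :=
  (summable_geometric_of_lt_one (by positivity) (two_rpow_neg_lt_one hβ)).tsum_ofReal_ne_top

/-- Bounds for a kernel centred at `x` with scale `t`. -/
structure IsKernel (β : ℝ) (x : Rn n) (t B : ℝ) (κ : Rn n → ℂ) : Prop where
  le : ∀ y, ‖κ y‖ ≤ B * decay n (n + 2 * β) t ‖x - y‖
  sub_le : ∀ y y', ‖κ y - κ y'‖ ≤ B * ((‖y - y'‖ / t) ^ β *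
    (decay n (n + 2 * β) t ‖x - y‖ + decay n (n + 2 * β) t ‖x - y'‖))

namespace IsKernel

variable {β : ℝ} {x : Rn n} {t B : ℝ} {κ : Rn n → ℂ}

lemma continuous (hκ : IsKernel β x t B κ) (hβ : 0 < β) (ht : 0 < t) (hB : 0 ≤ B) :
    Continuous κ := by
  refine continuous_of_norm_sub_le (C := 2 * B * (t ^ n)⁻¹) (ℓ := t) hβ fun y y' =>
    (hκ.sub_le y y').trans ?_
  have h1 := decay_le n (M := n + 2 * β) ht (norm_nonneg (x - y)) (by positivity)
  have h2 := decay_le n (M := n + 2 * β) ht (norm_nonneg (x - y')) (by positivity)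
  calc _ ≤ B * ((‖y - y'‖ / t) ^ β * ((t ^ n)⁻¹ + (t ^ n)⁻¹)) := by gcongr
    _ = _ := by ring

/-- The size of the dyadic pieces. -/
noncomputable def pieceBound (n : ℕ) (β t B : ℝ) (r : ℕ) : ℝ :=
  B * decayConst n β * ratio β r ^ 2 * ((2 ^ r * t) ^ n)⁻¹

lemma pieceBound_nonneg (ht : 0 < t) (hB : 0 ≤ B) (r : ℕ) : 0 ≤ pieceBound n β t B r := by
  have := decayConst_pos n β
  unfold pieceBound; positivity

lemma mul_decay_le (hβ : 0 < β) (ht : 0 < t) (hB : 0 ≤ B) {r : ℕ} {y : Rn n}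
    (h : psi t r ‖x - y‖ ≠ 0) :
    B * decay n (n + 2 * β) t ‖x - y‖ ≤ pieceBound n β t B r := by
  have h1 : r = 0 ∨ 2 ^ r * t / 2 ≤ ‖x - y‖ := by
    by_contra hc
    exact h (psi_eq_zero_of_ge ht r hc)
  have h2 := decay_le_dyadic n hβ ht (norm_nonneg (x - y)) r h1
  calc _ ≤ B * (decayConst n β * (((2 : ℝ) ^ (-β)) ^ r) ^ 2 * ((2 ^ r * t) ^ n)⁻¹) := by gcongr
    _ = _ := by rw [pieceBound, ratio]; ring

/-- The dyadic pieces of a kernel. -/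
noncomputable def piece (x : Rn n) (t : ℝ) (κ : Rn n → ℂ) (r : ℕ) (y : Rn n) : ℂ :=
  κ y * (psi t r ‖x - y‖ : ℂ)

lemma piece_eq_zero (ht : 0 < t) (r : ℕ) {y : Rn n}
    (hy : y ∉ Metric.closedBall x (2 * (2 ^ r * t))) : piece x t κ r y = 0 := by
  rw [Metric.mem_closedBall, dist_comm, dist_eq_norm, not_le] at hy
  rw [piece, psi_eq_zero_of_le ht r hy.le, Complex.ofReal_zero, mul_zero]

lemma norm_piece_le (hκ : IsKernel β x t B κ) (hβ : 0 < β) (ht : 0 < t) (hB : 0 ≤ B) (r : ℕ)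
    (y : Rn n) : ‖piece x t κ r y‖ ≤ pieceBound n β t B r := by
  by_cases h : psi t r ‖x - y‖ = 0
  · rw [piece, h, Complex.ofReal_zero, mul_zero, norm_zero]
    exact pieceBound_nonneg ht hB r
  · rw [piece, norm_mul, Complex.norm_real, Real.norm_eq_abs]
    calc _ ≤ ‖κ y‖ * 1 := by gcongr; exact abs_psi_le_one _ _ _
      _ ≤ _ := by rw [mul_one]; exact (hκ.le y).trans (mul_decay_le hβ ht hB h)

/-- The product rule, with κ evaluated at the point y where the cutoff is active. When the cutoff
also acts at y', both decay factors have the size of the annulus; otherwise the second term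
vanishes. -/
lemma norm_piece_sub_le_aux (hκ : IsKernel β x t B κ) (hβ : 0 < β) (hβ1 : β ≤ 1) (ht : 0 < t)
    (hB : 0 ≤ B) (r : ℕ) {y : Rn n} (h : psi t r ‖x - y‖ ≠ 0) (y' : Rn n) :
    ‖piece x t κ r y - piece x t κ r y'‖ ≤ pieceBound n β t B r *
      (3 * (‖y - y'‖ / (2 ^ r * t)) ^ β + 2 * (‖y - y'‖ / t) ^ β) := by
  have hP := pieceBound_nonneg (n := n) (β := β) ht hB r
  have h1 := (hκ.le y).trans (mul_decay_le hβ ht hB h)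
  have e : piece x t κ r y - piece x t κ r y' =
      κ y * ((psi t r ‖x - y‖ - psi t r ‖x - y'‖ : ℝ) : ℂ)
        + (κ y - κ y') * (psi t r ‖x - y'‖ : ℂ) := by
    rw [piece, piece]; push_cast; ring
  rw [e, mul_add]
  refine (norm_add_le _ _).trans (add_le_add ?_ ?_)
  · rw [norm_mul, Complex.norm_real, Real.norm_eq_abs]
    gcongr
    exact abs_psi_sub_le ht hβ hβ1 r (abs_norm_sub_sub_le x y y')
  · by_cases h' : psi t r ‖x - y'‖ = 0
    · rw [h', Complex.ofReal_zero, mul_zero, norm_zero]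
      positivity
    · have h2 := mul_decay_le hβ ht hB h
      have h3 := mul_decay_le hβ ht hB h'
      rw [norm_mul, Complex.norm_real, Real.norm_eq_abs]
      calc _ ≤ ‖κ y - κ y'‖ * 1 := by gcongr; exact abs_psi_le_one _ _ _
        _ ≤ (‖y - y'‖ / t) ^ β * (B * decay n (n + 2 * β) t ‖x - y‖
              + B * decay n (n + 2 * β) t ‖x - y'‖) := by
            rw [mul_one]; exact (hκ.sub_le y y').trans_eq (by ring)
        _ ≤ (‖y - y'‖ / t) ^ β * (pieceBound n β t B r + pieceBound n β t B r) := by gcongr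
        _ = _ := by ring

/-- Hölder quotients of κ are measured at scale t; rescaling to 2^r t costs 2^{βr}, one of the two
available decay factors. The constant is 5 = 3 + 2. -/
lemma norm_piece_sub_le (hκ : IsKernel β x t B κ) (hβ : 0 < β) (hβ1 : β ≤ 1) (ht : 0 < t)
    (hB : 0 ≤ B) (r : ℕ) (y y' : Rn n) :
    ‖piece x t κ r y - piece x t κ r y'‖ ≤ B * decayConst n β * 5 * ratio β r *
      ((2 ^ r * t) ^ n)⁻¹ * (‖y - y'‖ / (2 ^ r * t)) ^ β := by
  have hc := decayConst_pos n β
  have he := ratio_pos β r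
  have he1 := ratio_le_one hβ r
  have key : pieceBound n β t B r *
      (3 * (‖y - y'‖ / (2 ^ r * t)) ^ β + 2 * (‖y - y'‖ / t) ^ β) ≤ B * decayConst n β * 5 *
        ratio β r * ((2 ^ r * t) ^ n)⁻¹ * (‖y - y'‖ / (2 ^ r * t)) ^ β := by
    have h1 := ratio_mul_rpow (β := β) r ht (norm_nonneg (y - y'))
    set b := (‖y - y'‖ / (2 ^ r * t)) ^ β with hb
    have hb0 : 0 ≤ b := by positivity
    calc _ = B * decayConst n β * ratio β r * ((2 ^ r * t) ^ n)⁻¹ *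
          (3 * (ratio β r * b) + 2 * (ratio β r * (‖y - y'‖ / t) ^ β)) := by
          rw [pieceBound]; ring
      _ ≤ B * decayConst n β * ratio β r * ((2 ^ r * t) ^ n)⁻¹ * (3 * (1 * b) + 2 * b) := by
          rw [h1]; gcongr
      _ = _ := by ring
  by_cases h : psi t r ‖x - y‖ = 0
  · by_cases h' : psi t r ‖x - y'‖ = 0
    · simp only [piece, h, h', Complex.ofReal_zero, mul_zero, sub_zero, norm_zero]
      positivity
    · have := norm_piece_sub_le_aux hκ hβ hβ1 ht hB r h' y
      rw [norm_sub_rev, norm_sub_rev y'] at this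
      exact this.trans key
  · exact (norm_piece_sub_le_aux hκ hβ hβ1 ht hB r h y').trans key

lemma continuous_piece (hκ : Continuous κ) (r : ℕ) : Continuous (piece x t κ r) :=
  hκ.mul (Complex.continuous_ofReal.comp ((continuous_psi t r).comp (by fun_prop)))

lemma hasCompactSupport_piece (ht : 0 < t) (r : ℕ) : HasCompactSupport (piece x t κ r) :=
  HasCompactSupport.intro (isCompact_closedBall x (2 * (2 ^ r * t))) fun _ hy =>
    piece_eq_zero ht r hy

lemma norm_integral_piece_le (hκ : IsKernel β x t B κ) (hβ : 0 < β) (ht : 0 < t)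
    (hB : 0 ≤ B) (r : ℕ) :
    ‖∫ y, piece x t κ r y‖ ≤ B * decayConst n β * ratio β r ^ 2 * (2 ^ n * ballVol n) := by
  have hr : 0 < 2 ^ r * t := by positivity
  rw [← setIntegral_eq_integral_of_forall_compl_eq_zero
    (s := Metric.closedBall x (2 * (2 ^ r * t))) fun y hy => piece_eq_zero ht r hy]
  refine (norm_setIntegral_le_of_norm_le_const (C := pieceBound n β t B r)
    measure_closedBall_lt_top fun y _ => hκ.norm_piece_le hβ ht hB r y).trans_eq ?_
  rw [volume_real_closedBall x (by positivity), pieceBound, mul_pow 2]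
  field_simp

/-- Subtracting the mean times a normalized bump of the same scale makes the piece integrate to zero
without spoiling its size or regularity. -/
lemma enorm_integral_piece_mul_le (hκ : IsKernel β x t B κ) (hβ : 0 < β) (hβ1 : β ≤ 1)
    (ht : 0 < t) (hB : 0 ≤ B) {k : ℤ} (h16 : 16 * t ≤ 2 ^ k) (h32 : 2 ^ k ≤ 32 * t) (r : ℕ)
    (f : Rn n → ℂ) :
    ‖∫ y, (piece x t κ r y - (∫ z, piece x t κ r z) * (bump x (2 ^ r * t) y : ℂ)) * f y‖ₑ ≤
      ENNReal.ofReal (32 ^ (n + 1) * (B * decayConst n β * (5 + 2 ^ n) * ratio β r)) *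
        cfSum β f (k + r) x := by
  have hv := ballVol_pos n
  have hc := decayConst_pos n β
  have he := ratio_pos β r
  have he1 := ratio_le_one hβ r
  have he2 : ratio β r ^ 2 ≤ ratio β r := by nlinarith
  have hr : 0 < 2 ^ r * t := by positivity
  have hcont := hκ.continuous hβ ht hB
  have hμ := hκ.norm_integral_piece_le hβ ht hB r
  have h2 : (2 : ℝ) ^ (k + (r : ℤ)) = 2 ^ k * 2 ^ r := by
    rw [zpow_add₀ (by norm_num), zpow_natCast]
  refine enorm_integral_le_cfSum hβ hβ1 hr (by rw [h2]; nlinarith [pow_pos (two_pos (α := ℝ)) r])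
    (by rw [h2]; nlinarith [pow_pos (two_pos (α := ℝ)) r]) (by positivity) ?_ ?_ ?_ ?_ f
  · intro y hy
    rw [piece_eq_zero ht r hy, bump_eq_zero hr hy, Complex.ofReal_zero, mul_zero, sub_zero]
  · have h3 : Integrable fun y => (∫ z, piece x t κ r z) * (bump x (2 ^ r * t) y : ℂ) :=
      (integrable_bump x hr).ofReal.const_mul _
    rw [integral_sub ((continuous_piece hcont r).integrable_of_hasCompactSupport
      (hasCompactSupport_piece ht r)) h3,
      integral_const_mul, integral_complex_ofReal, integral_bump x hr, Complex.ofReal_one, mul_one,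
      sub_self]
  · intro y
    refine (norm_sub_le _ _).trans ?_
    rw [norm_mul, Complex.norm_real, Real.norm_of_nonneg (bump_nonneg x hr y)]
    calc _ ≤ pieceBound n β t B r + B * decayConst n β * ratio β r ^ 2 * (2 ^ n * ballVol n) *
          ((ballVol n)⁻¹ * ((2 ^ r * t) ^ n)⁻¹) := by
          gcongr
          · exact hκ.norm_piece_le hβ ht hB r y
          · exact bump_nonneg x hr y
          · exact bump_le x hr y
      _ = B * decayConst n β * (1 + 2 ^ n) * ratio β r ^ 2 * ((2 ^ r * t) ^ n)⁻¹ := by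
          rw [pieceBound]; field_simp
      _ ≤ _ := by
          gcongr
          norm_num
  · intro y y'
    rw [sub_sub_sub_comm, ← mul_sub, ← Complex.ofReal_sub]
    refine (norm_sub_le _ _).trans ?_
    rw [norm_mul, Complex.norm_real, Real.norm_eq_abs]
    calc _ ≤ B * decayConst n β * 5 * ratio β r *
          ((2 ^ r * t) ^ n)⁻¹ * (‖y - y'‖ / (2 ^ r * t)) ^ β +
          B * decayConst n β * ratio β r * (2 ^ n * ballVol n) *
          ((ballVol n)⁻¹ * ((2 ^ r * t) ^ n)⁻¹ * (‖y - y'‖ / (2 ^ r * t)) ^ β) := by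
          gcongr
          · exact hκ.norm_piece_sub_le hβ hβ1 ht hB r y y'
          · exact hμ.trans (by gcongr)
          · exact abs_bump_sub_le x hr hβ hβ1 y y'
      _ = _ := by field_simp

end IsKernel

/-- For s < r the ratio at r is at most the ratio at s + 1, so one of the two factors can be moved
into the sum as a geometric weight, leaving one to sum over r. -/
lemma ofReal_ratio_sq_mul_sum_le {β : ℝ} (hβ : 0 < β) (X : ℕ → ℝ≥0∞) (r : ℕ) :
    ENNReal.ofReal (ratio β r ^ 2) * ∑ s ∈ Finset.range r, X (s + 1) ≤
      ENNReal.ofReal (ratio β r) * ∑' s : ℕ, ENNReal.ofReal (ratio β s) * X s := by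
  rw [sq, ENNReal.ofReal_mul (ratio_pos β r).le, mul_assoc, Finset.mul_sum]
  gcongr
  calc _ ≤ ∑ s ∈ Finset.range r, ENNReal.ofReal (ratio β (s + 1)) * X (s + 1) := by
        refine Finset.sum_le_sum fun s hs => ?_
        gcongr
        exact ratio_anti hβ (Finset.mem_range.1 hs)
    _ ≤ ∑' s : ℕ, ENNReal.ofReal (ratio β (s + 1)) * X (s + 1) := ENNReal.sum_le_tsum _
    _ ≤ _ := ENNReal.tsum_comp_le_tsum_of_injective (add_left_injective 1)
          (fun s => ENNReal.ofReal (ratio β s) * X s)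

/-- The constant in `IsKernel.enorm_integral_le`. -/
noncomputable def kernelConst (n : ℕ) (β : ℝ) : ℝ≥0∞ :=
  ENNReal.ofReal (32 ^ (n + 1) * (decayConst n β * (5 + 2 ^ n)) +
    decayConst n β * (2 ^ n * ballVol n) * (32 ^ (n + 1) * ((1 + 2 ^ (n + 1)) * (ballVol n)⁻¹))) *
    (1 + ∑' r : ℕ, ENNReal.ofReal (ratio β r))

lemma kernelConst_ne_top (n : ℕ) {β : ℝ} (hβ : 0 < β) : kernelConst n β ≠ ∞ :=
  ENNReal.mul_ne_top ENNReal.ofReal_ne_top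
    (ENNReal.add_ne_top.2 ⟨ENNReal.one_ne_top, tsum_ratio_ne_top hβ⟩)

lemma enorm_bump_sub_bump_le {β : ℝ} (hβ : 0 < β) (hβ1 : β ≤ 1) {t : ℝ} (ht : 0 < t) {k : ℤ}
    (h16 : 16 * t ≤ 2 ^ k) (h32 : 2 ^ k ≤ 32 * t) (x : Rn n) {f : Rn n → ℂ}
    (hf : LocallyIntegrable f) (r : ℕ) :
    ‖(∫ y, (bump x (2 ^ r * t) y : ℂ) * f y) - ∫ y, (bump x t y : ℂ) * f y‖ₑ
      ≤ ENNReal.ofReal (32 ^ (n + 1) * ((1 + 2 ^ (n + 1)) * (ballVol n)⁻¹)) *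
        ∑ s ∈ Finset.range r, cfSum β f (k + (s + 1 : ℕ)) x := by
  induction r with
  | zero => simp
  | succ r ih =>
    rw [Finset.sum_range_succ, mul_add, ← sub_add_sub_cancel _
      (∫ y, (bump x (2 ^ r * t) y : ℂ) * f y), add_comm]
    exact (enorm_add_le _ _).trans (add_le_add ih (enorm_bump_sub_le hβ hβ1 ht h16 h32 x hf r))

lemma integrable_bump_mul (x : Rn n) {ρ : ℝ} (hρ : 0 < ρ) {f : Rn n → ℂ}
    (hf : LocallyIntegrable f) : Integrable fun y => (bump x ρ y : ℂ) * f y :=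
  hf.integrable_smul_left_of_hasCompactSupport (𝕜 := ℂ)
    (Complex.continuous_ofReal.comp (continuous_bump x ρ))
    (HasCompactSupport.intro (isCompact_closedBall x (2 * ρ)) fun y hy => by
      simp [bump_eq_zero hρ hy])

namespace IsKernel

variable {β : ℝ} {x : Rn n} {t B : ℝ} {κ : Rn n → ℂ}

lemma integrable_piece_mul (hκ : Continuous κ) (ht : 0 < t) (r : ℕ) {f : Rn n → ℂ}
    (hf : LocallyIntegrable f) : Integrable fun y => piece x t κ r y * f y :=
  hf.integrable_smul_left_of_hasCompactSupport (𝕜 := ℂ) (continuous_piece hκ r)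
    (hasCompactSupport_piece ht r)

/-- The piece is its mean-zero part plus its mean times a bump at scale 2^r t. The first part is an
atom; on the second, f minus its average at scale t becomes a difference of averages, telescoped
over r scales. -/
lemma enorm_integral_piece_mul_sub_le (hκ : IsKernel β x t B κ) (hβ : 0 < β) (hβ1 : β ≤ 1)
    (ht : 0 < t) (hB : 0 ≤ B) {k : ℤ} (h16 : 16 * t ≤ 2 ^ k) (h32 : 2 ^ k ≤ 32 * t) (r : ℕ)
    {f : Rn n → ℂ} (hf : LocallyIntegrable f) :
    ‖∫ y, piece x t κ r y * (f y - ∫ z, (bump x t z : ℂ) * f z)‖ₑ ≤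
      ENNReal.ofReal (32 ^ (n + 1) * (decayConst n β * (5 + 2 ^ n)) +
        decayConst n β * (2 ^ n * ballVol n) *
          (32 ^ (n + 1) * ((1 + 2 ^ (n + 1)) * (ballVol n)⁻¹))) * ENNReal.ofReal B *
      (ENNReal.ofReal (ratio β r) * cfSum β f (k + r) x + ENNReal.ofReal (ratio β r) *
        ∑' s : ℕ, ENNReal.ofReal (ratio β s) * cfSum β f (k + s) x) := by
  have hv := ballVol_pos n
  have hc := decayConst_pos n β
  have he := ratio_pos β r
  have hr : 0 < 2 ^ r * t := by positivity
  have hcont := hκ.continuous hβ ht hB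
  set a := ∫ z, (bump x t z : ℂ) * f z with ha
  set μ := ∫ z, piece x t κ r z with hμ
  have e : ∫ y, piece x t κ r y * (f y - a) =
      (∫ y, (piece x t κ r y - μ * (bump x (2 ^ r * t) y : ℂ)) * f y) +
        μ * ((∫ y, (bump x (2 ^ r * t) y : ℂ) * f y) - a) := by
    simp_rw [mul_sub, sub_mul, mul_assoc]
    rw [integral_sub (integrable_piece_mul hcont ht r hf)
      (((continuous_piece hcont r).integrable_of_hasCompactSupport
        (hasCompactSupport_piece ht r)).mul_const a),
      integral_sub (integrable_piece_mul hcont ht r hf)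
        ((integrable_bump_mul x hr hf).const_mul _), integral_mul_const, integral_const_mul]
    ring
  set K₁ := 32 ^ (n + 1) * (decayConst n β * (5 + 2 ^ n))
  set K₃ := 32 ^ (n + 1) * ((1 + 2 ^ (n + 1)) * (ballVol n)⁻¹)
  set K₂ := decayConst n β * (2 ^ n * ballVol n) * K₃
  have hK₁ : 0 ≤ K₁ := by positivity
  have hK₃ : 0 ≤ K₃ := by positivity
  have hK₂ : 0 ≤ K₂ := by positivity
  rw [e]
  refine (enorm_add_le _ _).trans ?_
  rw [mul_add]
  refine add_le_add ?_ ?_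
  · refine (hκ.enorm_integral_piece_mul_le hβ hβ1 ht hB h16 h32 r f).trans ?_
    calc _ = ENNReal.ofReal K₁ * ENNReal.ofReal B *
          (ENNReal.ofReal (ratio β r) * cfSum β f (k + r) x) := by
          rw [← mul_assoc (_ * _), ← ENNReal.ofReal_mul hK₁, ← ENNReal.ofReal_mul (by positivity)]
          congr 2
          simp only [K₁]
          ring
      _ ≤ _ := by gcongr; linarith
  · rw [enorm_mul]
    have h1 : ‖μ‖ₑ ≤ ENNReal.ofReal (decayConst n β * (2 ^ n * ballVol n) * B * ratio β r ^ 2) := by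
      rw [← ofReal_norm]
      exact ENNReal.ofReal_le_ofReal
        ((hκ.norm_integral_piece_le hβ ht hB r).trans_eq (by ring))
    have h2 := enorm_bump_sub_bump_le hβ hβ1 ht h16 h32 x hf r
    calc _ ≤ ENNReal.ofReal (decayConst n β * (2 ^ n * ballVol n) * B * ratio β r ^ 2) *
          (ENNReal.ofReal K₃ * ∑ s ∈ Finset.range r, cfSum β f (k + (s + 1 : ℕ)) x) := by
          gcongr
      _ = ENNReal.ofReal K₂ * ENNReal.ofReal B * (ENNReal.ofReal (ratio β r ^ 2) *
            ∑ s ∈ Finset.range r, cfSum β f (k + (s + 1 : ℕ)) x) := by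
          rw [← mul_assoc (ENNReal.ofReal _) (ENNReal.ofReal _), ← mul_assoc (_ * _),
            ← ENNReal.ofReal_mul (by positivity), ← ENNReal.ofReal_mul hK₂,
            ← ENNReal.ofReal_mul (by positivity)]
          congr 2
          simp only [K₂]
          ring
      _ ≤ _ := by
          refine mul_le_mul' ?_ (ofReal_ratio_sq_mul_sum_le hβ (fun s => cfSum β f (k + s) x) r)
          gcongr
          linarith

/-- A kernel applied to a function minus its average is controlled by the dyadic coefficients. -/
lemma enorm_integral_le (hκ : IsKernel β x t B κ) (hβ : 0 < β) (hβ1 : β ≤ 1)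
    (ht : 0 < t) (hB : 0 ≤ B) {k : ℤ} (h16 : 16 * t ≤ 2 ^ k) (h32 : 2 ^ k ≤ 32 * t)
    {f : Rn n → ℂ} (hf : LocallyIntegrable f)
    (hfi : Integrable fun y => decay n (n + 2 * β) t ‖x - y‖ * ‖f y‖) :
    ‖∫ y, κ y * (f y - ∫ z, (bump x t z : ℂ) * f z)‖ₑ ≤
      kernelConst n β * ENNReal.ofReal B *
        ∑' s : ℕ, ENNReal.ofReal (ratio β s) * cfSum β f (k + s) x := by
  have hcont := hκ.continuous hβ ht hB
  set a := ∫ z, (bump x t z : ℂ) * f z with ha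
  set T := ∑' s : ℕ, ENNReal.ofReal (ratio β s) * cfSum β f (k + s) x with hT
  -- The first R + 1 annular cutoffs add up to a single cutoff at radius 2^R t, which tends to one;
  -- dominated convergence justifies the infinite decomposition.
  have hlim : Filter.Tendsto
      (fun R : ℕ => ∫ y, κ y * (eta (2 ^ R * t) ‖x - y‖ : ℂ) * (f y - a)) Filter.atTop
      (nhds (∫ y, κ y * (f y - a))) := by
    refine tendsto_integral_of_dominated_convergence
      (fun y => B * (decay n (n + 2 * β) t ‖x - y‖ * ‖f y‖)
        + B * (decay n (n + 2 * β) t ‖x - y‖ * ‖a‖)) (fun R => ?_)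
      ((hfi.const_mul B).add (((integrable_decay hβ ht x).mul_const _).const_mul B))
      (fun R => Filter.Eventually.of_forall fun y => ?_)
      (Filter.Eventually.of_forall fun y => ?_)
    · exact (hcont.mul (Complex.continuous_ofReal.comp
        (continuous_eta_norm x _))).aestronglyMeasurable.mul
        (hf.aestronglyMeasurable.sub aestronglyMeasurable_const)
    · rw [norm_mul, norm_mul, Complex.norm_real, Real.norm_of_nonneg (eta_nonneg _ _)]
      have hd := decay_nonneg n (M := n + 2 * β) ht (norm_nonneg (x - y))
      calc _ ≤ B * decay n (n + 2 * β) t ‖x - y‖ * 1 * (‖f y‖ + ‖a‖) := by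
            gcongr
            · exact eta_nonneg _ _
            · exact hκ.le y
            · exact eta_le_one _ _
            · exact norm_sub_le _ _
        _ = _ := by ring
    · refine tendsto_const_nhds.congr' ?_
      obtain ⟨R₀, hR₀⟩ := pow_unbounded_of_one_lt (‖x - y‖ / t) (by norm_num : (1 : ℝ) < 2)
      filter_upwards [Filter.eventually_ge_atTop R₀] with R hR
      rw [eta_eq_one (by positivity), Complex.ofReal_one, mul_one]
      rw [div_lt_iff₀ ht] at hR₀
      exact hR₀.le.trans (by gcongr; norm_num)
  refine le_of_tendsto (hlim.enorm) (Filter.Eventually.of_forall fun R => ?_)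
  have e : ∫ y, κ y * (eta (2 ^ R * t) ‖x - y‖ : ℂ) * (f y - a) =
      ∑ r ∈ Finset.range (R + 1), ∫ y, piece x t κ r y * (f y - a) := by
    rw [← integral_finsetSum]
    · congr 1 with y
      rw [← sum_psi, ← Finset.sum_mul, Complex.ofReal_sum, Finset.mul_sum]
      rfl
    · intro r _
      simp_rw [mul_sub]
      exact (integrable_piece_mul hcont ht r hf).sub
        (((continuous_piece hcont r).integrable_of_hasCompactSupport
          (hasCompactSupport_piece ht r)).mul_const a)
  rw [e]
  refine (enorm_sum_le _ _).trans ((Finset.sum_le_sum fun r _ =>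
    hκ.enorm_integral_piece_mul_sub_le hβ hβ1 ht hB h16 h32 r hf).trans ?_)
  rw [← Finset.mul_sum, Finset.sum_add_distrib, ← Finset.sum_mul]
  calc _ ≤ _ * (T + (∑' r : ℕ, ENNReal.ofReal (ratio β r)) * T) := by
        gcongr
        · exact ENNReal.sum_le_tsum _
        · exact ENNReal.sum_le_tsum _
    _ = _ := by rw [kernelConst]; ring

end IsKernel

/-! ### Multilinear kernels with cancellation -/

lemma prod_sub_prod_eq_sum {m : ℕ} (b a : Fin (m + 1) → ℂ) :
    ∏ i, b i - ∏ i, a i =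
      ∑ j, ∏ i, if i < j then a i else if i = j then b i - a i else b i := by
  -- The telescoping product: the first k factors have been replaced by a.
  set Q : ℕ → ℂ := fun k => ∏ i : Fin (m + 1), if (i : ℕ) < k then a i else b i with hQ
  have h1 : ∏ i, b i - ∏ i, a i = ∑ k ∈ Finset.range (m + 1), (Q k - Q (k + 1)) := by
    rw [Finset.sum_range_sub', hQ]
    congr 1
    exact Finset.prod_congr rfl fun i _ => (if_pos i.2).symm
  rw [h1, Finset.sum_range]
  refine Finset.sum_congr rfl fun j _ => ?_
  simp only [hQ]
  rw [Fin.prod_univ_succAbove _ j, Fin.prod_univ_succAbove _ j, Fin.prod_univ_succAbove _ j]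
  have h2 : ∀ i, (if ((j.succAbove i : Fin (m + 1)) : ℕ) < j + 1 then a (j.succAbove i)
      else b (j.succAbove i)) = if ((j.succAbove i : Fin (m + 1)) : ℕ) < j then a (j.succAbove i)
      else b (j.succAbove i) := by
    intro i
    have : ((j.succAbove i : Fin (m + 1)) : ℕ) ≠ j := fun h => Fin.succAbove_ne j i (Fin.ext h)
    refine if_congr ?_ rfl rfl
    lia
  simp only [h2, lt_irrefl, if_true, if_false, Nat.lt_succ_self, Fin.succAbove_ne, Fin.lt_def]
  ring

variable {m : ℕ}

/-- Bounds for a multilinear kernel centred at `x` with scale `t`. -/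
structure IsMultiKernel (β : ℝ) (x : Rn n) (t A : ℝ) (K : (Fin (m + 1) → Rn n) → ℂ) : Prop where
  le : ∀ y, ‖K y‖ ≤ A * ∏ i, decay n (n + 2 * β) t ‖x - y i‖
  sub_le : ∀ y j y', ‖K y - K (Function.update y j y')‖ ≤ A * ((‖y j - y'‖ / t) ^ β *
    (decay n (n + 2 * β) t ‖x - y j‖ + decay n (n + 2 * β) t ‖x - y'‖) *
    ∏ i, decay n (n + 2 * β) t ‖x - y (j.succAbove i)‖)

namespace IsMultiKernel

variable {β : ℝ} {x : Rn n} {t A : ℝ} {K : (Fin (m + 1) → Rn n) → ℂ}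

lemma continuous (hK : IsMultiKernel β x t A K) (hβ : 0 < β) (ht : 0 < t) (hA : 0 ≤ A) :
    Continuous K := by
  set L : ℝ := A * (2 * (t ^ n)⁻¹ * ((t ^ n)⁻¹) ^ m) with hL
  have h1 : ∀ y j y', ‖K y - K (Function.update y j y')‖ ≤ L * (‖y j - y'‖ / t) ^ β := by
    intro y j y'
    have hd : ∀ z : Rn n, decay n (n + 2 * β) t ‖x - z‖ ≤ (t ^ n)⁻¹ := fun z =>
      decay_le n ht (norm_nonneg _) (by positivity)
    have hd0 : ∀ z : Rn n, 0 ≤ decay n (n + 2 * β) t ‖x - z‖ := fun z =>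
      decay_nonneg n ht (norm_nonneg _)
    calc _ ≤ A * ((‖y j - y'‖ / t) ^ β * ((t ^ n)⁻¹ + (t ^ n)⁻¹) * ∏ _i : Fin m, (t ^ n)⁻¹) := by
          refine (hK.sub_le y j y').trans ?_
          gcongr
          · exact Finset.prod_nonneg fun i _ => hd0 _
          · exact hd _
          · exact hd _
          · exact fun i _ => hd0 _
          · exact hd _
      _ = _ := by rw [Finset.prod_const, Finset.card_univ, Fintype.card_fin, hL]; ring
  have h2 : ∀ (y y' : Fin (m + 1) → Rn n) (s : Finset (Fin (m + 1))),
      ‖K (s.piecewise y' y) - K y‖ ≤ ∑ i ∈ s, L * (‖y i - y' i‖ / t) ^ β := by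
    intro y y' s
    induction s using Finset.induction_on with
    | empty => simp
    | insert j s hj ih =>
      rw [Finset.piecewise_insert, Finset.sum_insert hj, ← sub_add_sub_cancel _
        (K (s.piecewise y' y))]
      refine (norm_add_le _ _).trans (add_le_add ?_ ih)
      rw [norm_sub_rev]
      refine (h1 _ j _).trans_eq ?_
      rw [Finset.piecewise_eq_of_notMem _ _ _ hj]
  rw [continuous_iff_continuousAt]
  intro y
  refine tendsto_iff_norm_sub_tendsto_zero.2 (squeeze_zero (fun _ => norm_nonneg _)
    (g := fun y' => ∑ i, L * (‖y i - y' i‖ / t) ^ β) (fun y' => ?_) ?_)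
  · simpa using h2 y y' Finset.univ
  · have : Continuous fun y' : Fin (m + 1) → Rn n => ∑ i, L * (‖y i - y' i‖ / t) ^ β := by
      refine continuous_finsetSum _ fun i _ => continuous_const.mul
        (Continuous.rpow_const (by fun_prop) fun _ => Or.inr hβ.le)
    have h3 := this.tendsto y
    simpa [Real.zero_rpow hβ.ne'] using h3

lemma aestronglyMeasurable_prod {m : ℕ} {h : Fin m → Rn n → ℂ}
    (hm : ∀ i, AEStronglyMeasurable (h i) volume) :
    AEStronglyMeasurable (fun y : Fin m → Rn n => ∏ i, h i (y i)) volume :=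
  Finset.aestronglyMeasurable_fun_prod _ fun i _ =>
    (hm i).comp_quasiMeasurePreserving (Measure.quasiMeasurePreserving_eval _ i)

lemma integrable (hK : IsMultiKernel β x t A K) (hβ : 0 < β) (ht : 0 < t) (hA : 0 ≤ A)
    {h : Fin (m + 1) → Rn n → ℂ} (hm : ∀ i, AEStronglyMeasurable (h i) volume)
    (hi : ∀ i, Integrable fun y => decay n (n + 2 * β) t ‖x - y‖ * ‖h i y‖) :
    Integrable fun y : Fin (m + 1) → Rn n => K y * ∏ i, h i (y i) := by
  refine Integrable.mono' ((Integrable.fintype_prod hi).const_mul A)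
    ((hK.continuous hβ ht hA).aestronglyMeasurable.mul (aestronglyMeasurable_prod hm))
    (Filter.Eventually.of_forall fun y => ?_)
  rw [norm_mul, norm_prod, Finset.prod_mul_distrib, ← mul_assoc]
  gcongr
  exact hK.le y

/-- The kernel in one variable obtained by integrating against functions of the others. -/
noncomputable def slice (K : (Fin (m + 1) → Rn n) → ℂ) (j : Fin (m + 1))
    (h : Fin (m + 1) → Rn n → ℂ) (z : Rn n) : ℂ :=
  ∫ y : Fin m → Rn n, K (j.insertNth z y) * ∏ i, h (j.succAbove i) (y i)

lemma integrable_slice (hK : IsMultiKernel β x t A K) (hβ : 0 < β) (ht : 0 < t) (hA : 0 ≤ A)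
    (j : Fin (m + 1)) {h : Fin (m + 1) → Rn n → ℂ}
    (hm : ∀ i, AEStronglyMeasurable (h i) volume)
    (hi : ∀ i, Integrable fun y => decay n (n + 2 * β) t ‖x - y‖ * ‖h i y‖) (z : Rn n) :
    Integrable fun y : Fin m → Rn n =>
      K (j.insertNth z y) * ∏ i, h (j.succAbove i) (y i) := by
  have hc : Continuous fun y : Fin m → Rn n => K (j.insertNth z y) :=
    (hK.continuous hβ ht hA).comp (Continuous.finInsertNth j continuous_const continuous_id)
  refine Integrable.mono' ((Integrable.fintype_prod fun i => hi (j.succAbove i)).const_mul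
    (A * decay n (n + 2 * β) t ‖x - z‖))
    (hc.aestronglyMeasurable.mul (aestronglyMeasurable_prod fun i => hm (j.succAbove i)))
    (Filter.Eventually.of_forall fun y => ?_)
  rw [norm_mul, norm_prod, Finset.prod_mul_distrib, ← mul_assoc]
  gcongr
  refine (hK.le _).trans_eq ?_
  simp only [Fin.prod_univ_succAbove _ j, Fin.insertNth_apply_same, Fin.insertNth_apply_succAbove]
  ring

/-- The multilinear bounds are products over the variables, so integrating out all but the j-th
leaves the one-variable bounds times a product of integrals, each later controlled by a maximal
function. -/
lemma isKernel_slice (hK : IsMultiKernel β x t A K) (hβ : 0 < β) (ht : 0 < t) (hA : 0 ≤ A)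
    (j : Fin (m + 1)) {h : Fin (m + 1) → Rn n → ℂ}
    (hm : ∀ i, AEStronglyMeasurable (h i) volume)
    (hi : ∀ i, Integrable fun y => decay n (n + 2 * β) t ‖x - y‖ * ‖h i y‖) :
    IsKernel β x t (A * ∏ i : Fin m, ∫ y, decay n (n + 2 * β) t ‖x - y‖ * ‖h (j.succAbove i) y‖)
      (slice K j h) where
  le z := by
    rw [← integral_fintype_prod_volume_eq_prod
      (fun (i : Fin m) y => decay n (n + 2 * β) t ‖x - y‖ * ‖h (j.succAbove i) y‖)]
    rw [mul_right_comm, ← integral_const_mul]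
    refine norm_integral_le_of_norm_le ((Integrable.fintype_prod fun i =>
      hi (j.succAbove i)).const_mul _) (Filter.Eventually.of_forall fun y => ?_)
    rw [norm_mul, norm_prod, Finset.prod_mul_distrib, ← mul_assoc]
    gcongr
    refine (hK.le _).trans_eq ?_
    simp only [Fin.prod_univ_succAbove _ j, Fin.insertNth_apply_same,
      Fin.insertNth_apply_succAbove]
    ring
  sub_le z z' := by
    rw [slice, slice, ← integral_sub (hK.integrable_slice hβ ht hA j hm hi z)
      (hK.integrable_slice hβ ht hA j hm hi z'), ← integral_fintype_prod_volume_eq_prod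
      (fun (i : Fin m) y => decay n (n + 2 * β) t ‖x - y‖ * ‖h (j.succAbove i) y‖)]
    rw [mul_right_comm, ← integral_const_mul]
    refine norm_integral_le_of_norm_le ((Integrable.fintype_prod fun i =>
      hi (j.succAbove i)).const_mul _) (Filter.Eventually.of_forall fun y => ?_)
    rw [← sub_mul, norm_mul, norm_prod, Finset.prod_mul_distrib, ← mul_assoc]
    gcongr
    have h1 := hK.sub_le (j.insertNth z y) j z'
    simp only [Fin.update_insertNth, Fin.insertNth_apply_same,
      Fin.insertNth_apply_succAbove] at h1
    exact h1.trans_eq (by ring)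

lemma integral_eq_integral_slice (hK : IsMultiKernel β x t A K) (hβ : 0 < β) (ht : 0 < t)
    (hA : 0 ≤ A) (j : Fin (m + 1)) {h : Fin (m + 1) → Rn n → ℂ}
    (hm : ∀ i, AEStronglyMeasurable (h i) volume)
    (hi : ∀ i, Integrable fun y => decay n (n + 2 * β) t ‖x - y‖ * ‖h i y‖) :
    ∫ y, K y * ∏ i, h i (y i) = ∫ z, slice K j h z * h j z := by
  have mp := (volume_preserving_piFinSuccAbove (fun _ : Fin (m + 1) => Rn n) j).symm
  rw [← mp.integral_comp', Measure.volume_eq_prod, integral_prod]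
  · congr 1 with z
    rw [slice, ← integral_mul_const]
    congr 1 with y
    have e : (MeasurableEquiv.piFinSuccAbove (fun _ => Rn n) j).symm (z, y) = j.insertNth z y := rfl
    rw [e, Fin.prod_univ_succAbove _ j]
    simp only [Fin.insertNth_apply_same, Fin.insertNth_apply_succAbove]
    ring
  · exact (mp.integrable_comp_emb (MeasurableEquiv.measurableEmbedding _)).2
      (hK.integrable hβ ht hA hm hi)

end IsMultiKernel

lemma ofReal_integral_decay_mul_le {β : ℝ} (hβ : 0 < β) {t : ℝ} (ht : 0 < t) (x : Rn n)
    {h : Rn n → ℂ} (hm : AEStronglyMeasurable h volume)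
    (hi : Integrable fun y => decay n (n + 2 * β) t ‖x - y‖ * ‖h y‖) :
    ENNReal.ofReal (∫ y, decay n (n + 2 * β) t ‖x - y‖ * ‖h y‖) ≤
      maxConst n β * maxSum (fun y => ‖h y‖ₑ) x := by
  have hd : ∀ y : Rn n, 0 ≤ decay n (n + 2 * β) t ‖x - y‖ := fun y =>
    decay_nonneg n ht (norm_nonneg _)
  rw [ofReal_integral_eq_lintegral_ofReal hi
    (Filter.Eventually.of_forall fun y => mul_nonneg (hd y) (norm_nonneg _))]
  refine le_trans (lintegral_mono fun y => ?_) (lintegral_decay_mul_le hβ ht x hm.enorm)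
  rw [ENNReal.ofReal_mul (hd y), ofReal_norm]

/-- The constant for averages in `ofReal_integral_decay_const_le`. -/
noncomputable def factorConst (n : ℕ) (β : ℝ) : ℝ≥0∞ :=
  maxConst n β * (1 + 2 ^ n * ENNReal.ofReal ((ballVol n)⁻¹ * 32 ^ n))

lemma factorConst_ne_top (n : ℕ) {β : ℝ} (hβ : 0 < β) : factorConst n β ≠ ∞ :=
  ENNReal.mul_ne_top (maxConst_ne_top n hβ) (ENNReal.add_ne_top.2 ⟨ENNReal.one_ne_top,
    ENNReal.mul_ne_top (by simp) ENNReal.ofReal_ne_top⟩)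

lemma ofReal_integral_decay_const_le {β : ℝ} (hβ : 0 < β) {t : ℝ} (ht : 0 < t) (x : Rn n)
    (f : Rn n → ℂ) :
    ENNReal.ofReal (∫ y, decay n (n + 2 * β) t ‖x - y‖ * ‖∫ z, (bump x t z : ℂ) * f z‖) ≤
      factorConst n β * maxSum (fun y => ‖f y‖ₑ) x := by
  have h1 := ofReal_integral_decay_mul_le hβ ht x (h := fun _ => (1 : ℂ))
    aestronglyMeasurable_const (by simpa using integrable_decay hβ ht x)
  simp only [norm_one, mul_one, enorm_one] at h1
  rw [integral_mul_const, ENNReal.ofReal_mul (integral_nonneg fun y =>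
    decay_nonneg n ht (norm_nonneg _)), ofReal_norm]
  calc _ ≤ maxConst n β * 2 ^ n *
        (ENNReal.ofReal ((ballVol n)⁻¹ * 32 ^ n) * maxSum (fun y => ‖f y‖ₑ) x) := by
        gcongr
        · exact h1.trans (by gcongr; exact maxSum_one_le x)
        · exact enorm_bump_average_le x ht f
    _ = maxConst n β * (2 ^ n * ENNReal.ofReal ((ballVol n)⁻¹ * 32 ^ n)) *
          maxSum (fun y => ‖f y‖ₑ) x := by ring
    _ ≤ _ := by
        rw [factorConst]
        gcongr
        exact le_add_self

/-- The geometrically weighted sums of the dyadic coefficients over the scales above `k`. -/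
noncomputable def cfTail (β : ℝ) (f : Rn n → ℂ) (k : ℤ) (x : Rn n) : ℝ≥0∞ :=
  ∑' s : ℕ, ENNReal.ofReal (ratio β s) * cfSum β f (k + s) x

/-- Multilinear kernels with cancellation are controlled by maximal functions and dyadic
coefficients. -/
lemma IsMultiKernel.enorm_integral_le {β : ℝ} {x : Rn n} {t A : ℝ}
    {K : (Fin (m + 1) → Rn n) → ℂ} (hK : IsMultiKernel β x t A K) (hβ : 0 < β) (hβ1 : β ≤ 1)
    (ht : 0 < t) (hA : 0 ≤ A) {k : ℤ} (h16 : 16 * t ≤ 2 ^ k) (h32 : 2 ^ k ≤ 32 * t)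
    (h0 : ∫ y, K y = 0) {f : Fin (m + 1) → Rn n → ℂ} (hf : ∀ i, LocallyIntegrable (f i))
    (hfi : ∀ i, Integrable fun y => decay n (n + 2 * β) t ‖x - y‖ * ‖f i y‖) :
    ‖∫ y, K y * ∏ i, f i (y i)‖ₑ ≤ ∑ j, kernelConst n β * (ENNReal.ofReal A *
      ∏ i, (factorConst n β * maxSum (fun y => ‖f (j.succAbove i) y‖ₑ) x)) *
      cfTail β (f j) k x := by
  set a : Fin (m + 1) → ℂ := fun i => ∫ z, (bump x t z : ℂ) * f i z with ha
  -- The hybrid tuples of the telescoping: averages before j, oscillation at j, original functions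
  -- after j.
  set h : Fin (m + 1) → Fin (m + 1) → Rn n → ℂ := fun j i y =>
    if i < j then a i else if i = j then f i y - a i else f i y with hh
  have hconst : ∀ c : ℂ, Integrable fun y : Rn n => decay n (n + 2 * β) t ‖x - y‖ * ‖c‖ :=
    fun c => (integrable_decay hβ ht x).mul_const _
  have hfm : ∀ i, AEStronglyMeasurable (f i) volume := fun i => (hf i).aestronglyMeasurable
  have hm : ∀ j i, AEStronglyMeasurable (h j i) volume := by
    intro j i
    simp only [hh]
    split_ifs
    · exact aestronglyMeasurable_const
    · exact (hfm i).sub aestronglyMeasurable_const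
    · exact hfm i
  have hi : ∀ j i, Integrable fun y => decay n (n + 2 * β) t ‖x - y‖ * ‖h j i y‖ := by
    intro j i
    simp only [hh]
    split_ifs
    · exact hconst _
    · refine ((hfi i).add (hconst (a i))).mono'
        ((continuous_decay ht x).aestronglyMeasurable.mul
          ((hfm i).sub aestronglyMeasurable_const).norm)
        (Filter.Eventually.of_forall fun y => ?_)
      have hd := decay_nonneg n (M := n + 2 * β) ht (norm_nonneg (x - y))
      rw [Real.norm_of_nonneg (by positivity), Pi.add_apply, ← mul_add]
      gcongr
      exact norm_sub_le _ _
    · exact hfi i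
  have hint : ∀ j, Integrable fun y : Fin (m + 1) → Rn n => K y * ∏ i, h j i (y i) := fun j =>
    hK.integrable hβ ht hA (hm j) (hi j)
  have hinta : Integrable fun y : Fin (m + 1) → Rn n => K y * ∏ i, a i :=
    hK.integrable hβ ht hA (h := fun i _ => a i) (fun i => aestronglyMeasurable_const)
      fun i => hconst (a i)
  -- The term with every function replaced by its average is a constant times the integral of K,
  -- which vanishes.
  have e : ∫ y, K y * ∏ i, f i (y i) = ∑ j, ∫ y, K y * ∏ i, h j i (y i) := by
    rw [← integral_finsetSum _ fun j _ => hint j]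
    have h1 : ∀ y : Fin (m + 1) → Rn n, K y * ∏ i, f i (y i) =
        (∑ j, K y * ∏ i, h j i (y i)) + K y * ∏ i, a i := by
      intro y
      rw [← Finset.mul_sum, ← prod_sub_prod_eq_sum]
      ring
    simp_rw [h1]
    rw [integral_add (integrable_finsetSum _ fun j _ => hint j) hinta, integral_mul_const, h0,
      zero_mul, add_zero]
  rw [e]
  refine (enorm_sum_le _ _).trans (Finset.sum_le_sum fun j _ => ?_)
  rw [hK.integral_eq_integral_slice hβ ht hA j (hm j) (hi j)]
  have hjj : ∀ y, h j j y = f j y - a j := fun y => by simp [hh]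
  have hpos : ∀ i, 0 ≤ ∫ y, decay n (n + 2 * β) t ‖x - y‖ * ‖h j (j.succAbove i) y‖ := fun i =>
    integral_nonneg fun y => mul_nonneg (decay_nonneg n ht (norm_nonneg _)) (norm_nonneg _)
  simp_rw [hjj]
  refine ((hK.isKernel_slice hβ ht hA j (hm j) (hi j)).enorm_integral_le hβ hβ1 ht
    (mul_nonneg hA (Finset.prod_nonneg fun i _ => hpos i)) h16 h32 (hf j) (hfi j)).trans ?_
  rw [ENNReal.ofReal_mul hA, ENNReal.ofReal_prod_of_nonneg fun i _ => hpos i]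
  refine mul_le_mul' (mul_le_mul' le_rfl (mul_le_mul' le_rfl
    (Finset.prod_le_prod' fun i _ => ?_))) le_rfl
  set l := j.succAbove i
  have hl : l ≠ j := Fin.succAbove_ne j i
  by_cases hlt : l < j
  · simp only [hh, if_pos hlt]
    exact ofReal_integral_decay_const_le hβ ht x (f l)
  · simp only [hh, if_neg hlt, if_neg hl]
    refine (ofReal_integral_decay_mul_le hβ ht x (hfm l) (hfi l)).trans ?_
    gcongr
    exact le_mul_of_one_le_right' le_self_add

/-! ### Regularity with decay, integrability and cancellation at almost every point -/

lemma decay_rpow_mul (n : ℕ) {N M ε t s : ℝ} (ht : 0 < t) (hs : 0 ≤ s) (h : N * (1 - ε) = M) :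
    decay n N t s ^ (1 - ε) * (t ^ (-(n : ℤ))) ^ ε = decay n M t s := by
  have hu : 0 < 1 + t⁻¹ * s := by positivity
  have hT : 0 < t ^ (-(n : ℤ)) := by positivity
  rw [decay, decay, Real.div_rpow hT.le (by positivity), ← Real.rpow_mul hu.le, h,
    div_mul_eq_mul_div,
    ← Real.rpow_add hT, sub_add_cancel, Real.rpow_one]

lemma decay_anti (n : ℕ) {N M t s : ℝ} (ht : 0 < t) (hs : 0 ≤ s) (h : M ≤ N) :
    decay n N t s ≤ decay n M t s := by
  have hu : 0 ≤ t⁻¹ * s := by positivity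
  unfold decay
  gcongr
  linarith

/-- The size and regularity conditions yield regularity with decay. -/
lemma exists_isMultiKernel {θ : KernelFamily n (m + 1)} {N γ : ℝ} (hN : (n : ℝ) < N) (hγ0 : 0 < γ)
    (hγ1 : γ ≤ 1) (hsize : SizeCondition θ N) (hreg : RegularityCondition θ γ) :
    ∃ β A : ℝ, 0 < β ∧ β ≤ 1 ∧ 0 ≤ A ∧ ∀ t : ℝ, 0 < t → ∀ x, IsMultiKernel β x t A (θ t x) := by
  obtain ⟨A₁, hA₁⟩ := hsize
  obtain ⟨A₂, hA₂⟩ := hreg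
  have hn0 : (0 : ℝ) ≤ n := Nat.cast_nonneg n
  have hN0 : 0 < N := hn0.trans_lt hN
  -- Solves N(1 - ε) = n + 2εγ: the decay left after interpolation is of order n + 2β with β = εγ.
  set ε := (N - n) / (N + 2 * γ) with hε
  have hε0 : 0 < ε := div_pos (by linarith) (by linarith)
  have hε1 : ε < 1 := (div_lt_one (by linarith)).2 (by linarith)
  have hM : N * (1 - ε) = n + 2 * (ε * γ) := by
    rw [hε]; field_simp; ring
  have hMN : (n : ℝ) + 2 * (ε * γ) ≤ N := by rw [← hM]; nlinarith
  set A := max 0 (max A₁ A₂) with hA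
  have hA0 : 0 ≤ A := le_max_left _ _
  have h1 : A₁ ≤ A := (le_max_left _ _).trans (le_max_right _ _)
  have h2 : A₂ ≤ A := (le_max_right _ _).trans (le_max_right _ _)
  refine ⟨ε * γ, A, by positivity, by nlinarith, hA0, fun t ht x => ?_⟩
  have hE : ∀ z : Rn n, 0 ≤ decay n N t ‖x - z‖ := fun z => decay_nonneg n ht (norm_nonneg _)
  have hsz : ∀ y, ‖θ t x y‖ ≤ A * ∏ i, decay n N t ‖x - y i‖ := fun y =>
    (hA₁ t ht x y).trans (mul_le_mul_of_nonneg_right h1 (Finset.prod_nonneg fun i _ => hE _))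
  refine ⟨fun y => (hsz y).trans ?_, fun y j y' => ?_⟩
  · gcongr
    · exact fun i _ => hE _
    · exact decay_anti n ht (norm_nonneg _) hMN
  · set T := t ^ (-(n : ℤ)) with hT
    have hT0 : 0 < T := by positivity
    set P := ∏ i, decay n N t ‖x - y (j.succAbove i)‖ with hP
    have hP0 : 0 ≤ P := Finset.prod_nonneg fun i _ => hE _
    set δ := ‖y j - y'‖ / t with hδ
    have hδ0 : 0 ≤ δ := by positivity
    set a := ‖θ t x y - θ t x (Function.update y j y')‖ with ha
    have hU : a ≤ A * (P * (decay n N t ‖x - y j‖ + decay n N t ‖x - y'‖)) := by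
      refine (norm_sub_le _ _).trans ((add_le_add (hsz y) (hsz _)).trans_eq ?_)
      rw [Fin.prod_univ_succAbove _ j, Fin.prod_univ_succAbove _ j]
      simp only [Function.update_self, ne_eq, Fin.succAbove_ne, not_false_eq_true,
        Function.update_of_ne]
      ring
    have hV : a ≤ A * (T * T ^ m * δ ^ γ) := by
      refine (hA₂ t ht x y j y').trans ?_
      have e : t ^ (-(((m + 1) * n : ℕ) : ℤ)) = T * T ^ m := by
        rw [← pow_succ', hT, zpow_neg, zpow_neg, zpow_natCast, zpow_natCast, inv_pow, ← pow_mul,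
          mul_comm]
      rw [e, ← div_eq_inv_mul]
      gcongr
    have hE0 := hE (y j)
    have hE1 := hE y'
    have ha0 : 0 ≤ a := norm_nonneg _
    have hδγ : 0 ≤ δ ^ γ := by positivity
    have hD : ∀ z : Rn n, decay n N t ‖x - z‖ ^ (1 - ε) * T ^ ε =
        decay n (n + 2 * (ε * γ)) t ‖x - z‖ := fun z => decay_rpow_mul n ht (norm_nonneg _) hM
    clear_value a δ T A P
    -- The size bound is used with weight 1 - ε and the regularity bound with weight ε; each factor
    -- t^{-n} of the latter restores the normalization of one decay factor.
    calc a = a ^ (1 - ε) * a ^ ε := by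
          rw [← Real.rpow_add_of_nonneg ha0 (by linarith) hε0.le, sub_add_cancel, Real.rpow_one]
      _ ≤ (A * (P * (decay n N t ‖x - y j‖ + decay n N t ‖x - y'‖))) ^ (1 - ε) *
            (A * (T * T ^ m * δ ^ γ)) ^ ε := by
          have : 0 ≤ 1 - ε := by linarith
          gcongr
      _ = (A ^ (1 - ε) * A ^ ε) * ((P ^ (1 - ε) * (T ^ m) ^ ε) *
            ((decay n N t ‖x - y j‖ + decay n N t ‖x - y'‖) ^ (1 - ε) * T ^ ε) * δ ^ (ε * γ)) := by
          rw [Real.mul_rpow hA0 (by positivity), Real.mul_rpow hP0 (by positivity),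
            Real.mul_rpow hA0 (by positivity), Real.mul_rpow (by positivity) (by positivity),
            Real.mul_rpow (by positivity) (by positivity), ← Real.rpow_mul hδ0, mul_comm γ]
          ring
      _ ≤ A * ((∏ i, decay n (n + 2 * (ε * γ)) t ‖x - y (j.succAbove i)‖) *
            (decay n (n + 2 * (ε * γ)) t ‖x - y j‖ + decay n (n + 2 * (ε * γ)) t ‖x - y'‖) *
            δ ^ (ε * γ)) := by
          have e1 : A ^ (1 - ε) * A ^ ε = A := by
            rw [← Real.rpow_add_of_nonneg hA0 (by linarith) hε0.le, sub_add_cancel, Real.rpow_one]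
          have e2 : P ^ (1 - ε) * (T ^ m) ^ ε =
              ∏ i, decay n (n + 2 * (ε * γ)) t ‖x - y (j.succAbove i)‖ := by
            rw [hP, ← Real.finsetProd_rpow _ _ fun i _ => hE _, ← Real.rpow_natCast_mul hT0.le,
              mul_comm (m : ℝ), Real.rpow_mul_natCast hT0.le, ← Fin.prod_const,
              ← Finset.prod_mul_distrib]
            exact Finset.prod_congr rfl fun i _ => hD _
          have e3 : (decay n N t ‖x - y j‖ + decay n N t ‖x - y'‖) ^ (1 - ε) * T ^ ε ≤
              decay n (n + 2 * (ε * γ)) t ‖x - y j‖ + decay n (n + 2 * (ε * γ)) t ‖x - y'‖ := by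
            rw [← hD, ← hD, ← add_mul]
            exact mul_le_mul_of_nonneg_right
              (Real.rpow_add_le_add_rpow hE0 hE1 (by linarith) (by linarith)) (by positivity)
          have e4 : 0 ≤ ∏ i, decay n (n + 2 * (ε * γ)) t ‖x - y (j.succAbove i)‖ :=
            Finset.prod_nonneg fun i _ => decay_nonneg n ht (norm_nonneg _)
          rw [e1, e2]
          exact mul_le_mul_of_nonneg_left (mul_le_mul_of_nonneg_right
            (mul_le_mul_of_nonneg_left e3 e4) (by positivity)) hA0
      _ = _ := by ring

/-- Since |f| ≤ 1 + |f|^q, it is enough that the decay function is integrable and bounded. -/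
lemma integrable_decay_mul_norm {β : ℝ} (hβ : 0 < β) {t : ℝ} (ht : 0 < t) (x : Rn n) {q : ℝ}
    (hq : 1 < q) {f : Rn n → ℂ} (hf : MemLp f (ENNReal.ofReal q) volume) :
    Integrable fun y => decay n (n + 2 * β) t ‖x - y‖ * ‖f y‖ := by
  have h1 := hf.integrable_norm_rpow (by simpa using by linarith) ENNReal.ofReal_ne_top
  rw [ENNReal.toReal_ofReal (by linarith)] at h1
  refine ((integrable_decay hβ ht x).add (h1.const_mul (t ^ n)⁻¹)).mono'
    ((continuous_decay ht x).aestronglyMeasurable.mul hf.1.norm)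
    (Filter.Eventually.of_forall fun y => ?_)
  have hd := decay_nonneg n (M := n + 2 * β) ht (norm_nonneg (x - y))
  have hd1 := decay_le n (M := n + 2 * β) ht (norm_nonneg (x - y)) (by positivity)
  have h2 : ‖f y‖ ≤ 1 + ‖f y‖ ^ q := by
    rcases le_total ‖f y‖ 1 with h | h
    · have : 0 ≤ ‖f y‖ ^ q := by positivity
      linarith
    · have := Real.self_le_rpow_of_one_le h hq.le
      linarith
  rw [Real.norm_of_nonneg (by positivity), Pi.add_apply]
  calc _ ≤ decay n (n + 2 * β) t ‖x - y‖ * (1 + ‖f y‖ ^ q) := by gcongr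
    _ = decay n (n + 2 * β) t ‖x - y‖ + decay n (n + 2 * β) t ‖x - y‖ * ‖f y‖ ^ q := by ring
    _ ≤ _ := by gcongr

/-- The cancellation condition holds for almost every scale at almost every point. -/
lemma ae_ae_integral_eq_zero {m : ℕ} {θ : KernelFamily n m} (hθ : KernelMeasurable θ)
    (hcancel : ∀ t : ℝ, 0 < t → Theta θ t (fun _ _ => 1) =ᵐ[volume] (fun _ => 0)) :
    ∀ᵐ x : Rn n, ∀ᵐ t ∂((volume : Measure ℝ).restrict (Set.Ioi 0)), ∫ y, θ t x y = 0 := by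
  set ν := (volume : Measure ℝ).restrict (Set.Ioi 0) with hν
  have h1 : AEStronglyMeasurable (fun z : (ℝ × Rn n) × (Fin m → Rn n) => θ z.1.1 z.1.2 z.2)
      ((ν.prod volume).prod volume) := by
    have := hθ.comp_measurePreserving (measurePreserving_prodAssoc ν (volume : Measure (Rn n))
      (volume : Measure (Fin m → Rn n)))
    exact this
  -- The exceptional null set of points depends on t. A jointly measurable version of the inner
  -- integral allows Fubini to exchange the order of the almost-everywhere statements.
  have h2 := h1.integral_prod_right'
  have h3 : ∀ᵐ t ∂ν, ∀ᵐ x : Rn n, h2.mk _ (t, x) = 0 := by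
    filter_upwards [Measure.ae_ae_of_ae_prod h2.ae_eq_mk, ae_restrict_mem measurableSet_Ioi]
      with t ht ht0
    filter_upwards [ht, hcancel t ht0] with x hx hx0
    rw [← hx]
    simpa [Theta] using hx0
  have hms : MeasurableSet {z : ℝ × Rn n | h2.mk _ z = 0} :=
    h2.stronglyMeasurable_mk.measurable (measurableSet_singleton 0)
  have h4 : ∀ᵐ z ∂(ν.prod (volume : Measure (Rn n))), h2.mk _ z = 0 :=
    (Measure.ae_prod_mem_iff_ae_ae_mem hms).2 h3
  have h5 : ∀ᵐ z ∂(ν.prod (volume : Measure (Rn n))), ∫ y, θ z.1 z.2 y = 0 := by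
    filter_upwards [h4, h2.ae_eq_mk] with z hz hz'
    rw [hz', hz]
  rw [← Measure.prod_swap] at h5
  exact Measure.ae_ae_of_ae_prod (ae_of_ae_map measurable_swap.aemeasurable h5)

/-! ### Pointwise bound of the multilinear square function -/

lemma tsum_mul_sq_le {ι : Type*} (e a : ι → ℝ≥0∞) :
    (∑' i, e i * a i) ^ 2 ≤ 2 * (∑' i, e i) * ∑' i, e i * a i ^ 2 := by
  have h : ∀ b c : ℝ≥0∞, b * c ≤ b ^ 2 + c ^ 2 := by
    intro b c
    rcases le_total b c with h | h
    · calc b * c ≤ c * c := by gcongr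
        _ = c ^ 2 := (sq c).symm
        _ ≤ _ := le_add_self
    · calc b * c ≤ b * b := by gcongr
        _ = b ^ 2 := (sq b).symm
        _ ≤ _ := le_self_add
  set X := ∑' i, e i * a i ^ 2
  set E := ∑' i, e i
  calc (∑' i, e i * a i) ^ 2 = ∑' i, ∑' j, e i * a i * (e j * a j) := by
        rw [sq, ← ENNReal.tsum_mul_right]
        simp_rw [← ENNReal.tsum_mul_left]
    _ ≤ ∑' i, ∑' j, (e i * a i ^ 2 * e j + e i * (e j * a j ^ 2)) := by
        refine ENNReal.tsum_le_tsum fun i => ENNReal.tsum_le_tsum fun j => ?_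
        calc _ = e i * e j * (a i * a j) := by ring
          _ ≤ e i * e j * (a i ^ 2 + a j ^ 2) := by gcongr; exact h _ _
          _ = _ := by ring
    _ = _ := by
        simp_rw [ENNReal.tsum_add, ENNReal.tsum_mul_left, ENNReal.tsum_mul_right]
        ring

lemma sum_sq_le {ι : Type*} [Fintype ι] (a : ι → ℝ≥0∞) :
    (∑ i, a i) ^ 2 ≤ 2 * Fintype.card ι * ∑ i, a i ^ 2 := by
  simpa [tsum_fintype] using tsum_mul_sq_le (fun _ => 1) a

/-- The sum of the square functions over all shifted grids. -/
noncomputable def squareSum (β : ℝ) (f : Rn n → ℂ) (x : Rn n) : ℝ≥0∞ :=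
  ∑ α : Fin n → Bool, (shiftedGrid α).square β f x

lemma tsum_cfSum_sq_le (β : ℝ) (f : Rn n → ℂ) (x : Rn n) :
    ∑' k : ℤ, cfSum β f k x ^ 2 ≤ 2 * 2 ^ n * 2 ^ n * squareSum β f x ^ 2 := by
  have hc : (Fintype.card (Fin n → Bool) : ℝ≥0∞) = 2 ^ n := by simp
  have hs : ∀ α : Fin n → Bool, ∑' k : ℤ, (shiftedGrid α).cf β f k x ^ 2 =
      (shiftedGrid α).square β f x ^ 2 := by
    intro α
    rw [Grid.square, ← ENNReal.rpow_two, ← ENNReal.rpow_mul]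
    norm_num
  calc _ ≤ ∑' k : ℤ, 2 * 2 ^ n * ∑ α : Fin n → Bool, (shiftedGrid α).cf β f k x ^ 2 := by
        refine ENNReal.tsum_le_tsum fun k => ?_
        rw [← hc]
        exact sum_sq_le _
    _ = 2 * 2 ^ n * ∑ α : Fin n → Bool, (shiftedGrid α).square β f x ^ 2 := by
        rw [ENNReal.tsum_mul_left, Summable.tsum_finsetSum fun _ _ => ENNReal.summable]
        simp_rw [hs]
    _ ≤ 2 * 2 ^ n * ∑ _α : Fin n → Bool, squareSum β f x ^ 2 := by
        gcongr with α
        exact Finset.single_le_sum (f := fun α => (shiftedGrid α).square β f x)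
          (fun _ _ => zero_le) (Finset.mem_univ α)
    _ = _ := by
        rw [Finset.sum_const, nsmul_eq_mul, Finset.card_univ, hc]
        ring

/-- Cauchy–Schwarz against the summable geometric weights, followed by a translation of the scale
index for each s. -/
lemma tsum_cfTail_sq_le (β : ℝ) (f : Rn n → ℂ) (x : Rn n) :
    ∑' k : ℤ, cfTail β f k x ^ 2 ≤ 2 * (∑' r : ℕ, ENNReal.ofReal (ratio β r)) ^ 2 *
      (2 * 2 ^ n * 2 ^ n * squareSum β f x ^ 2) := by
  set E := ∑' r : ℕ, ENNReal.ofReal (ratio β r)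
  calc _ ≤ ∑' k : ℤ, 2 * E * ∑' s : ℕ, ENNReal.ofReal (ratio β s) * cfSum β f (k + s) x ^ 2 :=
        ENNReal.tsum_le_tsum fun k => tsum_mul_sq_le _ _
    _ = 2 * E * ∑' s : ℕ, ENNReal.ofReal (ratio β s) * ∑' k : ℤ, cfSum β f k x ^ 2 := by
        rw [ENNReal.tsum_mul_left, ENNReal.tsum_comm]
        congr 2 with s
        rw [ENNReal.tsum_mul_left]
        congr 1
        exact (Equiv.addRight (s : ℤ)).tsum_eq fun k => cfSum β f k x ^ 2
    _ = 2 * E ^ 2 * ∑' k : ℤ, cfSum β f k x ^ 2 := by rw [ENNReal.tsum_mul_right]; ring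
    _ ≤ _ := by gcongr; exact tsum_cfSum_sq_le β f x

/-- On (2^j, 2^{j+1}] the hypothesis applies with k = j + 5, and 1/t ≤ 2^{-j} on an interval of
length 2^j, so each interval contributes at most one term. -/
lemma lintegral_Ioi_div_le {F : ℝ → ℝ≥0∞} {G : ℤ → ℝ≥0∞}
    (h : ∀ᵐ t ∂((volume : Measure ℝ).restrict (Set.Ioi 0)), ∀ k : ℤ, 16 * t ≤ 2 ^ k →
      2 ^ k ≤ 32 * t → F t ≤ G k) :
    ∫⁻ t in Set.Ioi (0 : ℝ), F t / ENNReal.ofReal t ≤ ∑' k, G k := by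
  have hU : Set.Ioi (0 : ℝ) ⊆ ⋃ j : ℤ, Set.Ioc (2 ^ j) (2 ^ (j + 1)) := fun t ht => by
    obtain ⟨j, hj⟩ := exists_mem_Ioc_zpow ht (by norm_num : (1 : ℝ) < 2)
    exact Set.mem_iUnion.2 ⟨j, hj⟩
  refine (lintegral_mono_set hU).trans ((lintegral_iUnion_le _ _).trans ?_)
  rw [← (Equiv.addRight (5 : ℤ)).tsum_eq G]
  refine ENNReal.tsum_le_tsum fun j => ?_
  have hj : (0 : ℝ) < 2 ^ j := by positivity
  have e1 : (2 : ℝ) ^ (j + 1) = 2 * 2 ^ j := by rw [zpow_add₀ (by norm_num)]; norm_num; ring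
  have e5 : (2 : ℝ) ^ (j + 5) = 32 * 2 ^ j := by rw [zpow_add₀ (by norm_num)]; norm_num; ring
  have hsub : Set.Ioc ((2 : ℝ) ^ j) (2 ^ (j + 1)) ⊆ Set.Ioi 0 := fun t ht => hj.trans ht.1
  calc ∫⁻ t in Set.Ioc ((2 : ℝ) ^ j) (2 ^ (j + 1)), F t / ENNReal.ofReal t
      ≤ ∫⁻ _t in Set.Ioc ((2 : ℝ) ^ j) (2 ^ (j + 1)), G (j + 5) * (ENNReal.ofReal (2 ^ j))⁻¹ := by
        refine lintegral_mono_ae ?_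
        filter_upwards [ae_restrict_of_ae_restrict_of_subset hsub h,
          ae_restrict_mem measurableSet_Ioc] with t ht htm
        rw [div_eq_mul_inv]
        refine mul_le_mul' (ht _ ?_ ?_) (ENNReal.inv_le_inv.2 (ENNReal.ofReal_le_ofReal htm.1.le))
        · have := htm.2
          rw [e1] at this
          rw [e5]; linarith
        · rw [e5]; linarith [htm.1]
    _ = G (j + 5) := by
        rw [setLIntegral_const, Real.volume_Ioc, e1, mul_assoc,
          show 2 * (2 : ℝ) ^ j - 2 ^ j = 2 ^ j by ring,
          ENNReal.inv_mul_cancel (by simpa using hj) ENNReal.ofReal_ne_top, mul_one]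

/-- The pointwise bound of the square function by maximal functions and dyadic square functions. -/
lemma exists_S_le {θ : KernelFamily n (m + 1)} (hθ : KernelMeasurable θ) {N γ : ℝ}
    (hN : (n : ℝ) < N) (hγ0 : 0 < γ) (hγ1 : γ ≤ 1) (hsize : SizeCondition θ N)
    (hreg : RegularityCondition θ γ)
    (hcancel : ∀ t : ℝ, 0 < t → Theta θ t (fun _ _ => 1) =ᵐ[volume] (fun _ => 0))
    {q : Fin (m + 1) → ℝ} (hq : ∀ i, 1 < q i) :
    ∃ β : ℝ, 0 < β ∧ ∃ C : ℝ≥0∞, C ≠ ∞ ∧ ∀ f : Fin (m + 1) → Rn n → ℂ,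
      (∀ i, MemLp (f i) (ENNReal.ofReal (q i)) volume) →
      ∀ᵐ x : Rn n, S θ f x ≤ C * ∏ i, (maxSum (fun y => ‖f i y‖ₑ) x + squareSum β (f i) x) := by
  obtain ⟨β, A, hβ, hβ1, hA, hK⟩ := exists_isMultiKernel hN hγ0 hγ1 hsize hreg
  set E := ∑' r : ℕ, ENNReal.ofReal (ratio β r) with hE
  set c : ℝ≥0∞ := kernelConst n β * (ENNReal.ofReal A * factorConst n β ^ m) with hc
  set C : ℝ≥0∞ := c ^ 2 * (2 * (m + 1 : ℕ) * (2 * E ^ 2 * (2 * 2 ^ n * 2 ^ n)) * (m + 1 : ℕ))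
    with hC
  have hcT : c ≠ ∞ := ENNReal.mul_ne_top (kernelConst_ne_top n hβ)
    (ENNReal.mul_ne_top ENNReal.ofReal_ne_top (ENNReal.pow_ne_top (factorConst_ne_top n hβ)))
  have hET : E ≠ ∞ := tsum_ratio_ne_top hβ
  have hCT : C ≠ ∞ := by
    have h2 : (2 : ℝ≥0∞) ≠ ∞ := ENNReal.ofNat_ne_top
    have hm : ((m + 1 : ℕ) : ℝ≥0∞) ≠ ∞ := ENNReal.natCast_ne_top _
    have h2n := ENNReal.pow_ne_top (n := n) h2
    exact ENNReal.mul_ne_top (ENNReal.pow_ne_top hcT) (ENNReal.mul_ne_top (ENNReal.mul_ne_top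
      (ENNReal.mul_ne_top h2 hm) (ENNReal.mul_ne_top (ENNReal.mul_ne_top h2
        (ENNReal.pow_ne_top hET)) (ENNReal.mul_ne_top (ENNReal.mul_ne_top h2 h2n) h2n))) hm)
  refine ⟨β, hβ, C ^ (1 / 2 : ℝ), ENNReal.rpow_ne_top_of_nonneg (by norm_num) hCT, fun f hf => ?_⟩
  have hloc : ∀ i, LocallyIntegrable (f i) := fun i =>
    (hf i).locallyIntegrable (by
      rw [← ENNReal.ofReal_one]
      exact ENNReal.ofReal_le_ofReal (hq i).le)
  filter_upwards [ae_ae_integral_eq_zero hθ hcancel] with x hx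
  set M : Fin (m + 1) → ℝ≥0∞ := fun i => maxSum (fun y => ‖f i y‖ₑ) x with hM
  set G : ℝ≥0∞ := ∏ i, (M i + squareSum β (f i) x) with hG
  have h1 : ∫⁻ t in Set.Ioi (0 : ℝ), ‖Theta θ t f x‖ₑ ^ 2 / ENNReal.ofReal t ≤
      ∑' k, (c * ∑ j, (∏ i, M (j.succAbove i)) * cfTail β (f j) k x) ^ 2 := by
    refine lintegral_Ioi_div_le ?_
    filter_upwards [hx, ae_restrict_mem measurableSet_Ioi] with t ht ht0 k h16 h32
    have ht0 : 0 < t := ht0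
    gcongr
    refine ((hK t ht0 x).enorm_integral_le hβ hβ1 ht0 hA h16 h32 ht hloc fun i =>
      integrable_decay_mul_norm hβ ht0 x (hq i) (hf i)).trans_eq ?_
    rw [Finset.mul_sum]
    refine Finset.sum_congr rfl fun j _ => ?_
    rw [Finset.prod_mul_distrib, Finset.prod_const, Finset.card_univ, Fintype.card_fin, hc]
    ring
  have h2 : ∑' k, (c * ∑ j, (∏ i, M (j.succAbove i)) * cfTail β (f j) k x) ^ 2 ≤ C * G ^ 2 := by
    calc _ ≤ ∑' k, c ^ 2 * (2 * (m + 1 : ℕ) *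
          ∑ j, (∏ i, M (j.succAbove i)) ^ 2 * cfTail β (f j) k x ^ 2) := by
          refine ENNReal.tsum_le_tsum fun k => ?_
          rw [mul_pow]
          gcongr
          refine (sum_sq_le _).trans_eq ?_
          rw [Fintype.card_fin]
          simp_rw [mul_pow]
      _ = c ^ 2 * (2 * (m + 1 : ℕ) * ∑ j, (∏ i, M (j.succAbove i)) ^ 2 *
            ∑' k, cfTail β (f j) k x ^ 2) := by
          rw [ENNReal.tsum_mul_left, ENNReal.tsum_mul_left,
            Summable.tsum_finsetSum fun _ _ => ENNReal.summable]
          simp_rw [ENNReal.tsum_mul_left]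
      _ ≤ c ^ 2 * (2 * (m + 1 : ℕ) * ∑ _j : Fin (m + 1),
            2 * E ^ 2 * (2 * 2 ^ n * 2 ^ n) * G ^ 2) := by
          refine mul_le_mul' le_rfl (mul_le_mul' le_rfl (Finset.sum_le_sum fun j _ => ?_))
          calc _ ≤ (∏ i, M (j.succAbove i)) ^ 2 *
                (2 * E ^ 2 * (2 * 2 ^ n * 2 ^ n * squareSum β (f j) x ^ 2)) := by
                gcongr
                exact tsum_cfTail_sq_le β (f j) x
            _ = 2 * E ^ 2 * (2 * 2 ^ n * 2 ^ n) *
                  (squareSum β (f j) x * ∏ i, M (j.succAbove i)) ^ 2 := by ring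
            _ ≤ _ := by
                -- The square function of f_j times the maximal functions of the others is one term
                -- in the expansion of ∏ (M f_i + 𝒮 f_i).
                rw [hG, Fin.prod_univ_succAbove _ j]
                gcongr
                · exact le_add_self
                · exact le_self_add
      _ = _ := by
          rw [Finset.sum_const, nsmul_eq_mul, Finset.card_univ, Fintype.card_fin, hC]
          ring
  calc S θ f x ≤ (C * G ^ 2) ^ (1 / 2 : ℝ) :=
        ENNReal.rpow_le_rpow (h1.trans h2) (by norm_num)
    _ = _ := by rw [ENNReal.mul_rpow_of_nonneg _ _ (by norm_num), Grid.sq_rpow_half]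

/-! ### From Muckenhoupt weights to positive dyadic weights -/

lemma one_sub_conjExponent {q : ℝ} (hq : 1 < q) : 1 - Real.conjExponent q = -(q - 1)⁻¹ := by
  have : q - 1 ≠ 0 := by linarith
  rw [Real.conjExponent]
  field_simp
  ring

lemma volume_cube_ne_top (a : Rn n) {ℓ : ℝ} (hℓ : 0 < ℓ) : volume (cube a ℓ) ≠ ∞ := by
  have : volume (cube a ℓ) = ENNReal.ofReal (ℓ ^ n) :=
    Grid.volume_box ℓ hℓ.le _ (fun i => measurableSet_Icc) (by simp)
  rw [this]
  exact ENNReal.ofReal_ne_top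

/-- The cubes centred at the origin. -/
def centredCube (n K : ℕ) : Set (Rn n) := cube (WithLp.toLp 2 fun _ => -((K : ℝ) + 1)) (2 * (K + 1))

lemma centredCube_mono {K L : ℕ} (h : K ≤ L) : centredCube n K ⊆ centredCube n L := by
  have h1 : (K : ℝ) ≤ L := by exact_mod_cast h
  intro x hx i
  have := hx i
  simp only [Set.mem_Icc] at this ⊢
  constructor <;> linarith [this.1, this.2]

lemma iUnion_centredCube (n K : ℕ) : ⋃ L : ℕ, centredCube n (K + L) = Set.univ := by
  refine Set.eq_univ_of_forall fun x => ?_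
  obtain ⟨L, hL⟩ := exists_nat_ge ‖x‖
  refine Set.mem_iUnion.2 ⟨L, fun i => ?_⟩
  have h1 := (Real.norm_eq_abs _).symm.trans_le ((PiLp.norm_apply_le x i).trans hL)
  rw [abs_le] at h1
  have h2 : (0 : ℝ) ≤ K := Nat.cast_nonneg K
  simp only [Set.mem_Icc, Nat.cast_add]
  constructor <;> linarith

lemma aemeasurable_coe_of_locallyIntegrable {u : Rn n → ℝ≥0}
    (hu : LocallyIntegrable (fun x => (u x : ℝ)) volume) :
    AEMeasurable (fun x => (u x : ℝ≥0∞)) volume := by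
  have := hu.aestronglyMeasurable.aemeasurable.ennreal_ofReal
  simpa using this

namespace IsApWeight

variable {q : ℝ} {u : Rn n → ℝ≥0}

/-- On each cube an `A_p` weight vanishes either almost everywhere or almost nowhere. -/
lemma ae_cube (hq : 1 < q) (hu : IsApWeight q u) (a : Rn n) {ℓ : ℝ} (hℓ : 0 < ℓ) :
    (∀ᵐ x ∂(volume.restrict (cube a ℓ)), u x = 0) ∨
      ∀ᵐ x ∂(volume.restrict (cube a ℓ)), u x ≠ 0 := by
  have hm : AEMeasurable (fun x => (u x : ℝ≥0∞)) (volume.restrict (cube a ℓ)) :=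
    (aemeasurable_coe_of_locallyIntegrable hu.1).restrict
  have hV : (volume (cube a ℓ))⁻¹ ≠ 0 := ENNReal.inv_ne_zero.2 (volume_cube_ne_top a hℓ)
  have hle : ((volume (cube a ℓ))⁻¹ * ∫⁻ x in cube a ℓ, (u x : ℝ≥0∞)) *
      ((volume (cube a ℓ))⁻¹ *
        ∫⁻ x in cube a ℓ, (u x : ℝ≥0∞) ^ (1 - Real.conjExponent q)) ^ (q - 1) < ∞ := by
    refine lt_of_le_of_lt ?_ hu.2
    exact le_iSup_of_le a (le_iSup_of_le ℓ (le_iSup_of_le hℓ le_rfl))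
  rw [one_sub_conjExponent hq] at hle
  have hq1 : 0 < q - 1 := by linarith
  -- The dual power is ∞ on the zero set. If its integral is infinite, finiteness of the product
  -- forces the integral of u to be 0; otherwise the zero set is null.
  by_cases hσ : ∫⁻ x in cube a ℓ, (u x : ℝ≥0∞) ^ (-(q - 1)⁻¹) = ∞
  · left
    rw [hσ, ENNReal.mul_top hV, ENNReal.top_rpow_of_pos hq1] at hle
    have h1 : (volume (cube a ℓ))⁻¹ * ∫⁻ x in cube a ℓ, (u x : ℝ≥0∞) = 0 := by
      by_contra h
      rw [ENNReal.mul_top h] at hle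
      exact lt_irrefl _ hle
    have h2 := (mul_eq_zero.1 h1).resolve_left hV
    rw [lintegral_eq_zero_iff' hm] at h2
    filter_upwards [h2] with x hx
    simpa using hx
  · right
    filter_upwards [ae_lt_top' (hm.pow_const _) hσ] with x hx h0
    rw [h0, ENNReal.coe_zero, ENNReal.zero_rpow_of_neg (by simpa using hq1)] at hx
    exact lt_irrefl _ hx

/-- An `A_p` weight vanishes either almost everywhere or almost nowhere. -/
lemma ae_eq_zero_or (hq : 1 < q) (hu : IsApWeight q u) :
    (∀ᵐ x : Rn n, u x = 0) ∨ ∀ᵐ x : Rn n, u x ≠ 0 := by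
  by_cases h : ∀ K, ∀ᵐ x ∂(volume.restrict (centredCube n K)), u x ≠ 0
  · right
    have := (ae_restrict_iUnion_iff (fun L => centredCube n (0 + L)) (fun x => u x ≠ 0)).2
      fun L => h _
    rwa [iUnion_centredCube, Measure.restrict_univ] at this
  · left
    push Not at h
    obtain ⟨K, hK⟩ := h
    -- If u is not almost everywhere nonzero on some cube, the same holds on all larger cubes, where
    -- the dichotomy then gives u = 0.
    have := (ae_restrict_iUnion_iff (μ := volume) (fun L => centredCube n (K + L))
      (fun x => u x = 0)).2 fun L => by
        refine (ae_cube hq hu _ (by positivity)).resolve_right fun h => hK ?_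
        exact ae_restrict_of_ae_restrict_of_subset (centredCube_mono (Nat.le_add_right K L)) h
    rwa [iUnion_centredCube, Measure.restrict_univ] at this

end IsApWeight

lemma integrableOn_cell {E : Type*} [NormedAddCommGroup E] (D : Grid n)
    {f : Rn n → E} (hf : LocallyIntegrable f volume) (k : ℤ) (x : Rn n) :
    IntegrableOn f (D.cell k x) := by
  refine (hf.integrableOn_isCompact (isCompact_closedBall x ((n + 1) * 2 ^ k))).mono_set ?_
  intro y hy
  rw [Metric.mem_closedBall, dist_comm, dist_eq_norm]
  exact D.norm_sub_le hy

/-- An `A_p` weight has a representative that satisfies the dyadic condition in every grid. -/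
lemma IsApWeight.exists_isAp {q : ℝ} (hq : 1 < q) {u : Rn n → ℝ≥0} (hu : IsApWeight q u)
    (h0 : ∀ᵐ x : Rn n, u x ≠ 0) :
    ∃ v : Rn n → ℝ≥0∞, (∀ᵐ x : Rn n, (u x : ℝ≥0∞) = v x) ∧
      ∀ D : Grid n, D.IsAp q v (ApConst q u) := by
  classical
  have hm := aemeasurable_coe_of_locallyIntegrable hu.1
  set g := hm.mk _ with hg
  set v : Rn n → ℝ≥0∞ := fun x => if g x = 0 ∨ g x = ∞ then 1 else g x with hv
  have huv : ∀ᵐ x : Rn n, (u x : ℝ≥0∞) = v x := by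
    filter_upwards [h0, hm.ae_eq_mk] with x hx hx'
    have : ¬(g x = 0 ∨ g x = ∞) := by
      rw [hg, ← hx']
      simpa using hx
    rw [hv]
    simp only [if_neg this]
    exact hx'
  have hgm : Measurable g := hm.measurable_mk
  refine ⟨v, huv, fun D => ?_⟩
  have hint : ∀ k x, ∫⁻ y in D.cell k x, v y = ∫⁻ y in D.cell k x, (u y : ℝ≥0∞) := fun k x =>
    lintegral_congr_ae (ae_restrict_of_ae (huv.mono fun y hy => hy.symm))
  refine ⟨hq, ?_, fun x => ?_, fun x => ?_, hu.2.ne, fun k x => ?_, fun k x => ?_⟩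
  · exact Measurable.ite ((hgm (measurableSet_singleton 0)).union
      (hgm (measurableSet_singleton ∞))) measurable_const hgm
  · simp only [hv]
    split_ifs with h
    · exact one_ne_zero
    · exact fun h' => h (Or.inl h')
  · simp only [hv]
    split_ifs with h
    · exact ENNReal.one_ne_top
    · exact fun h' => h (Or.inr h')
  · rw [hint]
    have := (integrableOn_cell D hu.1 k x).2
    rw [hasFiniteIntegral_iff_enorm] at this
    simpa using this.ne
  · have h1 : ∫⁻ y in D.cell k x, v y ^ (-(q - 1)⁻¹) =
        ∫⁻ y in D.cell k x, (u y : ℝ≥0∞) ^ (1 - Real.conjExponent q) := by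
      rw [one_sub_conjExponent hq]
      exact lintegral_congr_ae (ae_restrict_of_ae (huv.mono fun y hy => by simp only [hy]))
    have hq1 : 0 ≤ q - 1 := by linarith
    -- A half-open dyadic cube has the same volume as the closed cube containing it, so the dyadic
    -- constant is at most the full one.
    rw [hint, h1, ← D.volume_cube_corner]
    refine le_trans ?_ (le_iSup_of_le (D.corner k x) (le_iSup_of_le (2 ^ k)
      (le_iSup_of_le (by positivity) le_rfl)))
    gcongr <;> exact D.cell_subset_cube k x

/-! ### Weighted estimates and Hölder's inequality -/

lemma rpow_le_one_add_rpow (W : ℝ≥0∞) {a e : ℝ} (ha : 0 ≤ a) (h : a ≤ e) : W ^ a ≤ 1 + W ^ e := by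
  -- The summand 1 covers small W, so no lower bound for the Muckenhoupt constant is needed.
  rcases le_total W 1 with hW | hW
  · exact (ENNReal.rpow_le_one hW ha).trans le_self_add
  · exact (ENNReal.rpow_le_rpow_of_exponent_le hW h).trans le_add_self

/-- The power of the Muckenhoupt constant in the weighted estimate. -/
noncomputable def apExponent (q : ℝ) : ℝ :=
  max 1 (Real.conjExponent q / q) + max (1 / 2) (Real.conjExponent q / q)

/-- As q'/q = 1/(q-1), the first maximum covers the power 1 from the domination and the second the
power 1/(q-1) from Buckley's theorem. -/
lemma one_add_le_apExponent {q : ℝ} (hq : 1 < q) : 1 + (q - 1)⁻¹ ≤ apExponent q := by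
  have : Real.conjExponent q / q = (q - 1)⁻¹ := by
    have h1 : q ≠ 0 := by linarith
    rw [Real.conjExponent]
    field_simp
  rw [apExponent, this]
  exact add_le_add (le_max_left _ _) (le_max_right _ _)

lemma measurable_maxSum (h : Rn n → ℝ≥0∞) : Measurable (maxSum h) :=
  Finset.measurable_fun_sum _ fun α _ => (shiftedGrid α).measurable_maximal volume h

lemma measurable_squareSum (β : ℝ) (f : Rn n → ℂ) : Measurable (squareSum β f) :=
  Finset.measurable_fun_sum _ fun α _ => (shiftedGrid α).measurable_square β f

/-- The weighted estimate for the maximal functions and dyadic square functions. -/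
lemma exists_lintegral_maxSum_add_squareSum_le (n : ℕ) {q β : ℝ} (hq : 1 < q) (hβ : 0 < β) :
    ∃ C : ℝ≥0∞, C ≠ ∞ ∧ ∀ u : Rn n → ℝ≥0, IsApWeight q u → (∀ᵐ x : Rn n, u x ≠ 0) →
      ∀ f : Rn n → ℂ, LocallyIntegrable f →
        ∫⁻ x, (maxSum (fun y => ‖f y‖ₑ) x + squareSum β f x) ^ q * u x ≤
          C * ((1 + ApConst q u ^ apExponent q) ^ q * ∫⁻ x, ‖f x‖ₑ ^ q * u x) := by
  obtain ⟨C₂, hC₂, hsq⟩ := Grid.exists_lintegral_square_rpow_le n hq hβ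
  have hq0 : 0 < q := by linarith
  have hq1 : 0 < q - 1 := by linarith
  set C₁ := ENNReal.ofReal (2 * (q / (q - 1)) * (2 ^ (q / (q - 1) - 1) * (q / (q - 1) - 1)⁻¹)) *
      ENNReal.ofReal (2 * q * (2 ^ (q - 1) * (q - 1)⁻¹)) with hC₁
  have hC₁T : C₁ ≠ ∞ := ENNReal.mul_ne_top ENNReal.ofReal_ne_top ENNReal.ofReal_ne_top
  set c : ℝ≥0∞ := ((Finset.univ : Finset (Fin n → Bool)).card : ℝ≥0∞) with hc
  have hcT : c ≠ ∞ := ENNReal.natCast_ne_top _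
  refine ⟨2 ^ (q - 1) * (c ^ (q - 1) * (c * C₁) + c ^ (q - 1) * (c * C₂)), ?_, ?_⟩
  · have h2 : (2 : ℝ≥0∞) ^ (q - 1) ≠ ∞ := ENNReal.rpow_ne_top_of_nonneg hq1.le (by simp)
    have h3 : c ^ (q - 1) ≠ ∞ := ENNReal.rpow_ne_top_of_nonneg hq1.le hcT
    exact ENNReal.mul_ne_top h2 (ENNReal.add_ne_top.2
      ⟨ENNReal.mul_ne_top h3 (ENNReal.mul_ne_top hcT hC₁T),
        ENNReal.mul_ne_top h3 (ENNReal.mul_ne_top hcT hC₂)⟩)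
  intro u hu h0 f hf
  obtain ⟨v, huv, hv⟩ := hu.exists_isAp hq h0
  have hcongr : ∀ g : Rn n → ℝ≥0∞, ∫⁻ x, g x * u x = ∫⁻ x, g x * v x := fun g =>
    lintegral_congr_ae (huv.mono fun x hx => by simp only [hx])
  rw [hcongr, hcongr]
  set W := ApConst q u
  set F := ∫⁻ x, ‖f x‖ₑ ^ q * v x with hF
  set B := (1 + W ^ apExponent q) ^ q with hB
  have he := one_add_le_apExponent hq
  have hi0 : 0 < (q - 1)⁻¹ := inv_pos.2 hq1
  have hmax : ∀ α : Fin n → Bool,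
      ∫⁻ x, (shiftedGrid α).maximal volume (fun y => ‖f y‖ₑ) x ^ q * v x ≤ C₁ * (B * F) := by
    intro α
    have hfm : AEMeasurable (fun y => ‖f y‖ₑ) volume := hf.aestronglyMeasurable.enorm
    have h1 := (hv (shiftedGrid α)).lintegral_maximal_rpow_le hfm.measurable_mk
    rw [← Grid.maximal_congr _ hfm.ae_eq_mk] at h1
    refine h1.trans (mul_le_mul' le_rfl (mul_le_mul' ?_ (le_of_eq ?_)))
    · rw [show q / (q - 1) = (q - 1)⁻¹ * q by rw [div_eq_inv_mul], ENNReal.rpow_mul]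
      exact ENNReal.rpow_le_rpow (rpow_le_one_add_rpow W hi0.le (by linarith)) hq0.le
    · exact lintegral_congr_ae (hfm.ae_eq_mk.mono fun x hx => by simp only [hx])
  have hsquare : ∀ α : Fin n → Bool,
      ∫⁻ x, (shiftedGrid α).square β f x ^ q * v x ≤ C₂ * (B * F) := by
    intro α
    refine (hsq _ v W (hv (shiftedGrid α)) f hf.aestronglyMeasurable
      (integrableOn_cell _ hf)).trans
      (mul_le_mul' le_rfl (mul_le_mul' ?_ le_rfl))
    rw [show q + q / (q - 1) = (1 + (q - 1)⁻¹) * q by rw [div_eq_inv_mul]; ring, ENNReal.rpow_mul]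
    exact ENNReal.rpow_le_rpow (rpow_le_one_add_rpow W (by linarith) he) hq0.le
  have hvm : Measurable v := (hv (shiftedGrid fun _ => false)).measurable
  have hsum : ∀ (g : (Fin n → Bool) → Rn n → ℝ≥0∞) (C : ℝ≥0∞), (∀ α, Measurable (g α)) →
      (∀ α, ∫⁻ x, g α x ^ q * v x ≤ C * (B * F)) →
      ∫⁻ x, (∑ α, g α x) ^ q * v x ≤ c ^ (q - 1) * (c * C) * (B * F) := by
    intro g C hgm hg
    calc _ ≤ ∫⁻ x, c ^ (q - 1) * ∑ α, g α x ^ q * v x := by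
          refine lintegral_mono fun x => ?_
          rw [← Finset.sum_mul, ← mul_assoc]
          gcongr
          exact ENNReal.rpow_sum_le_const_mul_sum_rpow _ _ hq.le
      _ = c ^ (q - 1) * ∑ α, ∫⁻ x, g α x ^ q * v x := by
          rw [lintegral_const_mul, lintegral_finsetSum]
          · exact fun α _ => ((hgm α).pow_const q).mul hvm
          · exact Finset.measurable_fun_sum _ fun α _ => ((hgm α).pow_const q).mul hvm
      _ ≤ c ^ (q - 1) * ∑ _α : Fin n → Bool, C * (B * F) := by
          gcongr with α
          exact hg α
      _ = _ := by rw [Finset.sum_const, nsmul_eq_mul, hc]; ring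
  have h1 := hsum (fun α => (shiftedGrid α).maximal volume fun y => ‖f y‖ₑ) C₁
    (fun α => (shiftedGrid α).measurable_maximal volume _) hmax
  have h2 := hsum (fun α => (shiftedGrid α).square β f) C₂
    (fun α => (shiftedGrid α).measurable_square β f) hsquare
  have hmm : Measurable fun x => maxSum (fun y => ‖f y‖ₑ) x ^ q * v x :=
    ((measurable_maxSum _).pow_const q).mul hvm
  calc _ ≤ ∫⁻ x, 2 ^ (q - 1) *
        (maxSum (fun y => ‖f y‖ₑ) x ^ q * v x + squareSum β f x ^ q * v x) := by
        refine lintegral_mono fun x => ?_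
        rw [← add_mul, ← mul_assoc]
        gcongr
        exact ENNReal.rpow_add_le_mul_rpow_add_rpow _ _ hq.le
    _ = 2 ^ (q - 1) * ((∫⁻ x, maxSum (fun y => ‖f y‖ₑ) x ^ q * v x) +
          ∫⁻ x, squareSum β f x ^ q * v x) := by
        rw [lintegral_const_mul' _ _ (ENNReal.rpow_ne_top_of_nonneg hq1.le (by simp)),
          lintegral_add_left hmm]
    _ ≤ 2 ^ (q - 1) * (c ^ (q - 1) * (c * C₁) * (B * F) + c ^ (q - 1) * (c * C₂) * (B * F)) := by
        gcongr
        · exact h1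
        · exact h2
    _ = _ := by ring

lemma eLpNorm_weightMeasure {E : Type*} [ENorm E] {q : ℝ} (hq : 0 < q) {u : Rn n → ℝ≥0}
    (hu : AEMeasurable (fun x => (u x : ℝ≥0∞)) volume) (g : Rn n → E) :
    eLpNorm g (ENNReal.ofReal q) (weightMeasure u) = (∫⁻ x, ‖g x‖ₑ ^ q * u x) ^ (1 / q) := by
  rw [eLpNorm_eq_lintegral_rpow_enorm_toReal (by simpa using hq) ENNReal.ofReal_ne_top,
    ENNReal.toReal_ofReal hq.le, weightMeasure,
    lintegral_withDensity_eq_lintegral_mul_non_measurable₀ _ hu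
      (Filter.Eventually.of_forall fun x => ENNReal.coe_lt_top)]
  simp only [Pi.mul_apply, mul_comm]

lemma coe_prod_rpow_eq {p : ℝ} (hp : 0 ≤ p) {q : Fin m → ℝ} (hq : ∀ i, 0 < q i)
    (w : Fin m → Rn n → ℝ≥0) (x : Rn n) :
    (((∏ i, w i x) ^ p : ℝ≥0) : ℝ≥0∞) = ∏ i, ((w i x ^ q i : ℝ≥0) : ℝ≥0∞) ^ (p / q i) := by
  rw [← NNReal.finsetProd_rpow, ENNReal.ofNNReal_finsetProd]
  refine Finset.prod_congr rfl fun i _ => ?_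
  have h1 := (hq i).ne'
  rw [← ENNReal.coe_rpow_of_nonneg _ (div_nonneg hp (hq i).le), ← NNReal.rpow_mul]
  congr 2
  field_simp

/-- Hölder's inequality for products with product weights. -/
lemma lintegral_prod_rpow_mul_le {p : ℝ} (hp : 0 < p) {q : Fin m → ℝ} (hq : ∀ i, 0 < q i)
    (hpq : 1 / p = ∑ i, 1 / q i) {w : Fin m → Rn n → ℝ≥0}
    (hw : ∀ i, AEMeasurable (fun x => ((w i x ^ q i : ℝ≥0) : ℝ≥0∞)) volume)
    {G : Fin m → Rn n → ℝ≥0∞} (hG : ∀ i, Measurable (G i)) :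
    (∫⁻ x, (∏ i, G i x) ^ p * ((∏ i, w i x) ^ p : ℝ≥0)) ^ (1 / p) ≤
      ∏ i, (∫⁻ x, G i x ^ q i * (w i x ^ q i : ℝ≥0)) ^ (1 / q i) := by
  have h1 : ∀ x, (∏ i, G i x) ^ p * ((∏ i, w i x) ^ p : ℝ≥0) =
      ∏ i, (G i x ^ q i * (w i x ^ q i : ℝ≥0)) ^ (p / q i) := by
    intro x
    rw [coe_prod_rpow_eq hp.le hq, ← ENNReal.prod_rpow_of_nonneg hp.le,
      ← Finset.prod_mul_distrib]
    refine Finset.prod_congr rfl fun i _ => ?_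
    have h2 := (hq i).ne'
    rw [ENNReal.mul_rpow_of_nonneg _ _ (div_nonneg hp.le (hq i).le), ← ENNReal.rpow_mul,
      mul_div_cancel₀ _ h2]
  have h2 : ∑ i, p / q i = 1 := by
    simp_rw [div_eq_mul_one_div p]
    rw [← Finset.mul_sum, ← hpq]
    field_simp
  simp_rw [h1]
  calc _ ≤ (∏ i, (∫⁻ x, G i x ^ q i * (w i x ^ q i : ℝ≥0)) ^ (p / q i)) ^ (1 / p) := by
        gcongr
        exact ENNReal.lintegral_prod_norm_pow_le _
          (fun i _ => ((hG i).pow_const _).aemeasurable.mul (hw i)) h2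
          fun i _ => div_nonneg hp.le (hq i).le
    _ = _ := by
        rw [← ENNReal.prod_rpow_of_nonneg (by positivity)]
        refine Finset.prod_congr rfl fun i _ => ?_
        rw [← ENNReal.rpow_mul]
        congr 1
        field_simp

/-- The degenerate case: one weight vanishing almost everywhere makes the product measure zero. -/
lemma eLpNorm_S_eq_zero {θ : KernelFamily n m} {p : ℝ} (hp : 0 < p) {q : Fin m → ℝ}
    (hq : ∀ i, 0 < q i) {w : Fin m → Rn n → ℝ≥0} {i : Fin m} (hi : ∀ᵐ x : Rn n, w i x ^ q i = 0)
    (f : Fin m → Rn n → ℂ) :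
    eLpNorm (S θ f) (ENNReal.ofReal p) (weightMeasure fun x => (∏ i, w i x) ^ p) = 0 := by
  have h1 : (fun x => (((∏ i, w i x) ^ p : ℝ≥0) : ℝ≥0∞)) =ᵐ[volume] 0 := by
    filter_upwards [hi] with x hx
    rw [NNReal.rpow_eq_zero (hq i).ne'] at hx
    rw [Finset.prod_eq_zero (Finset.mem_univ i) hx, NNReal.zero_rpow hp.ne', ENNReal.coe_zero,
      Pi.zero_apply]
  rw [weightMeasure, withDensity_congr_ae h1, withDensity_zero, eLpNorm_measure_zero]

/-- The weighted estimate for the multilinear square function. -/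
lemma exists_eLpNorm_S_le {θ : KernelFamily n (m + 1)} (hθ : KernelMeasurable θ) {N γ : ℝ}
    (hN : (n : ℝ) < N) (hγ0 : 0 < γ) (hγ1 : γ ≤ 1) (hsize : SizeCondition θ N)
    (hreg : RegularityCondition θ γ)
    (hcancel : ∀ t : ℝ, 0 < t → Theta θ t (fun _ _ => 1) =ᵐ[volume] (fun _ => 0))
    {p : ℝ} {q : Fin (m + 1) → ℝ} (hp : 1 < p) (hq : ∀ i, 1 < q i) (hpq : 1 / p = ∑ i, 1 / q i) :
    ∃ C : ℝ≥0∞, C ≠ ∞ ∧ ∀ w : Fin (m + 1) → Rn n → ℝ≥0,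
      (∀ i, IsApWeight (q i) (fun x => w i x ^ q i)) → ∀ f : Fin (m + 1) → Rn n → ℂ,
        (∀ i, MemLp (f i) (ENNReal.ofReal (q i)) volume) →
        eLpNorm (S θ f) (ENNReal.ofReal p) (weightMeasure fun x => (∏ i, w i x) ^ p)
          ≤ C * (∏ i, (1 + ApConst (q i) (fun x => w i x ^ q i) ^ apExponent (q i))) *
              ∏ i, eLpNorm (f i) (ENNReal.ofReal (q i)) (weightMeasure fun x => w i x ^ q i) := by
  obtain ⟨β, hβ, C₀, hC₀, hS⟩ := exists_S_le hθ hN hγ0 hγ1 hsize hreg hcancel hq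
  choose C₁ hC₁ hG using fun i => exists_lintegral_maxSum_add_squareSum_le n (hq i) hβ
  have hp0 : 0 < p := by linarith
  have hq0 : ∀ i, 0 < q i := fun i => by linarith [hq i]
  refine ⟨C₀ * ∏ i, C₁ i ^ (1 / q i), ENNReal.mul_ne_top hC₀ (ENNReal.prod_ne_top fun i _ =>
    ENNReal.rpow_ne_top_of_nonneg (one_div_nonneg.2 (hq0 i).le) (hC₁ i)), fun w hw f hf => ?_⟩
  -- Either some weight is degenerate, or all are almost everywhere positive and the linear
  -- estimates apply.
  by_cases hz : ∃ i, ∀ᵐ x : Rn n, w i x ^ q i = 0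
  · obtain ⟨i, hi⟩ := hz
    rw [eLpNorm_S_eq_zero hp0 hq0 hi]
    exact zero_le
  · rw [not_exists] at hz
    have hne : ∀ i, ∀ᵐ x : Rn n, w i x ^ q i ≠ 0 := fun i =>
      ((hw i).ae_eq_zero_or (hq i)).resolve_left (hz i)
    have hloc : ∀ i, LocallyIntegrable (f i) := fun i =>
      (hf i).locallyIntegrable (by
        rw [← ENNReal.ofReal_one]
        exact ENNReal.ofReal_le_ofReal (hq i).le)
    have hwm : ∀ i, AEMeasurable (fun x => ((w i x ^ q i : ℝ≥0) : ℝ≥0∞)) volume := fun i =>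
      aemeasurable_coe_of_locallyIntegrable (hw i).1
    have hpm : AEMeasurable (fun x => (((∏ i, w i x) ^ p : ℝ≥0) : ℝ≥0∞)) volume := by
      simp_rw [coe_prod_rpow_eq hp0.le hq0]
      exact Finset.aemeasurable_fun_prod _ fun i _ => (hwm i).pow_const _
    set G : Fin (m + 1) → Rn n → ℝ≥0∞ := fun i x =>
      maxSum (fun y => ‖f i y‖ₑ) x + squareSum β (f i) x with hGdef
    rw [eLpNorm_weightMeasure hp0 hpm]
    calc _ ≤ (∫⁻ x, C₀ ^ p * ((∏ i, G i x) ^ p * ((∏ i, w i x) ^ p : ℝ≥0))) ^ (1 / p) := by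
          refine ENNReal.rpow_le_rpow (lintegral_mono_ae ?_) (by positivity)
          filter_upwards [hS f hf] with x hx
          rw [enorm_eq_self, ← mul_assoc, ← ENNReal.mul_rpow_of_nonneg _ _ hp0.le]
          gcongr
      _ = C₀ * (∫⁻ x, (∏ i, G i x) ^ p * ((∏ i, w i x) ^ p : ℝ≥0)) ^ (1 / p) := by
          rw [lintegral_const_mul' _ _ (ENNReal.rpow_ne_top_of_nonneg hp0.le hC₀),
            ENNReal.mul_rpow_of_nonneg _ _ (by positivity), ← ENNReal.rpow_mul,
            mul_one_div_cancel hp0.ne', ENNReal.rpow_one]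
      _ ≤ C₀ * ∏ i, (∫⁻ x, G i x ^ q i * (w i x ^ q i : ℝ≥0)) ^ (1 / q i) := by
          gcongr
          exact lintegral_prod_rpow_mul_le hp0 hq0 hpq hwm fun i =>
            (measurable_maxSum _).add (measurable_squareSum _ _)
      _ ≤ C₀ * ∏ i, (C₁ i ^ (1 / q i) *
            ((1 + ApConst (q i) (fun x => w i x ^ q i) ^ apExponent (q i)) *
              eLpNorm (f i) (ENNReal.ofReal (q i)) (weightMeasure fun x => w i x ^ q i))) := by
          refine mul_le_mul' le_rfl (Finset.prod_le_prod' fun i _ => ?_)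
          rw [eLpNorm_weightMeasure (hq0 i) (hwm i)]
          have hi : 0 ≤ 1 / q i := one_div_nonneg.2 (hq0 i).le
          refine (ENNReal.rpow_le_rpow (hG i _ (hw i) (hne i) (f i) (hloc i)) hi).trans_eq ?_
          rw [ENNReal.mul_rpow_of_nonneg _ _ hi, ENNReal.mul_rpow_of_nonneg _ _ hi,
            ← ENNReal.rpow_mul (1 + _), mul_one_div_cancel (hq0 i).ne', ENNReal.rpow_one]
      _ = _ := by
          rw [Finset.prod_mul_distrib, Finset.prod_mul_distrib]
          ring

end SquareFunction

theorem theorem2p5 (n m : ℕ) (hn : 0 < n)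
    (θ : SquareFunction.KernelFamily n m) (hθ : SquareFunction.KernelMeasurable θ)
    (N γ : ℝ) (hN : (n : ℝ) < N) (hγ0 : 0 < γ) (hγ1 : γ ≤ 1)
    (hsize : SquareFunction.SizeCondition θ N)
    (hreg : SquareFunction.RegularityCondition θ γ)
    (hcancel : ∀ t : ℝ, 0 < t →
      SquareFunction.Theta θ t (fun _ _ => 1) =ᵐ[volume] (fun _ => 0))
    (p : ℝ) (q : Fin m → ℝ) (hp : 1 < p) (hq : ∀ i, 1 < q i) (hpq : 1 / p = ∑ i, 1 / q i) :
    ∃ C : ℝ≥0, ∀ w : Fin m → SquareFunction.Rn n → ℝ≥0,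
      (∀ i, SquareFunction.IsApWeight (q i) (fun x => w i x ^ q i)) →
      ∀ f : Fin m → SquareFunction.Rn n → ℂ,
        (∀ i, MemLp (f i) (ENNReal.ofReal (q i))
          (SquareFunction.weightMeasure fun x => w i x ^ q i)) →
        (∀ i, MemLp (f i) (ENNReal.ofReal (q i)) volume) →
        eLpNorm (SquareFunction.S θ f) (ENNReal.ofReal p)
            (SquareFunction.weightMeasure fun x => (∏ i, w i x) ^ p)
          ≤ C * (∏ i, (1 + SquareFunction.ApConst (q i) (fun x => w i x ^ q i) ^
                (max 1 (Real.conjExponent (q i) / q i)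
                  + max (1 / 2) (Real.conjExponent (q i) / q i)))) *
              ∏ i, eLpNorm (f i) (ENNReal.ofReal (q i))
                (SquareFunction.weightMeasure fun x => w i x ^ q i) := by
  -- For m = 0 the exponent relation would read 1/p = 0.
  obtain _ | m := m
  · have : 0 < 1 / p := by positivity
    simp [hpq] at this
  · obtain ⟨C, hC, h⟩ := SquareFunction.exists_eLpNorm_S_le hθ hN hγ0 hγ1 hsize hreg
      hcancel hp hq hpq
    refine ⟨C.toNNReal, fun w hw f _ hf => ?_⟩
    rw [ENNReal.coe_toNNReal hC]
    exact h w hw f hf
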